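/- Let $M$ be a smooth ($C^\infty$, Hausdorff) four-dimensional manifold, $\Lambda\in\mathbb R$, and let $g_{ab}(\lambda)$, $\lambda\ge 0$, be a one-parameter family of smooth Lorentz metrics on $M$ of signature $(-,+,+,+)$. Put $\gamma_{ab}(\lambda)=g_{ab}(\lambda)-g_{ab}(0)$ and $g^{(0)}_{ab}=g_{ab}(0)$. Fix ($\lambda$-independent) a smooth Riemannian metric on $M$, with respect to which norms of tensors are taken, and a smooth derivative operator (affine connection) $\nabla_a$. A family $A_{a_1\dots a_k}(\lambda)$ of tensor fields is said to converge weakly to $A^{(0)}_{a_1\dots a_k}$ as $\lambda\to0^+$ if $\int f^{a_1\dots a_k}A_{a_1\dots a_k}(\lambda)\to\int f^{a_1\dots a_k}A^{(0)}_{a_1\dots a_k}$ for all smooth tensor fields $f^{a_1\dots a_k}$ of compact support. Assume: (i) for all $\lambda>0$, Einstein's equation $G_{ab}(g(\lambda))+\Lambda g_{ab}(\lambda)=8\pi T_{ab}(\lambda)$ holds, where $T_{ab}(\lambda)$ satisfies the weak energy condition: $T_{ab}(\lambda)t^at^b\ge0$ for all vectors $t^a$ that are timelike with respect to $g_{ab}(\lambda)$;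 (ii) there is a smooth positive function $C_1$ on $M$ with $|\gamma_{ab}(\lambda,x)|\le\lambda\,C_1(x)$ for all $\lambda>0$, $x\in M$; (iii) there is a smooth positive function $C_2$ on $M$ with $|\nabla_c\gamma_{ab}(\lambda,x)|\le C_2(x)$ for all $\lambda>0$, $x\in M$; (iv) there is a smooth tensor field $\mu_{abcdef}$ on $M$ such that $\nabla_a\gamma_{cd}(\lambda)\,\nabla_b\gamma_{ef}(\lambda)$ converges weakly to $\mu_{abcdef}$ as $\lambda\to0^+$. Then $T_{ab}(\lambda)$ converges weakly, as $\lambda\to0^+$, to a smooth tensor field $T^{(0)}_{ab}$, so that there is exactly one smooth tensor field $t^{(0)}_{ab}$, the effective stress-energy tensor, for which the averaged Einstein equation $$G_{ab}(g^{(0)})+\Lambda g^{(0)}_{ab}=8\pi\left(T^{(0)}_{ab}+t^{(0)}_{ab}\right)$$ holds; and it is traceless: $t^{(0)a}{}_a=g^{(0)ab}\,t^{(0)}_{ab}=0$. -/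

import Mathlib

open Filter Topology MeasureTheory
open scoped Manifold ContDiff

noncomputable section

/-- The model space of a four-dimensional spacetime. -/
abbrev E4 : Type := EuclideanSpace ℝ (Fin 4)

/-- Covariant tensor fields of rank `k` (no regularity imposed) on a four-manifold `M`. -/
abbrev TensorField (M : Type*) [TopologicalSpace M] [ChartedSpace E4 M] (k : ℕ) :=
  (x : M) → MultilinearMap ℝ (fun _ : Fin k => TangentSpace 𝓘(ℝ, E4) x) ℝ

/-- Coordinate charts of `M`. -/
abbrev Chart (M : Type*) [TopologicalSpace M] := OpenPartialHomeomorph M E4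

/-- Arrays of component functions: for each chart `e` and each multi-index, a function of the
coordinates `y ∈ e.target`. -/
abbrev Components (M : Type*) [TopologicalSpace M] (k : ℕ) :=
  Chart M → (Fin k → Fin 4) → E4 → ℝ

/-- All charts compatible with the smooth structure of `M`. -/
abbrev smoothCharts (M : Type*) [TopologicalSpace M] [ChartedSpace E4 M] : Set (Chart M) :=
  IsManifold.maximalAtlas 𝓘(ℝ, E4) ∞ M

section Coordinates

/-- The `i`-th partial derivative in coordinates. -/
def partialDeriv (i : Fin 4) (f : E4 → ℝ) (y : E4) : ℝ :=
  fderiv ℝ f y (EuclideanSpace.single i 1)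

/-- The inverse metric components `g^{ij}`. -/
def inverseMetric (g : (Fin 2 → Fin 4) → E4 → ℝ) (i j : Fin 4) (y : E4) : ℝ :=
  (Matrix.of fun a b : Fin 4 => g ![a, b] y)⁻¹ i j

/-- Christoffel symbols
`Γ^k_{ij} = (1/2) g^{kl} (∂_i g_{jl} + ∂_j g_{il} - ∂_l g_{ij})`. -/
def christoffel (g : (Fin 2 → Fin 4) → E4 → ℝ) (k i j : Fin 4) (y : E4) : ℝ :=
  (1 / 2) * ∑ l, inverseMetric g k l y *
    (partialDeriv i (g ![j, l]) y + partialDeriv j (g ![i, l]) y - partialDeriv l (g ![i, j]) y)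

/-- Ricci tensor
`R_{ij} = ∂_k Γ^k_{ij} - ∂_j Γ^k_{ki} + Γ^k_{kl} Γ^l_{ij} - Γ^k_{jl} Γ^l_{ik}`. -/
def ricci (g : (Fin 2 → Fin 4) → E4 → ℝ) (i j : Fin 4) (y : E4) : ℝ :=
  ∑ k, (partialDeriv k (christoffel g k i j) y - partialDeriv j (christoffel g k k i) y) +
    ∑ k, ∑ l, (christoffel g k k l y * christoffel g l i j y -
      christoffel g k j l y * christoffel g l i k y)

/-- The trace `g^{ij} A_{ij}` of a covariant 2-tensor. -/
def metricTrace (g : (Fin 2 → Fin 4) → E4 → ℝ) (A : Fin 4 → Fin 4 → E4 → ℝ) (y : E4) : ℝ :=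
  ∑ i, ∑ j, inverseMetric g i j y * A i j y

/-- Einstein tensor `G_{ij} = R_{ij} - (1/2) R g_{ij}`. -/
def einstein (g : (Fin 2 → Fin 4) → E4 → ℝ) (i j : Fin 4) (y : E4) : ℝ :=
  ricci g i j y - (1 / 2) * metricTrace g (ricci g) y * g ![i, j] y

end Coordinates

section Manifold

variable {M : Type*} [TopologicalSpace M] [ChartedSpace E4 M]

/-- The vector field with constant components `v` in the chart `e` (meaningful on `e.source`). -/
def coordField (e : Chart M) (v : E4) : (x : M) → TangentSpace 𝓘(ℝ, E4) x :=
  VectorField.mpullback 𝓘(ℝ, E4) 𝓘(ℝ, E4) e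
    (fun y => (NormedSpace.fromTangentSpace y).symm v)

/-- The coordinate vector field `∂_i` of the chart `e`. -/
def coordFrame (e : Chart M) (i : Fin 4) : (x : M) → TangentSpace 𝓘(ℝ, E4) x :=
  coordField e (EuclideanSpace.single i 1)

/-- Components of a tensor field in the coordinate basis of each chart. -/
def TensorField.comp {k : ℕ} (A : TensorField M k) : Components M k :=
  fun e idx y => A (e.symm y) (fun m => coordFrame e (idx m) (e.symm y))

/-- A tensor field is smooth if all its components in all smooth charts are. -/
def TensorField.Smooth {k : ℕ} (A : TensorField M k) : Prop :=
  ∀ e ∈ smoothCharts M, ∀ idx, ContDiffOn ℝ ∞ (A.comp e idx) e.target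

/-- Smooth metrics of Lorentz signature `(-,+,+,+)`. -/
structure IsLorentzMetric (g : TensorField M 2) : Prop where
  smooth : g.Smooth
  symm : ∀ (x : M) (u v : TangentSpace 𝓘(ℝ, E4) x), g x ![u, v] = g x ![v, u]
  signature : ∀ x : M, ∃ b : Module.Basis (Fin 4) ℝ (TangentSpace 𝓘(ℝ, E4) x), ∀ i j,
    g x ![b i, b j] = if i = j then (if i = 0 then -1 else 1) else 0

/-- `T` satisfies the weak energy condition with respect to `g`: `T_{ab} t^a t^b ≥ 0` for all
`g`-timelike vectors `t`. -/
def WeakEnergyCondition (g T : TensorField M 2) : Prop :=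
  ∀ (x : M) (t : TangentSpace 𝓘(ℝ, E4) x), g x ![t, t] < 0 → 0 ≤ T x ![t, t]

/-- Einstein's equation `G_{ab}(g) + Λ g_{ab} = 8π T_{ab}`. -/
def EinsteinEquation (Λ : ℝ) (g T : TensorField M 2) : Prop :=
  ∀ e ∈ smoothCharts M, ∀ y ∈ e.target, ∀ i j : Fin 4,
    einstein (g.comp e) i j y + Λ * g.comp e ![i, j] y = 8 * Real.pi * T.comp e ![i, j] y

/-- Vanishing of the trace `g^{ab} A_{ab}`. -/
def Traceless (g A : TensorField M 2) : Prop :=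
  ∀ e ∈ smoothCharts M, ∀ y ∈ e.target,
    metricTrace (g.comp e) (fun i j => A.comp e ![i, j]) y = 0

/-- The pointwise bound `|A| ≤ c`, where `|A|` is the norm of the multilinear form with components
`A` with respect to the Riemannian metric `h`. -/
def NormLE {k : ℕ} [IsManifold 𝓘(ℝ, E4) ∞ M]
    (h : Bundle.ContMDiffRiemannianMetric 𝓘(ℝ, E4) ∞ E4
      (TangentSpace 𝓘(ℝ, E4) : M → Type))
    (A : Components M k) (c : M → ℝ) : Prop :=
  ∀ e ∈ smoothCharts M, ∀ y ∈ e.target, ∀ u : Fin k → E4,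
    |∑ idx : Fin k → Fin 4, A e idx y * ∏ m, u m (idx m)| ≤
      c (e.symm y) * ∏ m, Real.sqrt (h.inner (e.symm y)
        (coordField e (u m) (e.symm y)) (coordField e (u m) (e.symm y)))

/-- The components `∇_c γ_{ab}` (indices in the order `c, a, b`) of the covariant derivative:
`(∇_Z γ)(X, Y) = Z (γ(X, Y)) - γ(∇_Z X, Y) - γ(X, ∇_Z Y)` for coordinate fields `X, Y, Z`. -/
def covDeriv [IsManifold 𝓘(ℝ, E4) ∞ M]
    (D : CovariantDerivative 𝓘(ℝ, E4) E4 (TangentSpace 𝓘(ℝ, E4) : M → Type))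
    (γ : TensorField M 2) : Components M 3 := fun e idx y =>
  partialDeriv (idx 0) (γ.comp e ![idx 1, idx 2]) y
    - γ (e.symm y) ![D (coordFrame e (idx 1)) (e.symm y) (coordFrame e (idx 0) (e.symm y)),
        coordFrame e (idx 2) (e.symm y)]
    - γ (e.symm y) ![coordFrame e (idx 1) (e.symm y),
        D (coordFrame e (idx 2)) (e.symm y) (coordFrame e (idx 0) (e.symm y))]

/-- The components of `A_{acd} A_{bef}`, with indices in the order `a, b, c, d, e, f`. -/
def quadraticProduct (A : Components M 3) : Components M 6 := fun e idx y =>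
  A e ![idx 0, idx 2, idx 3] y * A e ![idx 1, idx 4, idx 5] y

/-- `A(s)` converges weakly to `A₀` as `s → 0⁺`:
`∫ f^{a_1…a_k} A_{a_1…a_k}(s) → ∫ f^{a_1…a_k} A₀_{a_1…a_k}` for all smooth compactly supported
test fields `f`, here with support in an arbitrary coordinate domain and expressed in the
coordinates (the positive smooth density relating a fixed volume element to `dy` is absorbed in
`f`; test fields with larger compact support are finite sums of such fields). -/
def WeakLimit {k : ℕ} (A : ℝ → Components M k) (A₀ : Components M k) : Prop :=
  ∀ e ∈ smoothCharts M, ∀ f : (Fin k → Fin 4) → E4 → ℝ,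
    (∀ idx, ContDiff ℝ ∞ (f idx) ∧ HasCompactSupport (f idx) ∧ tsupport (f idx) ⊆ e.target) →
    Tendsto (fun s => ∫ y, ∑ idx, f idx y * A s e idx y) (𝓝[>] 0)
      (𝓝 (∫ y, ∑ idx, f idx y * A₀ e idx y))

/-- `t₀` is the effective stress-energy tensor of the family `(g(s), T(s))`: the smooth tensor
field that appears, beside the averaged (weak limit) matter stress-energy tensor `T₀`, as a source
in the averaged Einstein equation `G_{ab}(g(0)) + Λ g_{ab}(0) = 8π (T₀_{ab} + t₀_{ab})`. -/
def IsEffectiveStressEnergy (Λ : ℝ) (g T : ℝ → TensorField M 2) (t₀ : TensorField M 2) : Prop :=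
  t₀.Smooth ∧ ∃ T₀ : TensorField M 2, T₀.Smooth ∧
    WeakLimit (fun s => (T s).comp) T₀.comp ∧ EinsteinEquation Λ (g 0) (T₀ + t₀)

end Manifold

end

/-! Work in one chart. Write γ = g(s) − g(0), N for the inverse of g(0), p = ∂γ and C^k_{ij} = ½
N^{ka}(p_{ija} + p_{jia} − p_{aij}). Since γ = O(s) and p is bounded, Γ(g(s)) = Γ(g(0)) + C + O(s)
uniformly on compact sets, where C is bounded and tends weakly to zero. Terms linear in C average
out, products of two C's do not, so Ricci(g(s)) tends weakly to Ricci(g(0)) + Q, where Q is the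
limit of C^k_{kl}C^l_{ij} − C^k_{jl}C^l_{ik} and is algebraic in μ and N (`weakTo_ricci`).

The energy condition supplies compactness. Second derivatives of γ are not controlled pointwise, but
integration by parts bounds the Einstein tensor as a distribution (`distBounded_einstein`). Put E =
G + Λg = 8πT. For a constant coordinate vector v that is timelike for g(0) at a point, E(v,v) ≥ 0
near that point for small s, and a nonnegative family bounded as a distribution is bounded in L¹.
The timelike cone is open, so polarization bounds every symmetrized component of E, and trace
reversal then bounds the symmetrized Ricci tensor in L¹ (`l1Bounded_ricci`).

Hence γ_{ab}(R_{cd} + R_{dc}) tends weakly to zero, being O(s) times an L¹-bounded family. Moving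
the derivative in Ricci onto γ shows that γ_{ab}R_{cd} behaves weakly like −(p_{kab}C^k_{cd} −
p_{dab}C^k_{kc}). So these quadratic expressions, symmetrized in c and d, have weak limit zero
(`weakTo_gradKoszul`). The algebraic identity `trace_raisedKoszul_mul` writes the g(0)-trace of the
quadratic part of Ricci as a combination of their contractions, and therefore tr Q = 0
(`trace_quadRicci`).

The L¹ bound also permits replacing g(s) by g(0) in the scalar curvature term, so G(g(s)) tends
weakly to G(g(0)) + Q − ½(tr Q) g(0) = G(g(0)) + Q (`weakTo_einstein`). Einstein's equation then
yields the limit of T, and the effective tensor must be −Q/8π, which is traceless. Globally, weak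
limits transform as tensor components by change of variables, Q is built independently of the basis,
and continuous weak limits are unique. -/

/-! ### Modes of convergence and boundedness for families of functions on a coordinate domain. -/

/-- Test functions supported in `U`. -/
structure IsTest (U : Set E4) (f : E4 → ℝ) : Prop where
  smooth : ContDiff ℝ ∞ f
  compact : HasCompactSupport f
  subset : tsupport f ⊆ U

/-- `u s = O(s ^ n)` as `s → 0⁺`, uniformly on compact subsets of `U`. -/
structure UniformO (U : Set E4) (n : ℕ) (u : ℝ → E4 → ℝ) : Prop where
  cont : ∀ s, 0 < s → ContinuousOn (u s) U
  bound : ∀ K ⊆ U, IsCompact K → ∃ C : ℝ, 0 ≤ C ∧ ∀ᶠ s in 𝓝[>] (0 : ℝ), ∀ y ∈ K, |u s y| ≤ C * s ^ n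

/-- `u s` converges to `F` as `s → 0⁺` in the sense of distributions on `U`. -/
structure WeakTo (U : Set E4) (u : ℝ → E4 → ℝ) (F : E4 → ℝ) : Prop where
  cont : ∀ s, 0 < s → ContinuousOn (u s) U
  cont_lim : ContinuousOn F U
  tendsto : ∀ f, IsTest U f → Tendsto (fun s => ∫ y, f y * u s y) (𝓝[>] 0) (𝓝 (∫ y, f y * F y))

/-- `u s` is bounded in `L¹` on compact subsets of `U` for small `s > 0`. -/
structure L1Bounded (U : Set E4) (u : ℝ → E4 → ℝ) : Prop where
  cont : ∀ s, 0 < s → ContinuousOn (u s) U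
  bound : ∀ K ⊆ U, IsCompact K → ∃ C : NNReal, ∀ᶠ s in 𝓝[>] (0 : ℝ), ∫⁻ y in K, ‖u s y‖ₑ ≤ C

/-- `u s` is bounded as a distribution on `U` for small `s > 0`. -/
structure DistBounded (U : Set E4) (u : ℝ → E4 → ℝ) : Prop where
  cont : ∀ s, 0 < s → ContinuousOn (u s) U
  bound : ∀ f, IsTest U f → ∃ C : ℝ, ∀ᶠ s in 𝓝[>] (0 : ℝ), |∫ y, f y * u s y| ≤ C

/-- `u s` is smooth, `O(s)`-close to `u₀`, and has bounded first derivatives. -/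
structure NearTo (U : Set E4) (u : ℝ → E4 → ℝ) (u₀ : E4 → ℝ) : Prop where
  smooth : ∀ s, 0 < s → ContDiffOn ℝ ∞ (u s) U
  smooth_lim : ContDiffOn ℝ ∞ u₀ U
  near : UniformO U 1 (fun s y => u s y - u₀ y)
  deriv : ∀ i, UniformO U 0 (fun s => partialDeriv i (u s))

/-! ### Partial derivatives, test functions, and the algebra of these modes of convergence. -/

section Calculus

variable {U : Set E4}

theorem eventually_pos_right : ∀ᶠ s in 𝓝[>] (0 : ℝ), 0 < s := eventually_mem_nhdsWithin

theorem eventually_lt_one_right : ∀ᶠ s in 𝓝[>] (0 : ℝ), s < 1 :=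
  eventually_nhdsWithin_of_eventually_nhds (gt_mem_nhds one_pos)

theorem ContDiffOn.partialDeriv (hU : IsOpen U) {f : E4 → ℝ} (hf : ContDiffOn ℝ ∞ f U) (i : Fin 4) :
    ContDiffOn ℝ ∞ (_root_.partialDeriv i f) U :=
  (hf.fderiv_of_isOpen hU (by simp)).clm_apply contDiffOn_const

theorem ContDiff.partialDeriv {f : E4 → ℝ} (hf : ContDiff ℝ ∞ f) (i : Fin 4) :
    ContDiff ℝ ∞ (_root_.partialDeriv i f) :=
  (hf.fderiv_right (by simp)).clm_apply contDiff_const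

theorem ContDiffOn.diffAt (hU : IsOpen U) {f : E4 → ℝ} (hf : ContDiffOn ℝ ∞ f U) {y : E4}
    (hy : y ∈ U) : DifferentiableAt ℝ f y :=
  ((hf.contDiffAt (hU.mem_nhds hy)).differentiableAt (by simp))

theorem partialDeriv_congr (hU : IsOpen U) {f g : E4 → ℝ} (h : Set.EqOn f g U) (i : Fin 4) :
    Set.EqOn (partialDeriv i f) (partialDeriv i g) U := fun y hy => by
  have : f =ᶠ[𝓝 y] g := Filter.eventually_of_mem (hU.mem_nhds hy) h
  simp only [partialDeriv, this.fderiv_eq]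

theorem partialDeriv_add {f g : E4 → ℝ} {y : E4} (hf : DifferentiableAt ℝ f y)
    (hg : DifferentiableAt ℝ g y) (i : Fin 4) :
    partialDeriv i (fun z => f z + g z) y = partialDeriv i f y + partialDeriv i g y := by
  simp [partialDeriv, fderiv_fun_add hf hg]

theorem partialDeriv_sub {f g : E4 → ℝ} {y : E4} (hf : DifferentiableAt ℝ f y)
    (hg : DifferentiableAt ℝ g y) (i : Fin 4) :
    partialDeriv i (fun z => f z - g z) y = partialDeriv i f y - partialDeriv i g y := by
  simp [partialDeriv, fderiv_fun_sub hf hg]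

theorem partialDeriv_mul {f g : E4 → ℝ} {y : E4} (hf : DifferentiableAt ℝ f y)
    (hg : DifferentiableAt ℝ g y) (i : Fin 4) :
    partialDeriv i (fun z => f z * g z) y =
      partialDeriv i f y * g y + f y * partialDeriv i g y := by
  simp [partialDeriv, fderiv_fun_mul hf hg]; ring

theorem partialDeriv_inv {f : E4 → ℝ} {y : E4} (hf : DifferentiableAt ℝ f y) (h0 : f y ≠ 0)
    (i : Fin 4) :
    partialDeriv i (fun z => (f z)⁻¹) y = - (partialDeriv i f y * ((f y)⁻¹ * (f y)⁻¹)) := by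
  have h : HasFDerivAt (fun z => (f z)⁻¹) _ y := (hasFDerivAt_inv h0).comp y hf.hasFDerivAt
  simp only [partialDeriv, h.fderiv]
  simp [pow_two]

namespace IsTest

/-- The factor `a` need only be smooth on `U`: off the support of `f` the product vanishes locally,
so it is smooth on the whole space. -/
theorem mul_smooth (hU : IsOpen U) {f a : E4 → ℝ} (hf : IsTest U f) (ha : ContDiffOn ℝ ∞ a U) :
    IsTest U (fun y => f y * a y) where
  smooth := by
    rw [contDiff_iff_contDiffAt]
    intro y
    by_cases hy : y ∈ tsupport f
    · exact hf.smooth.contDiffAt.mul (ha.contDiffAt (hU.mem_nhds (hf.subset hy)))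
    · refine (contDiffAt_const (c := (0 : ℝ))).congr_of_eventuallyEq ?_
      filter_upwards [(isClosed_tsupport f).isOpen_compl.mem_nhds hy] with z hz
      simp [image_eq_zero_of_notMem_tsupport hz]
  compact := hf.compact.mul_right
  subset := tsupport_mul_subset_left.trans hf.subset

theorem partialDeriv {f : E4 → ℝ} (hf : IsTest U f) (i : Fin 4) :
    IsTest U (_root_.partialDeriv i f) where
  smooth := hf.smooth.partialDeriv i
  compact := hf.compact.fderiv_apply (𝕜 := ℝ) _
  subset := (tsupport_fderiv_apply_subset ℝ _).trans hf.subset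

theorem continuous_mul (hU : IsOpen U) {f a : E4 → ℝ} (hf : IsTest U f) (ha : ContinuousOn a U) :
    Continuous (fun y => f y * a y) := by
  refine continuous_of_tsupport fun y hy => ?_
  have hy' := hf.subset (tsupport_mul_subset_left hy)
  exact hf.smooth.continuous.continuousAt.mul (ha.continuousAt (hU.mem_nhds hy'))

theorem integrable_mul (hU : IsOpen U) {f a : E4 → ℝ} (hf : IsTest U f) (ha : ContinuousOn a U) :
    Integrable (fun y => f y * a y) :=
  (hf.continuous_mul hU ha).integrable_of_hasCompactSupport hf.compact.mul_right

theorem mono {V : Set E4} {f : E4 → ℝ} (hf : IsTest U f) (h : U ⊆ V) : IsTest V f :=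
  ⟨hf.smooth, hf.compact, hf.subset.trans h⟩

theorem integral_congr {f a b : E4 → ℝ} (hf : IsTest U f) (h : Set.EqOn a b U) :
    ∫ y, f y * a y = ∫ y, f y * b y := by
  congr 1; ext y
  by_cases hy : y ∈ tsupport f
  · rw [h (hf.subset hy)]
  · simp [image_eq_zero_of_notMem_tsupport hy]

theorem integral_partialDeriv (hU : IsOpen U) {f u : E4 → ℝ} (hf : IsTest U f)
    (hu : ContDiffOn ℝ ∞ u U) (i : Fin 4) :
    ∫ y, f y * _root_.partialDeriv i u y = - ∫ y, _root_.partialDeriv i f y * u y := by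
  refine integral_mul_fderiv_eq_neg_fderiv_mul_of_integrable ?_ ?_ ?_ ?_ ?_
  · exact (hf.partialDeriv i).integrable_mul hU hu.continuousOn
  · exact hf.integrable_mul hU (hu.partialDeriv hU i).continuousOn
  · exact hf.integrable_mul hU hu.continuousOn
  · exact fun x _ => hf.smooth.differentiable (by simp) x
  · exact fun x hx => hu.diffAt hU (hf.subset hx)

theorem exists_bound {f : E4 → ℝ} (hf : IsTest U f) : ∃ C : ℝ, 0 ≤ C ∧ ∀ y, |f y| ≤ C := by
  obtain ⟨C, hC⟩ := hf.smooth.continuous.bounded_above_of_compact_support hf.compact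
  exact ⟨C, (norm_nonneg _).trans (hC 0), hC⟩

end IsTest

namespace UniformO

variable {n m : ℕ} {u v : ℝ → E4 → ℝ}

theorem congr (hu : UniformO U n u) (h : ∀ s, 0 < s → Set.EqOn (v s) (u s) U) : UniformO U n v where
  cont s hs := (hu.cont s hs).congr (h s hs)
  bound K hK hKc := by
    obtain ⟨C, h0, hC⟩ := hu.bound K hK hKc
    refine ⟨C, h0, ?_⟩
    filter_upwards [hC, eventually_pos_right] with s h1 h2 y hy
    rw [h s h2 (hK hy)]; exact h1 y hy

theorem add (hu : UniformO U n u) (hv : UniformO U n v) :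
    UniformO U n (fun s y => u s y + v s y) where
  cont s hs := (hu.cont s hs).add (hv.cont s hs)
  bound K hK hKc := by
    obtain ⟨C, h0, hC⟩ := hu.bound K hK hKc
    obtain ⟨D, h0', hD⟩ := hv.bound K hK hKc
    refine ⟨C + D, by positivity, ?_⟩
    filter_upwards [hC, hD] with s h1 h2 y hy
    have := abs_add_le (u s y) (v s y)
    linarith [h1 y hy, h2 y hy]

theorem mul (hu : UniformO U n u) (hv : UniformO U m v) :
    UniformO U (n + m) (fun s y => u s y * v s y) where
  cont s hs := (hu.cont s hs).mul (hv.cont s hs)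
  bound K hK hKc := by
    obtain ⟨C, h0, hC⟩ := hu.bound K hK hKc
    obtain ⟨D, h0', hD⟩ := hv.bound K hK hKc
    refine ⟨C * D, by positivity, ?_⟩
    filter_upwards [hC, hD] with s h1 h2 y hy
    rw [abs_mul, pow_add]
    calc |u s y| * |v s y| ≤ (C * s ^ n) * (D * s ^ m) :=
          mul_le_mul (h1 y hy) (h2 y hy) (abs_nonneg _) ((abs_nonneg _).trans (h1 y hy))
      _ = _ := by ring

theorem of_continuousOn {a : E4 → ℝ} (ha : ContinuousOn a U) : UniformO U 0 (fun _ => a) where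
  cont _ _ := ha
  bound K hK hKc := by
    obtain ⟨C, hC⟩ := hKc.exists_bound_of_continuousOn (ha.mono hK)
    refine ⟨max C 0, le_max_right _ _, Eventually.of_forall fun s y hy => ?_⟩
    simpa using Or.inl (hC y hy)

theorem const_mul (hu : UniformO U n u) {a : E4 → ℝ} (ha : ContinuousOn a U) :
    UniformO U n (fun s y => a y * u s y) := by
  simpa using (of_continuousOn ha).mul hu

theorem neg (hu : UniformO U n u) : UniformO U n (fun s y => - u s y) :=
  (hu.const_mul (continuousOn_const (c := (-1 : ℝ)))).congr fun s _ y _ => by simp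

theorem sub (hu : UniformO U n u) (hv : UniformO U n v) :
    UniformO U n (fun s y => u s y - v s y) :=
  (hu.add hv.neg).congr fun s _ y _ => by simp [sub_eq_add_neg]

theorem zero : UniformO U n (fun _ _ => 0) where
  cont _ _ := continuousOn_const
  bound K _ _ := ⟨0, le_rfl, by simp⟩

theorem sum {ι : Type*} {t : Finset ι} {u : ι → ℝ → E4 → ℝ} (hu : ∀ i ∈ t, UniformO U n (u i)) :
    UniformO U n (fun s y => ∑ i ∈ t, u i s y) := by
  classical
  induction t using Finset.induction_on with
  | empty => simpa using zero
  | insert a t ha ih =>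
    simp only [Finset.sum_insert ha]
    exact (hu a (by simp)).add (ih fun i hi => hu i (by simp [hi]))

theorem to_zero (hu : UniformO U n u) : UniformO U 0 u where
  cont := hu.cont
  bound K hK hKc := by
    obtain ⟨C, h0, hC⟩ := hu.bound K hK hKc
    refine ⟨C, h0, ?_⟩
    filter_upwards [hC, eventually_pos_right, eventually_lt_one_right] with s h1 h2 h3 y hy
    refine (h1 y hy).trans ?_
    rw [pow_zero]
    gcongr
    exact pow_le_one₀ h2.le h3.le

theorem one_mul_zero (hu : UniformO U 1 u) (hv : UniformO U 0 v) :
    UniformO U 1 (fun s y => u s y * v s y) := hu.mul hv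

theorem zero_mul_one (hu : UniformO U 0 u) (hv : UniformO U 1 v) :
    UniformO U 1 (fun s y => u s y * v s y) := by simpa using hu.mul hv

theorem zero_mul_zero (hu : UniformO U 0 u) (hv : UniformO U 0 v) :
    UniformO U 0 (fun s y => u s y * v s y) := hu.mul hv

theorem l1Bounded (hu : UniformO U 0 u) : L1Bounded U u where
  cont := hu.cont
  bound K hK hKc := by
    obtain ⟨C, h0, hC⟩ := hu.bound K hK hKc
    refine ⟨(C.toNNReal * (volume K).toNNReal), ?_⟩
    filter_upwards [hC] with s h1
    calc ∫⁻ y in K, ‖u s y‖ₑ ≤ ∫⁻ y in K, (C.toNNReal : ENNReal) := by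
          refine setLIntegral_mono' hKc.measurableSet fun y hy => ?_
          rw [Real.enorm_eq_ofReal_abs]
          exact ENNReal.ofReal_le_ofReal (by simpa using h1 y hy)
      _ = _ := by
          rw [setLIntegral_const, ENNReal.coe_mul, ENNReal.coe_toNNReal hKc.measure_lt_top.ne]

end UniformO

namespace WeakTo

variable {u v : ℝ → E4 → ℝ} {F G : E4 → ℝ}

theorem congr (hu : WeakTo U u F) (h : ∀ s, 0 < s → Set.EqOn (v s) (u s) U)
    (hG : Set.EqOn G F U) : WeakTo U v G where
  cont s hs := (hu.cont s hs).congr (h s hs)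
  cont_lim := hu.cont_lim.congr hG
  tendsto f hf := by
    rw [hf.integral_congr hG]
    refine (hu.tendsto f hf).congr' ?_
    filter_upwards [eventually_pos_right] with s hs
    exact (hf.integral_congr (h s hs)).symm

theorem add (hU : IsOpen U) (hu : WeakTo U u F) (hv : WeakTo U v G) :
    WeakTo U (fun s y => u s y + v s y) (fun y => F y + G y) where
  cont s hs := (hu.cont s hs).add (hv.cont s hs)
  cont_lim := hu.cont_lim.add hv.cont_lim
  tendsto f hf := by
    simp only [mul_add]
    rw [integral_add (hf.integrable_mul hU hu.cont_lim) (hf.integrable_mul hU hv.cont_lim)]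
    refine ((hu.tendsto f hf).add (hv.tendsto f hf)).congr' ?_
    filter_upwards [eventually_pos_right] with s hs
    rw [integral_add (hf.integrable_mul hU (hu.cont s hs)) (hf.integrable_mul hU (hv.cont s hs))]

theorem smooth_mul (hU : IsOpen U) (hu : WeakTo U u F) {a : E4 → ℝ} (ha : ContDiffOn ℝ ∞ a U) :
    WeakTo U (fun s y => a y * u s y) (fun y => a y * F y) where
  cont s hs := ha.continuousOn.mul (hu.cont s hs)
  cont_lim := ha.continuousOn.mul hu.cont_lim
  tendsto f hf := by
    simpa only [mul_assoc] using hu.tendsto _ (hf.mul_smooth hU ha)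

theorem const_mul (hU : IsOpen U) (hu : WeakTo U u F) (c : ℝ) :
    WeakTo U (fun s y => c * u s y) (fun y => c * F y) :=
  hu.smooth_mul hU contDiffOn_const

theorem neg (hU : IsOpen U) (hu : WeakTo U u F) :
    WeakTo U (fun s y => - u s y) (fun y => - F y) :=
  (hu.const_mul hU (-1)).congr (fun s _ y _ => by simp) (fun y _ => by simp)

theorem sub (hU : IsOpen U) (hu : WeakTo U u F) (hv : WeakTo U v G) :
    WeakTo U (fun s y => u s y - v s y) (fun y => F y - G y) :=
  (hu.add hU (hv.neg hU)).congr (fun s _ y _ => by simp [sub_eq_add_neg])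
    (fun y _ => by simp [sub_eq_add_neg])

theorem const (hF : ContinuousOn F U) : WeakTo U (fun _ => F) F :=
  ⟨fun _ _ => hF, hF, fun _ _ => tendsto_const_nhds⟩

theorem sum (hU : IsOpen U) {ι : Type*} {t : Finset ι} {u : ι → ℝ → E4 → ℝ} {F : ι → E4 → ℝ}
    (hu : ∀ i ∈ t, WeakTo U (u i) (F i)) :
    WeakTo U (fun s y => ∑ i ∈ t, u i s y) (fun y => ∑ i ∈ t, F i y) := by
  classical
  induction t using Finset.induction_on with
  | empty => simpa using const continuousOn_const
  | insert a t ha ih =>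
    simp only [Finset.sum_insert ha]
    exact (hu a (by simp)).add hU (ih fun i hi => hu i (by simp [hi]))

/-- The derivative is moved onto the test function. The limit is taken to be zero because a general
limit in `WeakTo` is only continuous and need not be differentiable. -/
theorem partialDeriv (hU : IsOpen U) (hu : WeakTo U u (fun _ => 0))
    (hs : ∀ s, 0 < s → ContDiffOn ℝ ∞ (u s) U) (i : Fin 4) :
    WeakTo U (fun s => _root_.partialDeriv i (u s)) (fun _ => 0) where
  cont s h := ((hs s h).partialDeriv hU i).continuousOn
  cont_lim := continuousOn_const
  tendsto f hf := by
    have := (hu.tendsto _ (hf.partialDeriv i)).neg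
    simp only [mul_zero, integral_zero, neg_zero] at this ⊢
    refine this.congr' ?_
    filter_upwards [eventually_pos_right] with s h
    rw [hf.integral_partialDeriv hU (hs s h)]

/-- The fundamental lemma of the calculus of variations gives equality almost everywhere; continuity
of both limits turns it into equality at every point of `U`. -/
theorem unique (hU : IsOpen U) (hF : WeakTo U u F) (hG : WeakTo U u G) : Set.EqOn F G U := by
  have hd : ContinuousOn (fun y => F y - G y) U := hF.cont_lim.sub hG.cont_lim
  have h := hU.ae_eq_zero_of_integral_contDiff_smul_eq_zero (μ := (volume : Measure E4))
    (f := fun y => F y - G y) (hd.locallyIntegrableOn hU.measurableSet) (by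
      intro f h1 h2 h3
      have hf : IsTest U f := ⟨h1, h2, h3⟩
      have := tendsto_nhds_unique (hF.tendsto f hf) (hG.tendsto f hf)
      simp only [smul_eq_mul, mul_sub]
      rw [integral_sub (hf.integrable_mul hU hF.cont_lim) (hf.integrable_mul hU hG.cont_lim), this,
        sub_self])
  have h2 := Measure.eqOn_open_of_ae_eq (μ := (volume : Measure E4)) (U := U)
    (f := fun y => F y - G y) (g := fun _ => 0)
    ((ae_restrict_iff' hU.measurableSet).2 h) hU hd continuousOn_const
  exact fun y hy => sub_eq_zero.1 (h2 hy)

theorem mono {V : Set E4} (hu : WeakTo U u F) (h : V ⊆ U) : WeakTo V u F where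
  cont s hs := (hu.cont s hs).mono h
  cont_lim := hu.cont_lim.mono h
  tendsto f hf := hu.tendsto f (hf.mono h)

end WeakTo

namespace L1Bounded

variable {u v : ℝ → E4 → ℝ}

theorem congr (hu : L1Bounded U u) (h : ∀ s, 0 < s → Set.EqOn (v s) (u s) U) : L1Bounded U v where
  cont s hs := (hu.cont s hs).congr (h s hs)
  bound K hK hKc := by
    obtain ⟨C, hC⟩ := hu.bound K hK hKc
    refine ⟨C, ?_⟩
    filter_upwards [hC, eventually_pos_right] with s h1 h2
    rwa [setLIntegral_congr_fun (g := fun y => ‖u s y‖ₑ) hKc.measurableSet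
      (fun y hy => by simp only [h s h2 (hK hy)])]

theorem add (hu : L1Bounded U u) (hv : L1Bounded U v) :
    L1Bounded U (fun s y => u s y + v s y) where
  cont s hs := (hu.cont s hs).add (hv.cont s hs)
  bound K hK hKc := by
    obtain ⟨C, hC⟩ := hu.bound K hK hKc
    obtain ⟨D, hD⟩ := hv.bound K hK hKc
    refine ⟨C + D, ?_⟩
    filter_upwards [hC, hD, eventually_pos_right] with s h1 h2 h3
    calc ∫⁻ y in K, ‖u s y + v s y‖ₑ ≤ ∫⁻ y in K, (‖u s y‖ₑ + ‖v s y‖ₑ) :=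
          lintegral_mono fun y => enorm_add_le _ _
      _ = (∫⁻ y in K, ‖u s y‖ₑ) + ∫⁻ y in K, ‖v s y‖ₑ :=
          lintegral_add_left' (((hu.cont s h3).mono hK).aemeasurable hKc.measurableSet).enorm _
      _ ≤ _ := by push_cast; gcongr

theorem bounded_mul (hu : L1Bounded U u) {a : ℝ → E4 → ℝ} (ha : UniformO U 0 a) :
    L1Bounded U (fun s y => a s y * u s y) where
  cont s hs := (ha.cont s hs).mul (hu.cont s hs)
  bound K hK hKc := by
    obtain ⟨C, hC⟩ := hu.bound K hK hKc
    obtain ⟨D, h0, hD⟩ := ha.bound K hK hKc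
    refine ⟨D.toNNReal * C, ?_⟩
    filter_upwards [hC, hD] with s h1 h2
    calc ∫⁻ y in K, ‖a s y * u s y‖ₑ ≤ ∫⁻ y in K, D.toNNReal * ‖u s y‖ₑ := by
          refine setLIntegral_mono' hKc.measurableSet fun y hy => ?_
          rw [enorm_mul]
          gcongr
          rw [Real.enorm_eq_ofReal_abs]
          exact ENNReal.ofReal_le_ofReal (by simpa using h2 y hy)
      _ = D.toNNReal * ∫⁻ y in K, ‖u s y‖ₑ := lintegral_const_mul' _ _ ENNReal.coe_ne_top
      _ ≤ _ := by push_cast; gcongr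

theorem neg (hu : L1Bounded U u) : L1Bounded U (fun s y => - u s y) :=
  (hu.bounded_mul (UniformO.of_continuousOn (continuousOn_const (c := (-1 : ℝ))))).congr
    fun s _ y _ => by simp

theorem const_mul (hu : L1Bounded U u) (c : ℝ) : L1Bounded U (fun s y => c * u s y) :=
  hu.bounded_mul (UniformO.of_continuousOn (continuousOn_const (c := c)))

theorem sub (hu : L1Bounded U u) (hv : L1Bounded U v) :
    L1Bounded U (fun s y => u s y - v s y) :=
  (hu.add hv.neg).congr fun s _ y _ => by simp [sub_eq_add_neg]

theorem sum {ι : Type*} {t : Finset ι} {u : ι → ℝ → E4 → ℝ} (hu : ∀ i ∈ t, L1Bounded U (u i)) :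
    L1Bounded U (fun s y => ∑ i ∈ t, u i s y) := by
  classical
  induction t using Finset.induction_on with
  | empty => simpa using (UniformO.zero (U := U) (n := 0)).l1Bounded
  | insert a t ha ih =>
    simp only [Finset.sum_insert ha]
    exact (hu a (by simp)).add (ih fun i hi => hu i (by simp [hi]))

/-- The product of a family tending to zero uniformly and a family bounded in `L¹` tends weakly to
zero. -/
theorem small_mul (hu : L1Bounded U u) {a : ℝ → E4 → ℝ} (ha : UniformO U 1 a) :
    WeakTo U (fun s y => a s y * u s y) (fun _ => 0) where
  cont s hs := (ha.cont s hs).mul (hu.cont s hs)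
  cont_lim := continuousOn_const
  tendsto f hf := by
    obtain ⟨C, hC⟩ := hu.bound _ hf.subset hf.compact
    obtain ⟨D, h0, hD⟩ := ha.bound _ hf.subset hf.compact
    obtain ⟨B, hB0, hB⟩ := hf.exists_bound
    simp only [mul_zero, integral_zero]
    -- `B` bounds the test function, `D * s` the small factor, and `C` the `L¹` norm of `u s` on the
    -- support of `f`.
    refine squeeze_zero_norm' (a := fun s => (B * D * C) * s) ?_ ?_
    · filter_upwards [hC, hD, eventually_pos_right] with s h1 h2 h3
      have key : ‖∫ y, f y * (a s y * u s y)‖ₑ ≤ ENNReal.ofReal (B * D * s) * C := by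
        have e : ∫ y, f y * (a s y * u s y) = ∫ y in tsupport f, f y * (a s y * u s y) := by
          rw [setIntegral_eq_integral_of_forall_compl_eq_zero]
          intro y hy
          simp [image_eq_zero_of_notMem_tsupport hy]
        rw [e]
        calc ‖∫ y in tsupport f, f y * (a s y * u s y)‖ₑ
            ≤ ∫⁻ y in tsupport f, ‖f y * (a s y * u s y)‖ₑ := enorm_integral_le_lintegral_enorm _
          _ ≤ ∫⁻ y in tsupport f, ENNReal.ofReal (B * D * s) * ‖u s y‖ₑ := by
              refine setLIntegral_mono' hf.compact.measurableSet fun y hy => ?_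
              rw [← mul_assoc, enorm_mul]
              gcongr
              rw [Real.enorm_eq_ofReal_abs, abs_mul]
              refine ENNReal.ofReal_le_ofReal ?_
              calc |f y| * |a s y| ≤ B * (D * s ^ 1) :=
                    mul_le_mul (hB y) (h2 y hy) (abs_nonneg _) hB0
                _ = _ := by ring
          _ = ENNReal.ofReal (B * D * s) * ∫⁻ y in tsupport f, ‖u s y‖ₑ :=
              lintegral_const_mul' _ _ ENNReal.ofReal_ne_top
          _ ≤ _ := by gcongr
      have h4 : (0 : ℝ) ≤ B * D * s := by positivity
      rw [← ENNReal.ofReal_coe_nnreal (p := C), ← ENNReal.ofReal_mul h4, ← ofReal_norm] at key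
      have := (ENNReal.ofReal_le_ofReal_iff (by positivity)).1 key
      calc _ ≤ _ := this
        _ = _ := by ring
    · have : Tendsto (fun s : ℝ => (B * D * C) * s) (𝓝 0) (𝓝 ((B * D * C) * 0)) :=
        (continuous_const.mul continuous_id).tendsto 0
      simpa using this.mono_left nhdsWithin_le_nhds

end L1Bounded

theorem UniformO.weakTo {u : ℝ → E4 → ℝ} (hu : UniformO U 1 u) : WeakTo U u (fun _ => 0) :=
  ((UniformO.of_continuousOn (continuousOn_const (c := (1 : ℝ)))).l1Bounded.small_mul hu).congr
    (fun s _ y _ => by simp) (fun _ _ => rfl)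

namespace DistBounded

variable {u v : ℝ → E4 → ℝ}

theorem congr (hu : DistBounded U u) (h : ∀ s, 0 < s → Set.EqOn (v s) (u s) U) :
    DistBounded U v where
  cont s hs := (hu.cont s hs).congr (h s hs)
  bound f hf := by
    obtain ⟨C, hC⟩ := hu.bound f hf
    refine ⟨C, ?_⟩
    filter_upwards [hC, eventually_pos_right] with s h1 h2
    rwa [hf.integral_congr (h s h2)]

theorem add (hU : IsOpen U) (hu : DistBounded U u) (hv : DistBounded U v) :
    DistBounded U (fun s y => u s y + v s y) where
  cont s hs := (hu.cont s hs).add (hv.cont s hs)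
  bound f hf := by
    obtain ⟨C, hC⟩ := hu.bound f hf
    obtain ⟨D, hD⟩ := hv.bound f hf
    refine ⟨C + D, ?_⟩
    filter_upwards [hC, hD, eventually_pos_right] with s h1 h2 hs
    simp only [mul_add]
    rw [integral_add (hf.integrable_mul hU (hu.cont s hs)) (hf.integrable_mul hU (hv.cont s hs))]
    exact (abs_add_le _ _).trans (add_le_add h1 h2)

theorem const_mul (hu : DistBounded U u) (c : ℝ) : DistBounded U (fun s y => c * u s y) where
  cont s hs := continuousOn_const.mul (hu.cont s hs)
  bound f hf := by
    obtain ⟨C, hC⟩ := hu.bound f hf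
    refine ⟨|c| * C, ?_⟩
    filter_upwards [hC] with s h1
    simp only [mul_left_comm _ c]
    rw [integral_const_mul, abs_mul]
    gcongr

theorem neg (hu : DistBounded U u) : DistBounded U (fun s y => - u s y) :=
  (hu.const_mul (-1)).congr fun s _ y _ => by simp

theorem sub (hU : IsOpen U) (hu : DistBounded U u) (hv : DistBounded U v) :
    DistBounded U (fun s y => u s y - v s y) :=
  (hu.add hU hv.neg).congr fun s _ y _ => by simp [sub_eq_add_neg]

theorem of_uniformO (hu : UniformO U 0 u) : DistBounded U u where
  cont := hu.cont
  bound f hf := by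
    obtain ⟨C, h0, hC⟩ := hu.bound _ hf.subset hf.compact
    refine ⟨∫ y, ‖f y‖ * C, ?_⟩
    filter_upwards [hC, eventually_pos_right] with s h1 h2
    refine (norm_integral_le_integral_norm (fun y => f y * u s y)).trans
      (integral_mono_of_nonneg ?_ ?_ ?_)
    · exact Eventually.of_forall fun y => norm_nonneg _
    · refine Integrable.mul_const ?_ C
      exact (hf.smooth.continuous.integrable_of_hasCompactSupport hf.compact).norm
    · refine Eventually.of_forall fun y => ?_
      by_cases hy : y ∈ tsupport f
      · simp only [norm_mul]
        gcongr
        simpa using h1 y hy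
      · simp [image_eq_zero_of_notMem_tsupport hy]

theorem sum (hU : IsOpen U) {ι : Type*} {t : Finset ι} {u : ι → ℝ → E4 → ℝ}
    (hu : ∀ i ∈ t, DistBounded U (u i)) : DistBounded U (fun s y => ∑ i ∈ t, u i s y) := by
  classical
  induction t using Finset.induction_on with
  | empty => simpa using of_uniformO (UniformO.zero (U := U) (n := 0))
  | insert a t ha ih =>
    simp only [Finset.sum_insert ha]
    exact (hu a (by simp)).add hU (ih fun i hi => hu i (by simp [hi]))

/-- The bound in `DistBounded` may depend on the test function, so it may be the one belonging to
the derivative of that function. This is how second derivatives of the metrics are controlled. -/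
theorem partialDeriv (hU : IsOpen U) (hu : DistBounded U u)
    (hs : ∀ s, 0 < s → ContDiffOn ℝ ∞ (u s) U) (i : Fin 4) :
    DistBounded U (fun s => _root_.partialDeriv i (u s)) where
  cont s h := ((hs s h).partialDeriv hU i).continuousOn
  bound f hf := by
    obtain ⟨C, hC⟩ := hu.bound _ (hf.partialDeriv i)
    refine ⟨C, ?_⟩
    filter_upwards [hC, eventually_pos_right] with s h1 h2
    rwa [hf.integral_partialDeriv hU (hs s h2), abs_neg]

end DistBounded

end Calculus

/-! ### Families close to a smooth limit with bounded first derivatives: stability under algebra and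
inversion. -/

section Near

variable {U : Set E4} {u v : ℝ → E4 → ℝ} {u₀ v₀ : E4 → ℝ}

namespace NearTo

theorem bounded (hu : NearTo U u u₀) : UniformO U 0 u :=
  (hu.near.to_zero.add (UniformO.of_continuousOn hu.smooth_lim.continuousOn)).congr
    fun s _ y _ => by simp

theorem const (hU : IsOpen U) {a : E4 → ℝ} (ha : ContDiffOn ℝ ∞ a U) : NearTo U (fun _ => a) a where
  smooth _ _ := ha
  smooth_lim := ha
  near := UniformO.zero.congr fun s _ y _ => by simp
  deriv i := UniformO.of_continuousOn (ha.partialDeriv hU i).continuousOn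

theorem add (hU : IsOpen U) (hu : NearTo U u u₀) (hv : NearTo U v v₀) :
    NearTo U (fun s y => u s y + v s y) (fun y => u₀ y + v₀ y) where
  smooth s hs := (hu.smooth s hs).add (hv.smooth s hs)
  smooth_lim := hu.smooth_lim.add hv.smooth_lim
  near := (hu.near.add hv.near).congr fun s _ y _ => by ring
  deriv i := ((hu.deriv i).add (hv.deriv i)).congr fun s hs y hy =>
    partialDeriv_add ((hu.smooth s hs).diffAt hU hy) ((hv.smooth s hs).diffAt hU hy) i

theorem mul (hU : IsOpen U) (hu : NearTo U u u₀) (hv : NearTo U v v₀) :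
    NearTo U (fun s y => u s y * v s y) (fun y => u₀ y * v₀ y) where
  smooth s hs := (hu.smooth s hs).mul (hv.smooth s hs)
  smooth_lim := hu.smooth_lim.mul hv.smooth_lim
  near := ((hu.near.one_mul_zero hv.bounded).add
    (hv.near.const_mul hu.smooth_lim.continuousOn)).congr fun s _ y _ => by ring
  deriv i := (((hu.deriv i).zero_mul_zero hv.bounded).add
    (hu.bounded.zero_mul_zero (hv.deriv i))).congr fun s hs y hy =>
      partialDeriv_mul ((hu.smooth s hs).diffAt hU hy) ((hv.smooth s hs).diffAt hU hy) i

theorem const_mul (hU : IsOpen U) (hu : NearTo U u u₀) (c : ℝ) :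
    NearTo U (fun s y => c * u s y) (fun y => c * u₀ y) :=
  (const hU contDiffOn_const).mul hU hu

theorem sum (hU : IsOpen U) {ι : Type*} {t : Finset ι} {u : ι → ℝ → E4 → ℝ} {u₀ : ι → E4 → ℝ}
    (hu : ∀ i ∈ t, NearTo U (u i) (u₀ i)) :
    NearTo U (fun s y => ∑ i ∈ t, u i s y) (fun y => ∑ i ∈ t, u₀ i y) := by
  classical
  induction t using Finset.induction_on with
  | empty => simpa using const hU contDiffOn_const
  | insert a t ha ih =>
    simp only [Finset.sum_insert ha]
    exact (hu a (by simp)).add hU (ih fun i hi => hu i (by simp [hi]))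

theorem prod (hU : IsOpen U) {ι : Type*} {t : Finset ι} {u : ι → ℝ → E4 → ℝ} {u₀ : ι → E4 → ℝ}
    (hu : ∀ i ∈ t, NearTo U (u i) (u₀ i)) :
    NearTo U (fun s y => ∏ i ∈ t, u i s y) (fun y => ∏ i ∈ t, u₀ i y) := by
  classical
  induction t using Finset.induction_on with
  | empty => simpa using const hU contDiffOn_const
  | insert a t ha ih =>
    simp only [Finset.prod_insert ha]
    exact (hu a (by simp)).mul hU (ih fun i hi => hu i (by simp [hi]))

theorem bounded_inv (hu : NearTo U u u₀) (h₀ : ∀ y ∈ U, u₀ y ≠ 0)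
    (hs : ∀ s, 0 < s → ∀ y ∈ U, u s y ≠ 0) : UniformO U 0 (fun s y => (u s y)⁻¹) where
  cont s h := ((hu.smooth s h).continuousOn).inv₀ (hs s h)
  bound K hK hKc := by
    obtain ⟨C, hC0, hC⟩ := hu.near.bound K hK hKc
    obtain ⟨B, hB⟩ := hKc.exists_bound_of_continuousOn
      ((hu.smooth_lim.continuousOn.inv₀ h₀).mono hK)
    set B' := max B 1
    have hB' : 0 < B' := lt_of_lt_of_le one_pos (le_max_right _ _)
    refine ⟨2 * B', by positivity, ?_⟩
    -- On `K` one has |u₀| ≥ 1/B'. Once the deviation C s is below half of that, |u s| ≥ 1/(2B').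
    have hlim : ∀ᶠ s in 𝓝[>] (0 : ℝ), C * s < (2 * B')⁻¹ := by
      refine eventually_nhdsWithin_of_eventually_nhds ?_
      have : Tendsto (fun s : ℝ => C * s) (𝓝 0) (𝓝 (C * 0)) :=
        (continuous_const.mul continuous_id).tendsto 0
      rw [mul_zero] at this
      exact this.eventually (gt_mem_nhds (by positivity))
    filter_upwards [hC, hlim, eventually_pos_right] with s h1 h2 h3 y hy
    have h4 := h1 y hy
    rw [pow_one] at h4
    have h5 : B'⁻¹ ≤ |u₀ y| := by
      have : |(u₀ y)⁻¹| ≤ B' := (hB y hy).trans (le_max_left _ _)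
      rw [abs_inv] at this
      exact inv_le_of_inv_le₀ (abs_pos.2 (h₀ y (hK hy))) this
    have h6 : (2 * B')⁻¹ ≤ |u s y| := by
      have h7 : |u₀ y| ≤ |u s y| + |u s y - u₀ y| := by
        have := abs_sub_abs_le_abs_sub (u₀ y) (u s y)
        rw [abs_sub_comm] at this
        linarith
      have h8 : B'⁻¹ = (2 * B')⁻¹ + (2 * B')⁻¹ := by field_simp; norm_num
      linarith
    rw [abs_inv, pow_zero, mul_one]
    exact inv_le_of_inv_le₀ (by positivity) h6

/-- Closeness comes from 1/u − 1/u₀ = −(u − u₀)/(u u₀), with both reciprocals bounded on compact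
sets. -/
theorem inv (hU : IsOpen U) (hu : NearTo U u u₀) (h₀ : ∀ y ∈ U, u₀ y ≠ 0)
    (hs : ∀ s, 0 < s → ∀ y ∈ U, u s y ≠ 0) :
    NearTo U (fun s y => (u s y)⁻¹) (fun y => (u₀ y)⁻¹) where
  smooth s h := (hu.smooth s h).inv (hs s h)
  smooth_lim := hu.smooth_lim.inv h₀
  near := (((hu.near.one_mul_zero (hu.bounded_inv h₀ hs)).const_mul
      (hu.smooth_lim.continuousOn.inv₀ h₀)).neg).congr fun s h y hy => by
    have h1 := hs s h y hy
    have h2 := h₀ y hy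
    simp only [Pi.inv_apply]
    field_simp
    ring
  deriv i := (((hu.deriv i).zero_mul_zero ((hu.bounded_inv h₀ hs).zero_mul_zero
      (hu.bounded_inv h₀ hs))).neg).congr fun s h y hy =>
    partialDeriv_inv ((hu.smooth s h).diffAt hU hy) (hs s h y hy) i

theorem det (hU : IsOpen U) {A : ℝ → E4 → Matrix (Fin 4) (Fin 4) ℝ}
    {A₀ : E4 → Matrix (Fin 4) (Fin 4) ℝ}
    (hA : ∀ i j, NearTo U (fun s y => A s y i j) (fun y => A₀ y i j)) :
    NearTo U (fun s y => (A s y).det) (fun y => (A₀ y).det) := by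
  simp only [Matrix.det_apply']
  exact sum hU fun σ _ => (prod hU fun i _ => hA _ _).const_mul hU _

/-- By Cramer's rule the entries of the inverse are determinants divided by the determinant. The row
replaced in the adjugate is constant in `s`. -/
theorem matrix_inv (hU : IsOpen U) {A : ℝ → E4 → Matrix (Fin 4) (Fin 4) ℝ}
    {A₀ : E4 → Matrix (Fin 4) (Fin 4) ℝ}
    (hA : ∀ i j, NearTo U (fun s y => A s y i j) (fun y => A₀ y i j))
    (h₀ : ∀ y ∈ U, (A₀ y).det ≠ 0) (hs : ∀ s, 0 < s → ∀ y ∈ U, (A s y).det ≠ 0) (i j : Fin 4) :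
    NearTo U (fun s y => (A s y)⁻¹ i j) (fun y => (A₀ y)⁻¹ i j) := by
  simp only [Matrix.inv_def, Ring.inverse_eq_inv', Matrix.smul_apply, smul_eq_mul,
    Matrix.adjugate_apply]
  refine ((det hU hA).inv hU h₀ hs).mul hU (det hU fun k l => ?_)
  by_cases hk : k = j
  · simpa [hk] using const hU contDiffOn_const
  · simpa [Matrix.updateRow_ne hk] using hA k l

end NearTo

end Near

/-! ### Expansion of the Christoffel symbols and weak limit of the Ricci tensor. -/

/-- The combination `p_{ija} + p_{jia} - p_{aij}` entering the Christoffel symbols. -/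
noncomputable def koszul (p : Fin 4 → Fin 4 → Fin 4 → ℝ) (a i j : Fin 4) : ℝ := p i j a + p j i a - p a i j

/-- The product of two Koszul combinations, `m_{abcdef}` standing for `p_{acd} p_{bef}`. -/
def koszulProd {ι R : Type*} [AddCommGroup R] (m : (Fin 6 → ι) → R) (a i j b k l : ι) : R :=
  m ![i, k, j, a, l, b] + m ![i, l, j, a, k, b] - m ![i, b, j, a, k, l]
    + m ![j, k, i, a, l, b] + m ![j, l, i, a, k, b] - m ![j, b, i, a, k, l]
    - m ![a, k, i, j, l, b] - m ![a, l, i, j, k, b] + m ![a, b, i, j, k, l]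

/-- The contraction `C^k_{kl} C^l_{ij} - C^k_{jl} C^l_{ik}` of the quadratic form `m`, where
`C^k_{ij} = (1/2) N^{ka} (p_{ija} + p_{jia} - p_{aij})`. -/
noncomputable def quadRicci (N : Fin 4 → Fin 4 → ℝ) (m : (Fin 6 → Fin 4) → ℝ) (i j : Fin 4) : ℝ :=
  ∑ k, ∑ l, ((1 / 4) * ∑ a, ∑ b, N k a * N l b * koszulProd m a k l b i j
    - (1 / 4) * ∑ a, ∑ b, N k a * N l b * koszulProd m a j l b i k)

/-- The partial derivatives `∂_c (g(s) - g(0))_{ij}`. -/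
noncomputable def gradDiff (G : ℝ → (Fin 2 → Fin 4) → E4 → ℝ) (s : ℝ) (y : E4) (c i j : Fin 4) : ℝ :=
  partialDeriv c (fun z => G s ![i, j] z - G 0 ![i, j] z) y

/-- The part of `Γ(g(s)) - Γ(g(0))` that is linear in `∂ (g(s) - g(0))`. -/
noncomputable def linChristoffel (G : ℝ → (Fin 2 → Fin 4) → E4 → ℝ) (k i j : Fin 4) (s : ℝ) (y : E4) : ℝ :=
  (1 / 2) * ∑ a, inverseMetric (G 0) k a y * koszul (gradDiff G s y) a i j

/-- Families of metrics on a coordinate domain that converge uniformly and have bounded first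
derivatives. -/
structure MetricFamily (U : Set E4) (G : ℝ → (Fin 2 → Fin 4) → E4 → ℝ) : Prop where
  isOpen : IsOpen U
  near : ∀ i j, NearTo U (fun s => G s ![i, j]) (G 0 ![i, j])
  symm : ∀ s, 0 ≤ s → ∀ y ∈ U, ∀ i j, G s ![i, j] y = G s ![j, i] y
  det : ∀ s, 0 ≤ s → ∀ y ∈ U, (Matrix.of fun a b : Fin 4 => G s ![a, b] y).det ≠ 0

namespace MetricFamily

variable {U : Set E4} {G : ℝ → (Fin 2 → Fin 4) → E4 → ℝ} (hG : MetricFamily U G)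

include hG

theorem near_inverse (i j : Fin 4) :
    NearTo U (fun s => inverseMetric (G s) i j) (inverseMetric (G 0) i j) :=
  NearTo.matrix_inv hG.isOpen (A := fun s y => Matrix.of fun a b : Fin 4 => G s ![a, b] y)
    (A₀ := fun y => Matrix.of fun a b : Fin 4 => G 0 ![a, b] y) hG.near
    (hG.det 0 le_rfl) (fun s hs => hG.det s hs.le) i j

theorem smooth {s : ℝ} (hs : 0 ≤ s) (i j : Fin 4) : ContDiffOn ℝ ∞ (G s ![i, j]) U := by
  rcases hs.eq_or_lt with rfl | h
  · exact (hG.near i j).smooth_lim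
  · exact (hG.near i j).smooth s h

theorem smooth_inverse {s : ℝ} (hs : 0 ≤ s) (i j : Fin 4) :
    ContDiffOn ℝ ∞ (inverseMetric (G s) i j) U := by
  rcases hs.eq_or_lt with rfl | h
  · exact (hG.near_inverse i j).smooth_lim
  · exact (hG.near_inverse i j).smooth s h

theorem smooth_christoffel {s : ℝ} (hs : 0 ≤ s) (k i j : Fin 4) :
    ContDiffOn ℝ ∞ (christoffel (G s) k i j) U :=
  contDiffOn_const.mul (ContDiffOn.sum fun l _ => (hG.smooth_inverse hs k l).mul
    ((((hG.smooth hs _ _).partialDeriv hG.isOpen _).add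
      ((hG.smooth hs _ _).partialDeriv hG.isOpen _)).sub
      ((hG.smooth hs _ _).partialDeriv hG.isOpen _)))

theorem bounded_christoffel (k i j : Fin 4) :
    UniformO U 0 (fun s => christoffel (G s) k i j) :=
  (UniformO.sum (t := Finset.univ) fun l _ => (hG.near_inverse k l).bounded.zero_mul_zero
    ((((hG.near _ _).deriv _).add ((hG.near _ _).deriv _)).sub ((hG.near _ _).deriv _))).const_mul
      continuousOn_const

theorem smooth_diff {s : ℝ} (hs : 0 ≤ s) (i j : Fin 4) :
    ContDiffOn ℝ ∞ (fun z => G s ![i, j] z - G 0 ![i, j] z) U :=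
  (hG.smooth hs i j).sub (hG.smooth le_rfl i j)

theorem gradDiff_eq {s : ℝ} (hs : 0 ≤ s) {y : E4} (hy : y ∈ U) (c i j : Fin 4) :
    gradDiff G s y c i j = partialDeriv c (G s ![i, j]) y - partialDeriv c (G 0 ![i, j]) y :=
  partialDeriv_sub ((hG.smooth hs _ _).diffAt hG.isOpen hy)
    ((hG.smooth le_rfl _ _).diffAt hG.isOpen hy) c

theorem gradDiff_symm {s : ℝ} (hs : 0 ≤ s) {y : E4} (hy : y ∈ U) (c i j : Fin 4) :
    gradDiff G s y c i j = gradDiff G s y c j i :=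
  partialDeriv_congr hG.isOpen (fun z hz => by
    rw [hG.symm s hs z hz, hG.symm 0 le_rfl z hz]) c hy

theorem bounded_gradDiff (c i j : Fin 4) : UniformO U 0 (fun s y => gradDiff G s y c i j) :=
  (((hG.near i j).deriv c).sub (UniformO.of_continuousOn
    ((hG.smooth le_rfl i j).partialDeriv hG.isOpen c).continuousOn)).congr
      fun _ hs _ hy => hG.gradDiff_eq hs.le hy c i j

/-- The first derivatives of the perturbation are merely bounded, but they are derivatives of a
family that is O(s). -/
theorem weakTo_gradDiff (c i j : Fin 4) :
    WeakTo U (fun s y => gradDiff G s y c i j) (fun _ => 0) :=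
  (hG.near i j).near.weakTo.partialDeriv hG.isOpen (fun _ hs => hG.smooth_diff hs.le i j) c

theorem weakTo_koszul (a i j : Fin 4) :
    WeakTo U (fun s y => koszul (gradDiff G s y) a i j) (fun _ => 0) :=
  (((hG.weakTo_gradDiff _ _ _).add hG.isOpen (hG.weakTo_gradDiff _ _ _)).sub hG.isOpen
    (hG.weakTo_gradDiff _ _ _)).congr (fun _ _ _ _ => rfl) (fun _ _ => by simp)

theorem bounded_linChristoffel (k i j : Fin 4) : UniformO U 0 (linChristoffel G k i j) :=
  (UniformO.sum (t := Finset.univ) fun _ _ => (((hG.bounded_gradDiff _ _ _).add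
    (hG.bounded_gradDiff _ _ _)).sub (hG.bounded_gradDiff _ _ _)).const_mul
      (hG.smooth_inverse le_rfl _ _).continuousOn).const_mul continuousOn_const

theorem weakTo_linChristoffel (k i j : Fin 4) :
    WeakTo U (linChristoffel G k i j) (fun _ => 0) :=
  ((WeakTo.sum hG.isOpen (t := Finset.univ) fun _ _ => (hG.weakTo_koszul _ _ _).smooth_mul
    hG.isOpen (hG.smooth_inverse le_rfl _ _)).const_mul hG.isOpen (1 / 2)).congr
      (fun _ _ _ _ => rfl) (fun _ _ => by simp)

/-- The remainder is ½ (g(s)⁻¹ − g(0)⁻¹) contracted with first derivatives of g(s): an O(s) factor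
times a bounded one. -/
theorem christoffel_expansion (k i j : Fin 4) :
    UniformO U 1 (fun s y => christoffel (G s) k i j y
      - (christoffel (G 0) k i j y + linChristoffel G k i j s y)) := by
  refine ((UniformO.sum (t := Finset.univ) fun l _ => (hG.near_inverse k l).near.one_mul_zero
    ((((hG.near j l).deriv i).add ((hG.near i l).deriv j)).sub ((hG.near i j).deriv l))).const_mul
      (continuousOn_const (c := (1 / 2 : ℝ)))).congr fun s hs y hy => ?_
  simp only [christoffel, linChristoffel, koszul, hG.gradDiff_eq hs.le hy, ← mul_add, ← mul_sub,
    ← Finset.sum_add_distrib, ← Finset.sum_sub_distrib]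
  congr 1
  refine Finset.sum_congr rfl fun l _ => ?_
  ring

theorem weakTo_christoffel_sub (k i j : Fin 4) :
    WeakTo U (fun s y => christoffel (G s) k i j y - christoffel (G 0) k i j y) (fun _ => 0) :=
  ((hG.christoffel_expansion k i j).weakTo.add hG.isOpen (hG.weakTo_linChristoffel k i j)).congr
    (fun _ _ _ _ => by ring) (fun _ _ => by simp)

theorem weakTo_partialDeriv_christoffel (c k i j : Fin 4) :
    WeakTo U (fun s => partialDeriv c (christoffel (G s) k i j))
      (partialDeriv c (christoffel (G 0) k i j)) := by
  have h := (hG.weakTo_christoffel_sub k i j).partialDeriv hG.isOpen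
    (fun s hs => (hG.smooth_christoffel hs.le k i j).sub (hG.smooth_christoffel le_rfl k i j)) c
  refine (h.add hG.isOpen (WeakTo.const ((hG.smooth_christoffel le_rfl k i j).partialDeriv
    hG.isOpen c).continuousOn)).congr (fun s hs y hy => ?_) (fun y _ => by simp)
  beta_reduce
  rw [partialDeriv_sub ((hG.smooth_christoffel hs.le _ _ _).diffAt hG.isOpen hy)
    ((hG.smooth_christoffel le_rfl _ _ _).diffAt hG.isOpen hy)]
  ring

variable {m : (Fin 6 → Fin 4) → E4 → ℝ} (hm : ∀ a b c d e f,
  WeakTo U (fun s y => gradDiff G s y a c d * gradDiff G s y b e f) (m ![a, b, c, d, e, f]))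

include hm

theorem weakTo_koszul_mul (a i j b k l : Fin 4) :
    WeakTo U (fun s y => koszul (gradDiff G s y) a i j * koszul (gradDiff G s y) b k l)
      (fun y => koszulProd (m · y) a i j b k l) := by
  have hU := hG.isOpen
  refine (((((((((hm i k j a l b).add hU (hm i l j a k b)).sub hU (hm i b j a k l)).add hU
    (hm j k i a l b)).add hU (hm j l i a k b)).sub hU (hm j b i a k l)).sub hU
    (hm a k i j l b)).sub hU (hm a l i j k b)).add hU (hm a b i j k l)).congr
    (fun s hs y hy => ?_) (fun y _ => rfl)
  simp only [koszul]
  ring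

theorem weakTo_linChristoffel_mul (k i j l i' j' : Fin 4) :
    WeakTo U (fun s y => linChristoffel G k i j s y * linChristoffel G l i' j' s y)
      (fun y => (1 / 4) * ∑ a, ∑ b, inverseMetric (G 0) k a y * inverseMetric (G 0) l b y *
        koszulProd (m · y) a i j b i' j') := by
  have hU := hG.isOpen
  refine ((WeakTo.sum hU (t := Finset.univ) fun a _ => WeakTo.sum hU (t := Finset.univ) fun b _ =>
    (hG.weakTo_koszul_mul hm a i j b i' j').smooth_mul hU
    ((hG.smooth_inverse le_rfl k a).mul (hG.smooth_inverse le_rfl l b))).const_mul hU (1 / 4)).congr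
    (fun s hs y hy => ?_) (fun y _ => rfl)
  simp only [linChristoffel]
  rw [mul_mul_mul_comm, Finset.sum_mul_sum]
  congr 1
  · norm_num
  · exact Finset.sum_congr rfl fun a _ => Finset.sum_congr rfl fun b _ => by ring

/-- Weak limits do not multiply. Expanding each factor as Γ(0) + C + O(s), the cross terms are a
smooth function times a weakly null one, and only C·C contributes a defect, which is expressed
through `m`. -/
theorem weakTo_christoffel_mul (k i j l i' j' : Fin 4) :
    WeakTo U (fun s y => christoffel (G s) k i j y * christoffel (G s) l i' j' y)
      (fun y => christoffel (G 0) k i j y * christoffel (G 0) l i' j' y +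
        (1 / 4) * ∑ a, ∑ b, inverseMetric (G 0) k a y * inverseMetric (G 0) l b y *
        koszulProd (m · y) a i j b i' j') := by
  have hU := hG.isOpen
  have s1 := hG.smooth_christoffel le_rfl k i j
  have s2 := hG.smooth_christoffel le_rfl l i' j'
  have h1 := hG.weakTo_linChristoffel_mul hm k i j l i' j'
  have h2 := (hG.weakTo_linChristoffel l i' j').smooth_mul hU s1
  have h3 := (hG.weakTo_linChristoffel k i j).smooth_mul hU s2
  have h4 := ((hG.christoffel_expansion k i j).one_mul_zero
    (hG.bounded_christoffel l i' j')).weakTo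
  have h5 := (((UniformO.of_continuousOn s1.continuousOn).add
    (hG.bounded_linChristoffel k i j)).zero_mul_one (hG.christoffel_expansion l i' j')).weakTo
  refine (((((WeakTo.const (s1.mul s2).continuousOn).add hU h1).add hU h2).add hU
    h3).add hU (h4.add hU h5)).congr (fun s hs y hy => ?_) (fun y _ => ?_)
  · ring
  · ring

theorem weakTo_ricci (i j : Fin 4) :
    WeakTo U (fun s => ricci (G s) i j) (fun y => ricci (G 0) i j y +
      quadRicci (fun a b => inverseMetric (G 0) a b y) (m · y) i j) := by
  have hU := hG.isOpen
  refine ((WeakTo.sum hU (t := Finset.univ) fun k _ =>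
      (hG.weakTo_partialDeriv_christoffel k k i j).sub hU
        (hG.weakTo_partialDeriv_christoffel j k k i)).add hU
    (WeakTo.sum hU (t := Finset.univ) fun k _ => WeakTo.sum hU (t := Finset.univ) fun l _ =>
      (hG.weakTo_christoffel_mul hm k k l l i j).sub hU
        (hG.weakTo_christoffel_mul hm k j l l i k))).congr (fun s hs y hy => rfl) (fun y _ => ?_)
  simp only [ricci, quadRicci, add_assoc]
  congr 1
  simp only [← Finset.sum_add_distrib]
  exact Finset.sum_congr rfl fun k _ => Finset.sum_congr rfl fun l _ => by ring

omit hm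

theorem smooth_ricci {s : ℝ} (hs : 0 ≤ s) (i j : Fin 4) :
    ContDiffOn ℝ ∞ (ricci (G s) i j) U := by
  have hc := fun k i j => (hG.smooth_christoffel hs k i j)
  have hd := fun c k i j => ((hG.smooth_christoffel hs k i j).partialDeriv hG.isOpen c)
  exact (ContDiffOn.sum fun k _ => (hd _ _ _ _).sub (hd _ _ _ _)).add
    (ContDiffOn.sum fun k _ => ContDiffOn.sum fun l _ =>
      ((hc _ _ _).mul (hc _ _ _)).sub ((hc _ _ _).mul (hc _ _ _)))

/-- Leibniz: a ∂Γ = ∂(aΓ) − (∂a)Γ, the derivative of a bounded family minus a bounded family. No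
bound on second derivatives of the metrics is needed. -/
theorem distBounded_mul_partialDeriv {a : ℝ → E4 → ℝ} {a₀ : E4 → ℝ} (ha : NearTo U a a₀)
    (c k i j : Fin 4) :
    DistBounded U (fun s y => a s y * partialDeriv c (christoffel (G s) k i j) y) := by
  have hU := hG.isOpen
  have h1 := (DistBounded.of_uniformO (ha.bounded.zero_mul_zero
    (hG.bounded_christoffel k i j))).partialDeriv hU
    (fun s hs => (ha.smooth s hs).mul (hG.smooth_christoffel hs.le k i j)) c
  have h2 := DistBounded.of_uniformO ((ha.deriv c).zero_mul_zero
    (hG.bounded_christoffel k i j))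
  refine (h1.sub hU h2).congr fun s hs y hy => ?_
  simp only
  rw [partialDeriv_mul ((ha.smooth s hs).diffAt hU hy)
    ((hG.smooth_christoffel hs.le k i j).diffAt hU hy)]
  ring

/-- The quadratic part of the Ricci tensor is uniformly bounded. -/
theorem bounded_christoffel_quad (i j : Fin 4) : UniformO U 0 (fun s y =>
    ∑ k, ∑ l, (christoffel (G s) k k l y * christoffel (G s) l i j y -
      christoffel (G s) k j l y * christoffel (G s) l i k y)) :=
  UniformO.sum fun _ _ => UniformO.sum fun _ _ =>
    ((hG.bounded_christoffel _ _ _).zero_mul_zero (hG.bounded_christoffel _ _ _)).sub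
      ((hG.bounded_christoffel _ _ _).zero_mul_zero (hG.bounded_christoffel _ _ _))

theorem distBounded_mul_ricci {a : ℝ → E4 → ℝ} {a₀ : E4 → ℝ} (ha : NearTo U a a₀) (i j : Fin 4) :
    DistBounded U (fun s y => a s y * ricci (G s) i j y) := by
  have hU := hG.isOpen
  refine ((DistBounded.sum hU (t := Finset.univ) fun k _ =>
    (hG.distBounded_mul_partialDeriv ha k k i j).sub hU
      (hG.distBounded_mul_partialDeriv ha j k k i)).add hU
    (DistBounded.of_uniformO (ha.bounded.zero_mul_zero
      (hG.bounded_christoffel_quad i j)))).congr fun s hs y hy => ?_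
  simp only [ricci, mul_add, Finset.mul_sum, mul_sub]

/-- The trace part is a sum of Ricci components with coefficients ½ g^{kl} g_{ij}. These depend on
`s` but have bounded first derivatives, so they are admissible multipliers in
`distBounded_mul_ricci`. -/
theorem distBounded_einstein (i j : Fin 4) : DistBounded U (fun s => einstein (G s) i j) := by
  have hU := hG.isOpen
  have h1 := hG.distBounded_mul_ricci (NearTo.const hU (contDiffOn_const (c := (1 : ℝ)))) i j
  have h2 := fun k l => hG.distBounded_mul_ricci
    ((hG.near_inverse k l).mul hU ((hG.near i j).const_mul hU (1 / 2))) k l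
  refine (h1.sub hU (DistBounded.sum hU (t := Finset.univ) fun k _ =>
    DistBounded.sum hU (t := Finset.univ) fun l _ => h2 k l)).congr fun s hs y hy => ?_
  simp only [einstein, metricTrace, Finset.mul_sum, Finset.sum_mul, one_mul]
  congr 1
  exact Finset.sum_congr rfl fun k _ => Finset.sum_congr rfl fun l _ => by ring

/-- Write γ ∂Γ = ∂(γΓ) − (∂γ)Γ. Here γΓ = O(s), so its derivative is weakly null; in (∂γ)Γ the part
with Γ(0) is weakly null and the O(s) part of Γ is negligible, leaving (∂γ)C. -/
theorem weakTo_diff_mul_partialDeriv (a b c k i j : Fin 4) :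
    WeakTo U (fun s y => (G s ![a, b] y - G 0 ![a, b] y) *
      partialDeriv c (christoffel (G s) k i j) y +
        gradDiff G s y c a b * linChristoffel G k i j s y) (fun _ => 0) := by
  have hU := hG.isOpen
  have h1 := ((hG.near a b).near.one_mul_zero (hG.bounded_christoffel k i j)).weakTo.partialDeriv hU
    (fun s hs => (hG.smooth_diff hs.le a b).mul (hG.smooth_christoffel hs.le k i j)) c
  have h2 := (hG.weakTo_gradDiff c a b).smooth_mul hU (hG.smooth_christoffel le_rfl k i j)
  have h3 := ((hG.bounded_gradDiff c a b).zero_mul_one (hG.christoffel_expansion k i j)).weakTo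
  refine ((h1.sub hU h2).sub hU h3).congr (fun s hs y hy => ?_) (fun y _ => by simp)
  beta_reduce
  rw [partialDeriv_mul ((hG.smooth_diff hs.le a b).diffAt hU hy)
    ((hG.smooth_christoffel hs.le k i j).diffAt hU hy)]
  simp only [gradDiff]
  ring

/-- The ΓΓ part of Ricci is bounded, so γ times it is O(s); only the ∂Γ part survives, and for it
the derivative is moved onto γ. -/
theorem weakTo_diff_mul_ricci (a b i j : Fin 4) :
    WeakTo U (fun s y => (G s ![a, b] y - G 0 ![a, b] y) * ricci (G s) i j y +
        ∑ k, (gradDiff G s y k a b * linChristoffel G k i j s y -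
          gradDiff G s y j a b * linChristoffel G k k i s y)) (fun _ => 0) := by
  have hU := hG.isOpen
  refine ((WeakTo.sum hU (t := Finset.univ) fun k _ =>
    (hG.weakTo_diff_mul_partialDeriv a b k k i j).sub hU
      (hG.weakTo_diff_mul_partialDeriv a b j k k i)).add hU
    ((hG.near a b).near.one_mul_zero (hG.bounded_christoffel_quad i j)).weakTo).congr
      (fun s hs y hy => ?_) (fun y _ => by simp)
  simp only [ricci, mul_add, Finset.mul_sum, Finset.sum_add_distrib, Finset.sum_sub_distrib,
    mul_sub]
  ring

end MetricFamily

/-! ### From positivity to local `L¹` bounds. -/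

section LocalBounds

variable {U : Set E4} {u v : ℝ → E4 → ℝ}

theorem L1Bounded.of_local (hc : ∀ s, 0 < s → ContinuousOn (u s) U)
    (h : ∀ y ∈ U, ∃ t ∈ 𝓝 y, ∃ C : NNReal, ∀ᶠ s in 𝓝[>] (0 : ℝ), ∫⁻ z in t, ‖u s z‖ₑ ≤ C) :
    L1Bounded U u where
  cont := hc
  bound K hK hKc := by
    refine hKc.induction_on (p := fun t => ∃ C : NNReal, ∀ᶠ s in 𝓝[>] (0 : ℝ),
      ∫⁻ z in t, ‖u s z‖ₑ ≤ C) ⟨0, by simp⟩ ?_ ?_ ?_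
    · rintro s t hst ⟨C, hC⟩
      exact ⟨C, hC.mono fun r hr => (lintegral_mono_set hst).trans hr⟩
    · rintro s t ⟨C, hC⟩ ⟨D, hD⟩
      refine ⟨C + D, ?_⟩
      filter_upwards [hC, hD] with r h1 h2
      refine (lintegral_union_le _ s t).trans ?_
      push_cast
      gcongr
    · intro x hx
      obtain ⟨t, ht, hC⟩ := h x (hK hx)
      exact ⟨t, mem_nhdsWithin_of_mem_nhds ht, hC⟩

/-- A nonnegative family bounded as a distribution is locally bounded in `L¹`: test it against a
bump function, which dominates a multiple of the indicator of a neighbourhood. -/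
theorem DistBounded.exists_lintegral_le (hU : IsOpen U) (hu : DistBounded U u) {V : Set E4}
    (hVU : V ⊆ U) {y : E4} (hV : V ∈ 𝓝 y)
    (hpos : ∀ᶠ s in 𝓝[>] (0 : ℝ), ∀ z ∈ V, 0 ≤ u s z) :
    ∃ t ∈ 𝓝 y, ∃ C : NNReal, ∀ᶠ s in 𝓝[>] (0 : ℝ), ∫⁻ z in t, ‖u s z‖ₑ ≤ C := by
  obtain ⟨f, hfV, hfc, hfs, hf01, hf1⟩ := exists_contDiff_tsupport_subset (n := ⊤) hV
  have hf : IsTest U f := ⟨hfs, hfc, hfV.trans hVU⟩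
  obtain ⟨C, hC⟩ := hu.bound f hf
  have hto : IsOpen {z | 1 / 2 < f z} := isOpen_lt continuous_const hfs.continuous
  -- Since f(y) = 1, this set is a neighbourhood of `y`, and on it u ≤ 2 f u. Hence the constant 2C.
  refine ⟨{z | 1 / 2 < f z}, hto.mem_nhds (by simp only [Set.mem_ofPred_eq, hf1]; norm_num),
    (2 * C).toNNReal, ?_⟩
  filter_upwards [hC, hpos, eventually_pos_right] with s h1 h2 h3
  have hnn : ∀ z, 0 ≤ f z * u s z := fun z => by
    by_cases hz : z ∈ tsupport f
    · exact mul_nonneg (hf01 ⟨z, rfl⟩).1 (h2 z (hfV hz))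
    · simp [image_eq_zero_of_notMem_tsupport hz]
  calc ∫⁻ z in {z | 1 / 2 < f z}, ‖u s z‖ₑ
      ≤ ∫⁻ z in {z | 1 / 2 < f z}, ENNReal.ofReal (2 * (f z * u s z)) := by
        refine setLIntegral_mono' hto.measurableSet fun z hz => ?_
        have hz' : 1 / 2 < f z := hz
        have hzs : z ∈ tsupport f := by
          by_contra hz2
          rw [image_eq_zero_of_notMem_tsupport hz2] at hz'
          norm_num at hz'
        have h4 := h2 z (hfV hzs)
        rw [Real.enorm_eq_ofReal_abs, abs_of_nonneg h4]
        exact ENNReal.ofReal_le_ofReal (by nlinarith)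
    _ ≤ ∫⁻ z, ENNReal.ofReal (2 * (f z * u s z)) := setLIntegral_le_lintegral _ _
    _ = ENNReal.ofReal (∫ z, 2 * (f z * u s z)) :=
        (ofReal_integral_eq_lintegral_ofReal ((hf.integrable_mul hU (hu.cont s h3)).const_mul 2)
          (Eventually.of_forall fun z => mul_nonneg zero_le_two (hnn z))).symm
    _ ≤ ENNReal.ofReal (2 * C) := by
        refine ENNReal.ofReal_le_ofReal ?_
        rw [integral_const_mul]
        exact mul_le_mul_of_nonneg_left ((le_abs_self _).trans h1) zero_le_two

end LocalBounds

/-- The quadratic form of a matrix of functions. -/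
noncomputable def quadForm (A : Fin 4 → Fin 4 → ℝ) (v : Fin 4 → ℝ) : ℝ :=
  ∑ i, ∑ j, v i * v j * A i j

theorem continuous_quadForm (A : Fin 4 → Fin 4 → ℝ) : Continuous (quadForm A) := by
  unfold quadForm; fun_prop

theorem quadForm_sub (A B : Fin 4 → Fin 4 → ℝ) (v : Fin 4 → ℝ) :
    quadForm (fun i j => A i j - B i j) v = quadForm A v - quadForm B v := by
  simp [quadForm, mul_sub]

/-- The symmetrization of a matrix is a combination of values of its quadratic form. -/
theorem quadForm_polarization (A : Fin 4 → Fin 4 → ℝ) (v : Fin 4 → ℝ) (i j : Fin 4) (ε : ℝ) :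
    ε ^ 2 * (A i j + A j i) =
      quadForm A (v + ε • (Pi.single i 1 + Pi.single j 1)) - quadForm A (v + ε • Pi.single i 1)
        - quadForm A (v + ε • Pi.single j 1) + quadForm A v := by
  simp only [quadForm, Pi.add_apply, Pi.smul_apply, smul_eq_mul]
  rw [← Finset.sum_sub_distrib, ← Finset.sum_sub_distrib, ← Finset.sum_add_distrib]
  simp only [← Finset.sum_sub_distrib, ← Finset.sum_add_distrib]
  have : ∀ k l, (v k + ε * ((Pi.single i 1 : Fin 4 → ℝ) k + (Pi.single j 1 : Fin 4 → ℝ) k)) *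
        (v l + ε * ((Pi.single i 1 : Fin 4 → ℝ) l + (Pi.single j 1 : Fin 4 → ℝ) l)) * A k l
      - (v k + ε * (Pi.single i 1 : Fin 4 → ℝ) k) * (v l + ε * (Pi.single i 1 : Fin 4 → ℝ) l) * A k l
      - (v k + ε * (Pi.single j 1 : Fin 4 → ℝ) k) * (v l + ε * (Pi.single j 1 : Fin 4 → ℝ) l) * A k l
      + v k * v l * A k l =
      ε ^ 2 * ((Pi.single i 1 : Fin 4 → ℝ) k * ((Pi.single j 1 : Fin 4 → ℝ) l * A k l)) +
        ε ^ 2 * ((Pi.single j 1 : Fin 4 → ℝ) k * ((Pi.single i 1 : Fin 4 → ℝ) l * A k l)) := fun k l => by ring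
  simp only [this, Finset.sum_add_distrib, ← Finset.mul_sum]
  simp [Pi.single_apply, mul_add]

namespace MetricFamily

variable {U : Set E4} {G : ℝ → (Fin 2 → Fin 4) → E4 → ℝ} (hG : MetricFamily U G)

include hG

/-- A timelike vector of g(0) at `y` stays timelike, with the same components, for all g(s) with `s`
small on one fixed neighbourhood of `y`; the margin used is half the value q(y). -/
theorem exists_nhds_timelike {v : Fin 4 → ℝ} {y : E4} (hy : y ∈ U)
    (hv : quadForm (fun i j => G 0 ![i, j] y) v < 0) :
    ∃ V ∈ 𝓝 y, V ⊆ U ∧ ∀ᶠ s in 𝓝[>] (0 : ℝ), ∀ z ∈ V,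
      quadForm (fun i j => G s ![i, j] z) v < 0 := by
  set q := fun z => quadForm (fun i j => G 0 ![i, j] z) v
  have hq : ContinuousOn q U := continuousOn_finsetSum _ fun i _ => continuousOn_finsetSum _
    fun j _ => continuousOn_const.mul (hG.smooth le_rfl i j).continuousOn
  have hnb : {z | q z < q y / 2} ∩ U ∈ 𝓝 y :=
    inter_mem ((hq.continuousAt (hG.isOpen.mem_nhds hy)).eventually
      (gt_mem_nhds (by linarith : q y < q y / 2))) (hG.isOpen.mem_nhds hy)
  obtain ⟨K, hK, hKs, hKc⟩ := local_compact_nhds hnb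
  have hd : UniformO U 1 (fun s z => quadForm (fun i j => G s ![i, j] z - G 0 ![i, j] z) v) :=
    UniformO.sum fun i _ => UniformO.sum fun j _ => (hG.near i j).near.const_mul continuousOn_const
  obtain ⟨C, hC0, hC⟩ := hd.bound K (fun z hz => (hKs hz).2) hKc
  refine ⟨K, hK, fun z hz => (hKs hz).2, ?_⟩
  have hlim : ∀ᶠ s in 𝓝[>] (0 : ℝ), C * s < - (q y / 2) := by
    refine eventually_nhdsWithin_of_eventually_nhds ?_
    have : Tendsto (fun s : ℝ => C * s) (𝓝 0) (𝓝 (C * 0)) :=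
      (continuous_const.mul continuous_id).tendsto 0
    rw [mul_zero] at this
    exact this.eventually (gt_mem_nhds (by linarith))
  filter_upwards [hC, hlim] with s h1 h2 z hz
  have h3 := h1 z hz
  rw [quadForm_sub, pow_one] at h3
  have h4 : q z < q y / 2 := (hKs hz).1
  have h5 := (abs_le.1 h3).2
  simp only [q] at h4 h2 h5 ⊢
  linarith

/-- Positivity is known only on timelike vectors. The cone is open, so v, v + εe_i, v + εe_j and v +
ε(e_i + e_j) are all timelike for small ε, and polarization recovers E_{ij} + E_{ji} from these four
nonnegative quantities. -/
theorem l1Bounded_of_nonneg_timelike {E : ℝ → Fin 4 → Fin 4 → E4 → ℝ}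
    (hE : ∀ i j, DistBounded U (fun s => E s i j))
    (htime : ∀ y ∈ U, ∃ v, quadForm (fun i j => G 0 ![i, j] y) v < 0)
    (hpos : ∀ s, 0 < s → ∀ y ∈ U, ∀ v, quadForm (fun i j => G s ![i, j] y) v < 0 →
      0 ≤ quadForm (fun i j => E s i j y) v) (i j : Fin 4) :
    L1Bounded U (fun s y => E s i j y + E s j i y) := by
  have hU := hG.isOpen
  refine L1Bounded.of_local (fun s hs => ((hE i j).cont s hs).add ((hE j i).cont s hs)) ?_
  intro y hy
  obtain ⟨v, hv⟩ := htime y hy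
  have hnear : ∀ w : Fin 4 → ℝ, ∀ᶠ ε in 𝓝[>] (0 : ℝ),
      quadForm (fun i j => G 0 ![i, j] y) (v + ε • w) < 0 := fun w => by
    refine eventually_nhdsWithin_of_eventually_nhds ?_
    have : Tendsto (fun ε : ℝ => quadForm (fun i j => G 0 ![i, j] y) (v + ε • w)) (𝓝 0)
        (𝓝 (quadForm (fun i j => G 0 ![i, j] y) (v + (0 : ℝ) • w))) :=
      ((continuous_quadForm _).comp (by fun_prop : Continuous fun ε : ℝ => v + ε • w)).tendsto 0
    rw [zero_smul, add_zero] at this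
    exact this.eventually (gt_mem_nhds hv)
  obtain ⟨ε, h1, h2, h3, hε⟩ := ((hnear (Pi.single i 1 + Pi.single j 1)).and
    ((hnear (Pi.single i 1)).and ((hnear (Pi.single j 1)).and eventually_pos_right))).exists
  have hd : ∀ w, DistBounded U (fun s y => quadForm (fun i j => E s i j y) w) := fun w =>
    DistBounded.sum hU fun k _ => DistBounded.sum hU fun l _ => (hE k l).const_mul _
  have hloc : ∀ w, quadForm (fun i j => G 0 ![i, j] y) w < 0 → ∃ t ∈ 𝓝 y, ∃ C : NNReal,
      ∀ᶠ s in 𝓝[>] (0 : ℝ), ∫⁻ z in t, ‖quadForm (fun i j => E s i j z) w‖ₑ ≤ C := by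
    intro w hw
    obtain ⟨V, hV, hVU, hneg⟩ := hG.exists_nhds_timelike hy hw
    refine (hd w).exists_lintegral_le hU hVU hV ?_
    filter_upwards [hneg, eventually_pos_right] with s h4 h5 z hz
    exact hpos s h5 z (hVU hz) w (h4 z hz)
  obtain ⟨t1, ht1, C1, hC1⟩ := hloc _ h1
  obtain ⟨t2, ht2, C2, hC2⟩ := hloc _ h2
  obtain ⟨t3, ht3, C3, hC3⟩ := hloc _ h3
  obtain ⟨t4, ht4, C4, hC4⟩ := hloc _ hv
  obtain ⟨t, htsub, hto, hyt⟩ := mem_nhds_iff.1 (inter_mem (inter_mem (inter_mem ht1 ht2)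
    (inter_mem ht3 ht4)) (hU.mem_nhds hy))
  -- Polarization produces ε²(E_{ij} + E_{ji}), so the bound is rescaled by ε⁻².
  set D : ℝ := (ε ^ 2)⁻¹
  have hD : 0 ≤ D := by positivity
  refine ⟨t, hto.mem_nhds hyt, D.toNNReal * (C1 + C2 + C3 + C4), ?_⟩
  filter_upwards [hC1, hC2, hC3, hC4, eventually_pos_right] with s g1 g2 g3 g4 hs
  have hme : ∀ w, AEMeasurable (fun z => ‖quadForm (fun i j => E s i j z) w‖ₑ)
      (volume.restrict t) := fun w =>
    ((((hd w).cont s hs).mono fun z hz => (htsub hz).2).aemeasurable hto.measurableSet).enorm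
  calc ∫⁻ z in t, ‖E s i j z + E s j i z‖ₑ
      ≤ ∫⁻ z in t, D.toNNReal *
          (‖quadForm (fun i j => E s i j z) (v + ε • (Pi.single i 1 + Pi.single j 1))‖ₑ
          + ‖quadForm (fun i j => E s i j z) (v + ε • Pi.single i 1)‖ₑ
          + ‖quadForm (fun i j => E s i j z) (v + ε • Pi.single j 1)‖ₑ
          + ‖quadForm (fun i j => E s i j z) v‖ₑ) := by
        refine lintegral_mono fun z => ?_
        have e : E s i j z + E s j i z = D * (ε ^ 2 * (E s i j z + E s j i z)) := by
          rw [← mul_assoc, inv_mul_cancel₀ (by positivity), one_mul]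
        beta_reduce
        rw [e, quadForm_polarization (fun i j => E s i j z) v i j ε, enorm_mul,
          Real.enorm_eq_ofReal hD]
        gcongr
        · exact le_rfl
        · refine (enorm_add_le _ _).trans ?_
          gcongr
          refine (enorm_sub_le).trans ?_
          gcongr
          exact enorm_sub_le
    _ ≤ _ := by
        rw [lintegral_const_mul' _ _ ENNReal.coe_ne_top,
          lintegral_add_right' _ (hme _), lintegral_add_right' _ (hme _),
          lintegral_add_right' _ (hme _)]
        push_cast
        gcongr
        · exact (lintegral_mono_set fun z hz => (htsub hz).1.1.1).trans g1
        · exact (lintegral_mono_set fun z hz => (htsub hz).1.1.2).trans g2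
        · exact (lintegral_mono_set fun z hz => (htsub hz).1.2.1).trans g3
        · exact (lintegral_mono_set fun z hz => (htsub hz).1.2.2).trans g4

theorem inverse_symm {s : ℝ} (hs : 0 ≤ s) {y : E4} (hy : y ∈ U) (i j : Fin 4) :
    inverseMetric (G s) i j y = inverseMetric (G s) j i y := by
  have : (Matrix.of fun a b : Fin 4 => G s ![a, b] y).transpose =
      Matrix.of fun a b : Fin 4 => G s ![a, b] y := by
    ext a b; simp [hG.symm s hs y hy a b]
  simp only [inverseMetric]
  conv_lhs => rw [← this, ← Matrix.transpose_nonsing_inv, Matrix.transpose_apply]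

theorem metricTrace_self {s : ℝ} (hs : 0 ≤ s) {y : E4} (hy : y ∈ U) :
    metricTrace (G s) (fun i j => G s ![i, j]) y = 4 := by
  have h : (Matrix.of fun a b : Fin 4 => G s ![a, b] y)⁻¹ *
      (Matrix.of fun a b : Fin 4 => G s ![a, b] y) = 1 :=
    Matrix.nonsing_inv_mul _ (hG.det s hs y hy).isUnit
  have h2 : ∀ i, ∑ j, inverseMetric (G s) i j y * G s ![i, j] y = 1 := fun i => by
    have := congrFun (congrFun h i) i
    rw [Matrix.mul_apply, Matrix.one_apply_eq] at this
    rw [← this]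
    exact Finset.sum_congr rfl fun j _ => by rw [hG.symm s hs y hy i j]; rfl
  simp [metricTrace, h2]

/-- The Ricci tensor in terms of `E = G + Λ g`. -/
theorem ricci_eq {s : ℝ} (hs : 0 ≤ s) (Λ : ℝ) {y : E4} (hy : y ∈ U) (i j : Fin 4) :
    ricci (G s) i j y = (einstein (G s) i j y + Λ * G s ![i, j] y) -
      (1 / 2) * metricTrace (G s) (fun k l z => einstein (G s) k l z + Λ * G s ![k, l] z) y *
        G s ![i, j] y + Λ * G s ![i, j] y := by
  have h1 : metricTrace (G s) (fun k l z => einstein (G s) k l z + Λ * G s ![k, l] z) y =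
      metricTrace (G s) (ricci (G s)) y - (1 / 2) * metricTrace (G s) (ricci (G s)) y *
        metricTrace (G s) (fun i j => G s ![i, j]) y +
        Λ * metricTrace (G s) (fun i j => G s ![i, j]) y := by
    simp only [einstein]
    set R := metricTrace (G s) (ricci (G s))
    simp only [R, metricTrace, Finset.mul_sum, ← Finset.sum_sub_distrib, ← Finset.sum_add_distrib]
    exact Finset.sum_congr rfl fun _ _ => Finset.sum_congr rfl fun _ _ => by ring
  -- Dimension four enters here: with g^{ij}g_{ij} = 4 the trace of G + Λg is −R + 4Λ.
  rw [h1, hG.metricTrace_self hs hy, einstein]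
  ring

/-- Under the weak energy condition the symmetrized Ricci tensors are bounded in `L¹`. -/
theorem l1Bounded_ricci (Λ : ℝ) (htime : ∀ y ∈ U, ∃ v, quadForm (fun i j => G 0 ![i, j] y) v < 0)
    (hpos : ∀ s, 0 < s → ∀ y ∈ U, ∀ v, quadForm (fun i j => G s ![i, j] y) v < 0 →
      0 ≤ quadForm (fun i j => einstein (G s) i j y + Λ * G s ![i, j] y) v) (i j : Fin 4) :
    L1Bounded U (fun s y => ricci (G s) i j y + ricci (G s) j i y) := by
  have hU := hG.isOpen
  have hE : ∀ i j, DistBounded U (fun s y => einstein (G s) i j y + Λ * G s ![i, j] y) :=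
    fun i j => (hG.distBounded_einstein i j).add hU
      ((DistBounded.of_uniformO (hG.near i j).bounded).const_mul Λ)
  have hL := hG.l1Bounded_of_nonneg_timelike
    (E := fun s i j y => einstein (G s) i j y + Λ * G s ![i, j] y) hE htime hpos
  have htr : L1Bounded U (fun s y =>
      metricTrace (G s) (fun k l z => einstein (G s) k l z + Λ * G s ![k, l] z) y) := by
    -- The inverse metric is symmetric, so the trace of E is half the contraction of E_{kl} +
    -- E_{lk}, for which the `L¹` bound is available.
    refine ((L1Bounded.sum (t := Finset.univ) fun k _ => L1Bounded.sum (t := Finset.univ) fun l _ =>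
      (hL k l).bounded_mul (hG.near_inverse k l).bounded).const_mul (1 / 2)).congr ?_
    intro s hs y hy
    simp only [metricTrace, mul_add, Finset.sum_add_distrib]
    rw [Finset.sum_comm (f := fun k l => inverseMetric (G s) k l y * einstein (G s) l k y),
      Finset.sum_comm (f := fun k l => inverseMetric (G s) k l y * (Λ * G s ![l, k] y))]
    simp only [hG.inverse_symm hs.le hy _]
    ring
  have hg := fun i j => (hG.near i j).bounded
  refine (((hL i j).sub (htr.bounded_mul (hg i j))).add
    ((hg i j).l1Bounded.const_mul (2 * Λ))).congr fun s hs y hy => ?_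
  beta_reduce
  rw [hG.ricci_eq hs.le Λ hy i j, hG.ricci_eq hs.le Λ hy j i, hG.symm s hs.le y hy j i]
  ring

end MetricFamily

/-! ### The algebraic identity behind tracelessness. -/

section ContractionAlgebra

theorem sum_rotate3 {ι : Type*} [Fintype ι] (f : ι → ι → ι → ℝ) :
    ∑ a, ∑ b, ∑ c, f a b c = ∑ c, ∑ a, ∑ b, f a b c := by
  rw [Finset.sum_comm (s := (Finset.univ : Finset ι)) (f := fun c a => ∑ b, f a b c)]
  exact Finset.sum_congr rfl fun a _ => Finset.sum_comm

theorem sum_rotate3' {ι : Type*} [Fintype ι] (f : ι → ι → ι → ℝ) :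
    ∑ a, ∑ b, ∑ c, f a b c = ∑ b, ∑ c, ∑ a, f a b c :=
  (sum_rotate3 fun b c a => f a b c).symm

theorem sum_swap_pairs {ι : Type*} [Fintype ι] (f : ι → ι → ι → ι → ℝ) :
    ∑ a, ∑ b, ∑ c, ∑ d, f a b c d = ∑ c, ∑ d, ∑ a, ∑ b, f a b c d := by
  rw [Finset.sum_congr rfl fun a _ => sum_rotate3' (f a), sum_rotate3' fun a c d => ∑ b, f a b c d]

/-- Contraction of three pairs of indices with `N`. -/
def contract3 (N : Fin 4 → Fin 4 → ℝ)
    (F : Fin 4 × Fin 4 → Fin 4 × Fin 4 → Fin 4 × Fin 4 → ℝ) : ℝ :=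
  ∑ u, ∑ v, ∑ w, N u.1 u.2 * N v.1 v.2 * N w.1 w.2 * F u v w

variable {N : Fin 4 → Fin 4 → ℝ} (hN : ∀ i j, N i j = N j i)
  (F : Fin 4 × Fin 4 → Fin 4 × Fin 4 → Fin 4 × Fin 4 → ℝ)

theorem contract3_comm12 : contract3 N F = contract3 N fun u v w => F v u w := by
  unfold contract3
  rw [Finset.sum_comm]
  simp only [mul_comm (N _ _) (N _ _)]

theorem contract3_comm23 : contract3 N F = contract3 N fun u v w => F u w v := by
  unfold contract3
  refine Finset.sum_congr rfl fun u _ => ?_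
  rw [Finset.sum_comm]
  exact Finset.sum_congr rfl fun v _ => Finset.sum_congr rfl fun w _ => by ring

include hN in
theorem contract3_swap1 : contract3 N F = contract3 N fun u v w => F u.swap v w := by
  unfold contract3
  rw [← (Equiv.prodComm (Fin 4) (Fin 4)).sum_comp]
  refine Finset.sum_congr rfl fun u _ => ?_
  simp [hN u.2 u.1]

include hN in
theorem contract3_swap2 : contract3 N F = contract3 N fun u v w => F u v.swap w := by
  rw [contract3_comm12, contract3_swap1 hN, contract3_comm12]

variable {F} in
theorem contract3_congr {F' : Fin 4 × Fin 4 → Fin 4 × Fin 4 → Fin 4 × Fin 4 → ℝ}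
    (h : ∀ u v w, F u v w = F' u v w) : contract3 N F = contract3 N F' := by
  have : F = F' := by ext; apply h
  rw [this]

theorem contract3_cycle : contract3 N F = contract3 N fun u v w => F v w u := by
  rw [contract3_comm23, contract3_comm12]

theorem contract3_cycle' : contract3 N F = contract3 N fun u v w => F w u v := by
  rw [contract3_comm12, contract3_comm23]

theorem contract3_reverse : contract3 N F = contract3 N fun u v w => F w v u := by
  rw [contract3_comm12, contract3_comm23, contract3_comm12]

theorem contract3_add (F' : Fin 4 × Fin 4 → Fin 4 × Fin 4 → Fin 4 × Fin 4 → ℝ) :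
    contract3 N (fun u v w => F u v w + F' u v w) = contract3 N F + contract3 N F' := by
  simp only [contract3, mul_add, Finset.sum_add_distrib]

theorem contract3_sub (F' : Fin 4 × Fin 4 → Fin 4 × Fin 4 → Fin 4 × Fin 4 → ℝ) :
    contract3 N (fun u v w => F u v w - F' u v w) = contract3 N F - contract3 N F' := by
  simp only [contract3, mul_sub, Finset.sum_sub_distrib]

variable {p : Fin 4 → Fin 4 → Fin 4 → ℝ} (hp : ∀ c i j, p c i j = p c j i)

include hN hp in
-- With `N` symmetric and `p` symmetric in its last two indices, every product that occurs contracts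
-- to one of two invariants, A = p_{abc}p^{abc} or B = p_{abc}p^{bac}. The nine products on the left
-- and the three on the right both sum to 2B − A.
theorem contract3_koszul_mul_koszul :
    contract3 N (fun u v w => koszul p v.2 u.2 w.1 * koszul p w.2 u.1 v.1) =
      contract3 N (fun u v w => p w.1 u.1 v.1 * koszul p w.2 u.2 v.2) := by
  set A := contract3 N fun u v w => p u.1 v.1 w.1 * p u.2 v.2 w.2
  set B := contract3 N fun u v w => p u.1 v.1 w.1 * p v.2 u.2 w.2
  have h1 : contract3 N (fun u v w => p u.2 w.1 v.2 * p u.1 v.1 w.2) = A := by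
    rw [contract3_swap1 hN, contract3_swap2 hN]
    exact contract3_congr fun u v w => by simp [hp _ w.1]
  have h2 : contract3 N (fun u v w => p u.2 w.1 v.2 * p v.1 u.1 w.2) = B := by
    rw [contract3_swap1 hN, contract3_swap2 hN]
    exact contract3_congr fun u v w => by simp [hp _ w.1]
  have h3 : contract3 N (fun u v w => p u.2 w.1 v.2 * p w.2 u.1 v.1) = B := by
    rw [contract3_swap1 hN, contract3_swap2 hN, contract3_comm23]
    exact contract3_congr fun u v w => by simp
  have h4 : contract3 N (fun u v w => p w.1 u.2 v.2 * p u.1 v.1 w.2) = B := by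
    rw [contract3_swap1 hN, contract3_swap2 hN, contract3_cycle]
    exact contract3_congr fun u v w => by simp [hp _ w.2]
  have h5 : contract3 N (fun u v w => p w.1 u.2 v.2 * p v.1 u.1 w.2) = B := by
    rw [contract3_swap1 hN, contract3_swap2 hN, contract3_reverse]
    exact contract3_congr fun u v w => by simp [hp _ w.1, hp _ w.2]
  have h6 : contract3 N (fun u v w => p w.1 u.2 v.2 * p w.2 u.1 v.1) = A := by
    rw [contract3_swap1 hN, contract3_swap2 hN, contract3_cycle]
    exact contract3_congr fun u v w => by simp
  have h7 : contract3 N (fun u v w => p v.2 u.2 w.1 * p u.1 v.1 w.2) = B := by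
    rw [contract3_swap1 hN, contract3_swap2 hN, contract3_comm12]
    exact contract3_congr fun u v w => by simp
  have h8 : contract3 N (fun u v w => p v.2 u.2 w.1 * p v.1 u.1 w.2) = A := by
    rw [contract3_swap1 hN, contract3_swap2 hN, contract3_comm12]
    exact contract3_congr fun u v w => by simp
  have h9 : contract3 N (fun u v w => p v.2 u.2 w.1 * p w.2 u.1 v.1) = B := by
    rw [contract3_swap1 hN, contract3_swap2 hN, contract3_cycle']
    exact contract3_congr fun u v w => by simp [hp _ w.1, hp _ w.2]
  have g1 : contract3 N (fun u v w => p w.1 u.1 v.1 * p u.2 v.2 w.2) = B := by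
    rw [contract3_cycle]
    exact contract3_congr fun u v w => by simp [hp _ w.2]
  have g2 : contract3 N (fun u v w => p w.1 u.1 v.1 * p v.2 u.2 w.2) = B := by
    rw [contract3_reverse]
    exact contract3_congr fun u v w => by simp [hp _ w.1, hp _ w.2]
  have g3 : contract3 N (fun u v w => p w.1 u.1 v.1 * p w.2 u.2 v.2) = A := by
    rw [contract3_cycle]
  have e1 : contract3 N (fun u v w => koszul p v.2 u.2 w.1 * koszul p w.2 u.1 v.1) =
      contract3 N fun u v w => p u.2 w.1 v.2 * p u.1 v.1 w.2 + p u.2 w.1 v.2 * p v.1 u.1 w.2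
        - p u.2 w.1 v.2 * p w.2 u.1 v.1 + p w.1 u.2 v.2 * p u.1 v.1 w.2
        + p w.1 u.2 v.2 * p v.1 u.1 w.2 - p w.1 u.2 v.2 * p w.2 u.1 v.1
        - p v.2 u.2 w.1 * p u.1 v.1 w.2 - p v.2 u.2 w.1 * p v.1 u.1 w.2
        + p v.2 u.2 w.1 * p w.2 u.1 v.1 :=
    contract3_congr fun u v w => by simp only [koszul]; ring
  have e2 : contract3 N (fun u v w => p w.1 u.1 v.1 * koszul p w.2 u.2 v.2) =
      contract3 N fun u v w => p w.1 u.1 v.1 * p u.2 v.2 w.2 + p w.1 u.1 v.1 * p v.2 u.2 w.2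
        - p w.1 u.1 v.1 * p w.2 u.2 v.2 :=
    contract3_congr fun u v w => by simp only [koszul]; ring
  rw [e1, e2]
  simp only [contract3_add, contract3_sub, h1, h2, h3, h4, h5, h6, h7, h8, h9, g1, g2, g3]
  ring

/-- `C^k_{ij} = (1/2) N^{ka} (p_{ija} + p_{jia} - p_{aij})`. -/
noncomputable def raisedKoszul (N : Fin 4 → Fin 4 → ℝ) (p : Fin 4 → Fin 4 → Fin 4 → ℝ)
    (k i j : Fin 4) : ℝ := (1 / 2) * ∑ a, N k a * koszul p a i j

/-- The quadratic form `p_{kab} C^k_{cd} - p_{dab} C^k_{kc}`. -/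
noncomputable def gradKoszul (N : Fin 4 → Fin 4 → ℝ) (p : Fin 4 → Fin 4 → Fin 4 → ℝ)
    (a b c d : Fin 4) : ℝ :=
  ∑ k, (p k a b * raisedKoszul N p k c d - p d a b * raisedKoszul N p k k c)

include hp in
theorem raisedKoszul_symm (k i j : Fin 4) : raisedKoszul N p k i j = raisedKoszul N p k j i := by
  simp only [raisedKoszul, koszul]
  congr 1
  exact Finset.sum_congr rfl fun a _ => by rw [hp a i j]; ring

include hN hp in
-- In the trace C^k_{kl} the first and third Koszul terms cancel by the symmetries of `N` and `p`.
theorem sum_raisedKoszul (l : Fin 4) :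
    ∑ k, raisedKoszul N p k k l = (1 / 2) * ∑ k, ∑ a, N k a * p l k a := by
  simp only [raisedKoszul, koszul, ← Finset.mul_sum]
  congr 1
  have : ∑ k, ∑ a, N k a * p a k l = ∑ k, ∑ a, N k a * p k l a := by
    rw [Finset.sum_comm]
    exact Finset.sum_congr rfl fun k _ => Finset.sum_congr rfl fun a _ => by rw [hN, hp k a l]
  simp only [mul_sub, mul_add, Finset.sum_sub_distrib, Finset.sum_add_distrib, this]
  ring

include hN in
theorem contract_raisedKoszul (k : Fin 4) :
    ∑ i, ∑ j, N i j * raisedKoszul N p k i j =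
      ∑ b, N k b * (∑ i, ∑ j, N i j * p i j b - (1 / 2) * ∑ i, ∑ j, N i j * p b i j) := by
  have h1 : ∀ b, ∑ i, ∑ j, N i j * p j i b = ∑ i, ∑ j, N i j * p i j b := fun b => by
    rw [Finset.sum_comm]
    exact Finset.sum_congr rfl fun k _ => Finset.sum_congr rfl fun a _ => by rw [hN]
  have h2 : ∀ b, ∑ i, ∑ j, N i j * koszul p b i j =
      2 * ∑ i, ∑ j, N i j * p i j b - ∑ i, ∑ j, N i j * p b i j := fun b => by
    simp only [koszul, mul_sub, mul_add, Finset.sum_sub_distrib, Finset.sum_add_distrib, h1]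
    ring
  have h3 : ∑ i, ∑ j, N i j * raisedKoszul N p k i j =
      ∑ b, (1 / 2) * (N k b * ∑ i, ∑ j, N i j * koszul p b i j) := by
    simp only [raisedKoszul, Finset.mul_sum]
    rw [sum_rotate3]
    exact Finset.sum_congr rfl fun b _ => Finset.sum_congr rfl fun i _ =>
      Finset.sum_congr rfl fun j _ => by ring
  rw [h3]
  exact Finset.sum_congr rfl fun b _ => by rw [h2]; ring

include hN hp in
/-- The trace of the quadratic part of the Ricci tensor in terms of contractions of
`p_{kab} C^k_{cd} - p_{dab} C^k_{kc}`. -/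
theorem trace_raisedKoszul_mul :
    ∑ i, ∑ j, N i j * ∑ k, ∑ l, (raisedKoszul N p k k l * raisedKoszul N p l i j -
        raisedKoszul N p k j l * raisedKoszul N p l i k) =
      -(1 / 4) * ∑ a, ∑ b, ∑ c, ∑ d, N a c * N b d *
        (gradKoszul N p a b c d + gradKoszul N p a b d c) +
      (1 / 8) * ∑ a, ∑ b, ∑ c, ∑ d, N a b * N c d *
        (gradKoszul N p a b c d + gradKoszul N p a b d c) := by
  set C := raisedKoszul N p with hC
  -- τ_l = p_{lk}^k is the trace of `p` over its metric indices, and V_b = p_{i}^{i}_b its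
  -- divergence; they give C^k_{kl} = ½τ_l and N^{ij}C^k_{ij} = V^k − ½τ^k.
  set τ : Fin 4 → ℝ := fun l => ∑ k, ∑ a, N k a * p l k a with hτ
  set V : Fin 4 → ℝ := fun b => ∑ i, ∑ j, N i j * p i j b with hV
  have ht : ∀ l, ∑ k, C k k l = (1 / 2) * τ l := sum_raisedKoszul hN hp
  have hCV : ∀ k, ∑ i, ∑ j, N i j * C k i j = ∑ b, N k b * (V b - (1 / 2) * τ b) :=
    contract_raisedKoszul hN
  have hsym : ∀ k i j, C k i j = C k j i := raisedKoszul_symm hp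
  have hK : ∀ a b c d, gradKoszul N p a b c d + gradKoszul N p a b d c =
      2 * ∑ k, p k a b * C k c d - (1 / 2) * (p d a b * τ c + p c a b * τ d) := by
    intro a b c d
    simp only [gradKoszul, Finset.sum_sub_distrib, ← Finset.mul_sum, ← hC, ht, hsym _ d c]
    ring
  -- Everything reduces to the scalars S₁, T₁, V·τ and τ·τ. The left side is ½(T₁ − S₁), the two
  -- contractions on the right are 2S₁ − V·τ and 2T₁ − τ·τ, and T₁ = V·τ − ½τ·τ. The coefficients
  -- −1/4 and 1/8 make these agree.
  set S₁ := ∑ a, ∑ b, ∑ c, ∑ d, N a c * N b d * ∑ k, p k a b * C k c d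
  set T₁ := ∑ a, ∑ b, ∑ c, ∑ d, N a b * N c d * ∑ k, p k a b * C k c d
  set VT := ∑ a, ∑ c, N a c * V a * τ c
  set TT := ∑ a, ∑ c, N a c * τ a * τ c
  have hS₂ : ∑ a, ∑ b, ∑ c, ∑ d, N a c * N b d * (p d a b * τ c) = VT := by
    refine Finset.sum_congr rfl fun a _ => ?_
    rw [Finset.sum_comm]
    refine Finset.sum_congr rfl fun c _ => ?_
    rw [Finset.sum_comm]
    simp only [hV, Finset.mul_sum, Finset.sum_mul]
    exact Finset.sum_congr rfl fun d _ => Finset.sum_congr rfl fun b _ => by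
      rw [hN b d, hp d a b]; ring
  have hS₃ : ∑ a, ∑ b, ∑ c, ∑ d, N a c * N b d * (p c a b * τ d) = VT := by
    rw [Finset.sum_comm]
    refine Finset.sum_congr rfl fun b _ => ?_
    rw [sum_rotate3]
    refine Finset.sum_congr rfl fun d _ => ?_
    rw [Finset.sum_comm]
    simp only [hV, Finset.mul_sum, Finset.sum_mul]
    exact Finset.sum_congr rfl fun c _ => Finset.sum_congr rfl fun a _ => by
      rw [hN a c]; ring
  have hT₂ : ∑ a, ∑ b, ∑ c, ∑ d, N a b * N c d * (p d a b * τ c) = TT := by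
    rw [sum_swap_pairs, Finset.sum_comm]
    refine Finset.sum_congr rfl fun d _ => Finset.sum_congr rfl fun c _ => ?_
    rw [show N d c * τ d * τ c = τ d * (N c d * τ c) by rw [hN d c]; ring]
    conv_rhs => rw [hτ]
    simp only [Finset.sum_mul]
    exact Finset.sum_congr rfl fun a _ => Finset.sum_congr rfl fun b _ => by ring
  have hT₃ : ∑ a, ∑ b, ∑ c, ∑ d, N a b * N c d * (p c a b * τ d) = TT := by
    rw [sum_swap_pairs]
    refine Finset.sum_congr rfl fun c _ => Finset.sum_congr rfl fun d _ => ?_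
    rw [show N c d * τ c * τ d = τ c * (N c d * τ d) by ring]
    conv_rhs => rw [hτ]
    simp only [Finset.sum_mul]
    exact Finset.sum_congr rfl fun a _ => Finset.sum_congr rfl fun b _ => by ring
  have hT₁ : T₁ = ∑ k, τ k * ∑ i, ∑ j, N i j * C k i j := by
    have e : ∀ a b, ∑ c, ∑ d, N a b * N c d * ∑ k, p k a b * C k c d =
        ∑ k, N a b * p k a b * ∑ c, ∑ d, N c d * C k c d := fun a b => by
      simp only [Finset.mul_sum]
      rw [sum_rotate3]
      exact Finset.sum_congr rfl fun k _ => Finset.sum_congr rfl fun c _ =>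
        Finset.sum_congr rfl fun d _ => by ring
    simp only [T₁, e, hτ, Finset.sum_mul]
    rw [sum_rotate3]
  have hT₁' : T₁ = VT - (1 / 2) * TT := by
    rw [hT₁]
    simp only [hCV]
    simp only [VT, TT, Finset.mul_sum]
    rw [Finset.sum_comm (f := fun a c => N a c * V a * τ c), ← Finset.sum_sub_distrib]
    refine Finset.sum_congr rfl fun k _ => ?_
    rw [← Finset.sum_sub_distrib]
    exact Finset.sum_congr rfl fun b _ => by rw [hN b k]; ring
  have hQ₁ : ∑ i, ∑ j, N i j * ∑ k, ∑ l, C k k l * C l i j = (1 / 2) * T₁ := by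
    have e : ∀ i j, N i j * ∑ k, ∑ l, C k k l * C l i j =
        ∑ l, (1 / 2) * (τ l * (N i j * C l i j)) := fun i j => by
      rw [Finset.sum_comm, Finset.mul_sum]
      refine Finset.sum_congr rfl fun l _ => ?_
      rw [← Finset.sum_mul, ht]
      ring
    simp only [hT₁, e, Finset.mul_sum]
    rw [sum_rotate3]
  have hQ₂ : ∑ i, ∑ j, N i j * ∑ k, ∑ l, C k j l * C l i k = (1 / 2) * S₁ := by
    have e1 : ∑ i, ∑ j, N i j * ∑ k, ∑ l, C k j l * C l i k = (1 / 4) *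
        contract3 N (fun u v w => koszul p v.2 u.2 w.1 * koszul p w.2 u.1 v.1) := by
      simp only [contract3, Fintype.sum_prod_type, Finset.mul_sum]
      refine Finset.sum_congr rfl fun i _ => Finset.sum_congr rfl fun j _ =>
        Finset.sum_congr rfl fun k _ => ?_
      rw [Finset.sum_comm]
      refine Finset.sum_congr rfl fun l _ => ?_
      simp only [hC, raisedKoszul, Finset.mul_sum, Finset.sum_mul]
      rw [Finset.sum_comm]
      refine Finset.sum_congr rfl fun a _ => Finset.sum_congr rfl fun b _ => ?_
      ring
    have e2 : S₁ = (1 / 2) * contract3 N (fun u v w => p w.1 u.1 v.1 * koszul p w.2 u.2 v.2) := by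
      simp only [S₁, contract3, Fintype.sum_prod_type, Finset.mul_sum]
      refine Finset.sum_congr rfl fun a _ => ?_
      rw [Finset.sum_comm]
      refine Finset.sum_congr rfl fun c _ => Finset.sum_congr rfl fun b _ =>
        Finset.sum_congr rfl fun d _ => Finset.sum_congr rfl fun k _ => ?_
      simp only [hC, raisedKoszul, Finset.mul_sum]
      exact Finset.sum_congr rfl fun f _ => by ring
    rw [e1, e2, contract3_koszul_mul_koszul hN hp]
    ring
  have hS : ∑ a, ∑ b, ∑ c, ∑ d, N a c * N b d *
      (gradKoszul N p a b c d + gradKoszul N p a b d c) = 2 * S₁ - VT := by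
    have e : ∀ a b c d, N a c * N b d * (gradKoszul N p a b c d + gradKoszul N p a b d c) =
        2 * (N a c * N b d * ∑ k, p k a b * C k c d) - (1 / 2) * (N a c * N b d * (p d a b * τ c))
          - (1 / 2) * (N a c * N b d * (p c a b * τ d)) := fun a b c d => by rw [hK]; ring
    simp only [e, Finset.sum_sub_distrib, ← Finset.mul_sum (a := (2 : ℝ)),
      ← Finset.mul_sum (a := (1 / 2 : ℝ)), hS₂, hS₃]
    ring
  have hT : ∑ a, ∑ b, ∑ c, ∑ d, N a b * N c d *
      (gradKoszul N p a b c d + gradKoszul N p a b d c) = 2 * T₁ - TT := by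
    have e : ∀ a b c d, N a b * N c d * (gradKoszul N p a b c d + gradKoszul N p a b d c) =
        2 * (N a b * N c d * ∑ k, p k a b * C k c d) - (1 / 2) * (N a b * N c d * (p d a b * τ c))
          - (1 / 2) * (N a b * N c d * (p c a b * τ d)) := fun a b c d => by rw [hK]; ring
    simp only [e, Finset.sum_sub_distrib, ← Finset.mul_sum (a := (2 : ℝ)),
      ← Finset.mul_sum (a := (1 / 2 : ℝ)), hT₂, hT₃]
    ring
  rw [hS, hT, hT₁']
  simp only [Finset.sum_sub_distrib, mul_sub, hQ₁, hQ₂, hT₁']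
  ring

end ContractionAlgebra

/-! ### Vanishing of the averaged trace and weak limit of the Einstein tensor. -/

namespace MetricFamily

variable {U : Set E4} {G : ℝ → (Fin 2 → Fin 4) → E4 → ℝ} (hG : MetricFamily U G)
  {m : (Fin 6 → Fin 4) → E4 → ℝ} (hm : ∀ a b c d e f,
  WeakTo U (fun s y => gradDiff G s y a c d * gradDiff G s y b e f) (m ![a, b, c, d, e, f]))
  (hR : ∀ i j, L1Bounded U (fun s y => ricci (G s) i j y + ricci (G s) j i y))

include hG

include hR in
-- γ_{ab}(R_{cd} + R_{dc}) is weakly null by the `L¹` bound, while integration by parts identifies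
-- it with minus this expression up to weakly null terms.
theorem weakTo_gradKoszul (a b c d : Fin 4) :
    WeakTo U (fun s y =>
      gradKoszul (fun i j => inverseMetric (G 0) i j y) (gradDiff G s y) a b c d +
        gradKoszul (fun i j => inverseMetric (G 0) i j y) (gradDiff G s y) a b d c)
      (fun _ => 0) := by
  have hU := hG.isOpen
  refine (((hG.weakTo_diff_mul_ricci a b c d).add hU (hG.weakTo_diff_mul_ricci a b d c)).sub hU
    ((hR c d).small_mul (hG.near a b).near)).congr (fun s hs y hy => ?_) (fun y _ => by simp)
  simp only [gradKoszul, linChristoffel, raisedKoszul]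
  ring

include hm hR

/-- The trace of the averaged quadratic part of the Ricci tensor vanishes. -/
theorem trace_quadRicci {y : E4} (hy : y ∈ U) :
    ∑ i, ∑ j, inverseMetric (G 0) i j y *
      quadRicci (fun a b => inverseMetric (G 0) a b y) (m · y) i j = 0 := by
  have hU := hG.isOpen
  have sN := fun i j => hG.smooth_inverse le_rfl i j
  have h1 := WeakTo.sum hU (t := Finset.univ) fun i _ => WeakTo.sum hU (t := Finset.univ)
    fun j _ => (WeakTo.sum hU (t := Finset.univ) fun k _ => WeakTo.sum hU (t := Finset.univ)
      fun l _ => (hG.weakTo_linChristoffel_mul hm k k l l i j).sub hU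
        (hG.weakTo_linChristoffel_mul hm k j l l i k)).smooth_mul hU (sN i j)
  have h2 := ((WeakTo.sum hU (t := Finset.univ) fun a _ => WeakTo.sum hU (t := Finset.univ)
    fun b _ => WeakTo.sum hU (t := Finset.univ) fun c _ => WeakTo.sum hU (t := Finset.univ)
      fun d _ => (hG.weakTo_gradKoszul hR a b c d).smooth_mul hU
        ((sN a c).mul (sN b d))).const_mul hU (-(1 / 4))).add hU
    ((WeakTo.sum hU (t := Finset.univ) fun a _ => WeakTo.sum hU (t := Finset.univ)
    fun b _ => WeakTo.sum hU (t := Finset.univ) fun c _ => WeakTo.sum hU (t := Finset.univ)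
      fun d _ => (hG.weakTo_gradKoszul hR a b c d).smooth_mul hU
        ((sN a b).mul (sN c d))).const_mul hU (1 / 8))
  -- The trace of the CC terms has two weak limits: the trace of `quadRicci` by the hypothesis on
  -- products of derivatives, and zero by the algebraic identity. Uniqueness equates them.
  have h3 := (h2.congr (G := fun _ => 0) (fun s hs z hz => trace_raisedKoszul_mul
    (N := fun i j => inverseMetric (G 0) i j z) (p := gradDiff G s z)
    (fun i j => hG.inverse_symm le_rfl hz i j) (fun c i j => hG.gradDiff_symm hs.le hz c i j))
    (fun z _ => by simp))
  exact h1.unique hU h3 hy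

/-- The nonlinear term R g_{ij} is handled by replacing g^{kl}(s)g_{ij}(s) with its value at zero;
the error is O(s) times an `L¹`-bounded family. What remains converges by the limit of Ricci, and
its Q-part vanishes because the trace does. -/
theorem weakTo_einstein (i j : Fin 4) :
    WeakTo U (fun s => einstein (G s) i j) (fun y => einstein (G 0) i j y +
      quadRicci (fun a b => inverseMetric (G 0) a b y) (m · y) i j) := by
  have hU := hG.isOpen
  have hN := fun k l => (hG.near_inverse k l).mul hU (hG.near i j)
  -- The factor 1/4 is the ½ of the Einstein tensor times the ½ of symmetrization, since the `L¹`
  -- bound concerns R_{kl} + R_{lk}.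
  have h1 := WeakTo.sum hU (t := Finset.univ) fun k _ => WeakTo.sum hU (t := Finset.univ)
    fun l _ => ((hR k l).small_mul (hN k l).near).const_mul hU (1 / 4)
  have h2 := WeakTo.sum hU (t := Finset.univ) fun k _ => WeakTo.sum hU (t := Finset.univ)
    fun l _ => ((hG.weakTo_ricci hm k l).smooth_mul hU (hN k l).smooth_lim).const_mul hU (1 / 2)
  refine (((hG.weakTo_ricci hm i j).sub hU h1).sub hU h2).congr (fun s hs y hy => ?_)
    (fun y hy => ?_)
  · simp only [einstein, metricTrace]
    have e : ∑ k, ∑ l, inverseMetric (G s) k l y * ricci (G s) l k y =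
        ∑ k, ∑ l, inverseMetric (G s) k l y * ricci (G s) k l y := by
      rw [Finset.sum_comm]
      exact Finset.sum_congr rfl fun k _ => Finset.sum_congr rfl fun l _ => by
        rw [hG.inverse_symm hs.le hy]
    have e₀ : ∑ k, ∑ l, inverseMetric (G 0) k l y * ricci (G s) l k y =
        ∑ k, ∑ l, inverseMetric (G 0) k l y * ricci (G s) k l y := by
      rw [Finset.sum_comm]
      exact Finset.sum_congr rfl fun k _ => Finset.sum_congr rfl fun l _ => by
        rw [hG.inverse_symm le_rfl hy]
    have e2 : ∑ k, ∑ l, (1 / 4) * ((inverseMetric (G s) k l y * G s ![i, j] y -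
        inverseMetric (G 0) k l y * G 0 ![i, j] y) *
        (ricci (G s) k l y + ricci (G s) l k y)) =
        (1 / 4) * G s ![i, j] y * (∑ k, ∑ l, inverseMetric (G s) k l y * ricci (G s) k l y)
        + (1 / 4) * G s ![i, j] y * (∑ k, ∑ l, inverseMetric (G s) k l y * ricci (G s) l k y)
        - (1 / 4) * G 0 ![i, j] y * (∑ k, ∑ l, inverseMetric (G 0) k l y * ricci (G s) k l y)
        - (1 / 4) * G 0 ![i, j] y *
          (∑ k, ∑ l, inverseMetric (G 0) k l y * ricci (G s) l k y) := by
      simp only [Finset.mul_sum, ← Finset.sum_add_distrib, ← Finset.sum_sub_distrib]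
      exact Finset.sum_congr rfl fun k _ => Finset.sum_congr rfl fun l _ => by ring
    have e3 : ∑ k, ∑ l, (1 / 2) * (inverseMetric (G 0) k l y * G 0 ![i, j] y *
        ricci (G s) k l y) =
        (1 / 2) * G 0 ![i, j] y * (∑ k, ∑ l, inverseMetric (G 0) k l y * ricci (G s) k l y) := by
      simp only [Finset.mul_sum]
      exact Finset.sum_congr rfl fun k _ => Finset.sum_congr rfl fun l _ => by ring
    rw [e2, e3, e, e₀]
    ring
  · have htr := hG.trace_quadRicci hm hR hy
    have e3 : ∑ k, ∑ l, (1 / 2) * (inverseMetric (G 0) k l y * G 0 ![i, j] y *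
        (ricci (G 0) k l y +
          quadRicci (fun a b => inverseMetric (G 0) a b y) (m · y) k l)) =
        (1 / 2) * G 0 ![i, j] y * (∑ k, ∑ l, inverseMetric (G 0) k l y * ricci (G 0) k l y) +
        (1 / 2) * G 0 ![i, j] y * (∑ k, ∑ l, inverseMetric (G 0) k l y *
          quadRicci (fun a b => inverseMetric (G 0) a b y) (m · y) k l) := by
      simp only [Finset.mul_sum, ← Finset.sum_add_distrib]
      exact Finset.sum_congr rfl fun k _ => Finset.sum_congr rfl fun l _ => by ring
    simp only [mul_zero, Finset.sum_const_zero]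
    rw [e3, htr]
    simp only [einstein, metricTrace]
    ring

omit hm hR
theorem smooth_quadRicci (hs : ∀ a, ContDiffOn ℝ ∞ (m a) U) (i j : Fin 4) :
    ContDiffOn ℝ ∞ (fun y => quadRicci (fun a b => inverseMetric (G 0) a b y) (m · y) i j) U := by
  have sN := fun i j => hG.smooth_inverse le_rfl i j
  have sk : ∀ a i j b k l, ContDiffOn ℝ ∞ (fun y => koszulProd (m · y) a i j b k l) U :=
    fun a i j b k l => ((((((((hs _).add (hs _)).sub (hs _)).add (hs _)).add (hs _)).sub
      (hs _)).sub (hs _)).sub (hs _)).add (hs _)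
  have sc : ∀ k l i j i' j', ContDiffOn ℝ ∞ (fun y => (1 / 4 : ℝ) * ∑ a, ∑ b,
      inverseMetric (G 0) k a y * inverseMetric (G 0) l b y *
        koszulProd (m · y) a i j b i' j') U := fun k l i j i' j' =>
    contDiffOn_const.mul (ContDiffOn.sum fun _ _ => ContDiffOn.sum fun _ _ =>
      ((sN _ _).mul (sN _ _)).mul (sk _ _ _ _ _ _))
  exact ContDiffOn.sum fun k _ => ContDiffOn.sum fun l _ =>
    (sc k l k l i j).sub (sc k l j l i k)

theorem smooth_einstein {s : ℝ} (hs : 0 ≤ s) (i j : Fin 4) :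
    ContDiffOn ℝ ∞ (einstein (G s) i j) U :=
  (hG.smooth_ricci hs i j).sub ((contDiffOn_const.mul (ContDiffOn.sum fun k _ =>
    ContDiffOn.sum fun l _ => (hG.smooth_inverse hs k l).mul (hG.smooth_ricci hs k l))).mul
      (hG.smooth hs i j))

end MetricFamily

/-! ### Basis-independent contractions on a vector space. -/

section TensorAlgebra

variable {V : Type*} [AddCommGroup V] [Module ℝ V]

/-- The Gram matrix of a bilinear form in a family of vectors. -/
def gramMatrix (g : MultilinearMap ℝ (fun _ : Fin 2 => V) ℝ) (b : Fin 4 → V) :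
    Matrix (Fin 4) (Fin 4) ℝ :=
  Matrix.of fun i j => g ![b i, b j]

/-- The bilinear form obtained by fixing all but the first two arguments. -/
def firstTwo {n : ℕ} (Φ : MultilinearMap ℝ (fun _ : Fin (n + 2) => V) ℝ) (z : Fin n → V) :
    V →ₗ[ℝ] V →ₗ[ℝ] ℝ :=
  LinearMap.mk₂ ℝ (fun x y => (Φ.curryLeft x).curryLeft y z) (by intros; simp) (by intros; simp)
    (by intros; simp) (by intros; simp)

theorem gramMatrix_change (B : V →ₗ[ℝ] V →ₗ[ℝ] ℝ) (b : Fin 4 → V)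
    (P : Matrix (Fin 4) (Fin 4) ℝ) :
    (Matrix.of fun i j => B (∑ k, P k i • b k) (∑ k, P k j • b k)) =
      P.transpose * (Matrix.of fun i j => B (b i) (b j)) * P := by
  ext i j
  simp only [Matrix.of_apply, Matrix.mul_apply, Matrix.transpose_apply, map_sum, map_smul,
    LinearMap.sum_apply, LinearMap.smul_apply, smul_eq_mul, Finset.sum_mul,
    Finset.mul_sum]
  exact Finset.sum_congr rfl fun k _ => Finset.sum_congr rfl fun l _ => by ring

theorem sum_mul_eq_trace (N M : Matrix (Fin 4) (Fin 4) ℝ) :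
    ∑ i, ∑ j, N i j * M i j = (N * M.transpose).trace := by
  simp [Matrix.trace, Matrix.mul_apply]

/-- The contraction of a bilinear form with the inverse of another does not depend on the basis. -/
theorem contraction_basis_change (g : MultilinearMap ℝ (fun _ : Fin 2 => V) ℝ)
    (B : V →ₗ[ℝ] V →ₗ[ℝ] ℝ) (b b' : Module.Basis (Fin 4) ℝ V) :
    ∑ i, ∑ j, (gramMatrix g b')⁻¹ i j * B (b' i) (b' j) =
      ∑ i, ∑ j, (gramMatrix g b)⁻¹ i j * B (b i) (b j) := by
  set P : Matrix (Fin 4) (Fin 4) ℝ := b.toMatrix b'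
  have hP : ∀ i, b' i = ∑ k, P k i • b k := fun i => (b.sum_toMatrix_smul_self b' i).symm
  have hPdet : IsUnit P.det := by
    have := Module.Basis.toMatrix_mul_toMatrix_flip b b'
    exact Matrix.isUnit_det_of_right_inverse this
  have hG : gramMatrix g b' = P.transpose * gramMatrix g b * P := by
    have := gramMatrix_change (firstTwo g ![]) b P
    simp only [← hP] at this
    exact this
  have hM := gramMatrix_change B b P
  simp only [← hP] at hM
  have e1 := sum_mul_eq_trace (gramMatrix g b')⁻¹ (Matrix.of fun i j => B (b' i) (b' j))
  have e2 := sum_mul_eq_trace (gramMatrix g b)⁻¹ (Matrix.of fun i j => B (b i) (b j))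
  simp only [Matrix.of_apply] at e1 e2
  rw [e1, e2, hM, hG, Matrix.mul_inv_rev, Matrix.mul_inv_rev, Matrix.transpose_mul,
    Matrix.transpose_mul, Matrix.transpose_transpose]
  set M := (Matrix.of fun i j => B (b i) (b j)).transpose
  have hPt : IsUnit P.transpose.det := by rwa [Matrix.det_transpose]
  calc (P⁻¹ * ((gramMatrix g b)⁻¹ * P.transpose⁻¹) * (P.transpose * (M * P))).trace
      = (P⁻¹ * ((gramMatrix g b)⁻¹ * (P.transpose⁻¹ * P.transpose) * M * P)).trace := by
        simp only [Matrix.mul_assoc]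
    _ = ((gramMatrix g b)⁻¹ * M * (P * P⁻¹)).trace := by
        rw [Matrix.nonsing_inv_mul _ hPt, Matrix.trace_mul_comm]
        simp only [Matrix.mul_assoc, Matrix.one_mul]
    _ = _ := by rw [Matrix.mul_nonsing_inv _ hPdet, Matrix.mul_one]

theorem gramMatrix_det_ne_zero (g : MultilinearMap ℝ (fun _ : Fin 2 => V) ℝ)
    (b b' : Module.Basis (Fin 4) ℝ V) (hb : (gramMatrix g b).det ≠ 0) :
    (gramMatrix g b').det ≠ 0 := by
  set P : Matrix (Fin 4) (Fin 4) ℝ := b.toMatrix b'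
  have hP : ∀ i, b' i = ∑ k, P k i • b k := fun i => (b.sum_toMatrix_smul_self b' i).symm
  have hPdet : IsUnit P.det := by
    have := Module.Basis.toMatrix_mul_toMatrix_flip b b'
    exact Matrix.isUnit_det_of_right_inverse this
  have hG : gramMatrix g b' = P.transpose * gramMatrix g b * P := by
    have := gramMatrix_change (firstTwo g ![]) b P
    simp only [← hP] at this
    exact this
  rw [hG, Matrix.det_mul, Matrix.det_mul, Matrix.det_transpose]
  exact mul_ne_zero (mul_ne_zero hPdet.ne_zero hb) hPdet.ne_zero

/-- Contraction of the first four arguments in two pairs. -/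
noncomputable def doubleContraction (g : MultilinearMap ℝ (fun _ : Fin 2 => V) ℝ)
    (Φ : MultilinearMap ℝ (fun _ : Fin 6 => V) ℝ) (b : Fin 4 → V) :
    MultilinearMap ℝ (fun _ : Fin 2 => V) ℝ :=
  ∑ k, ∑ a, ∑ l, ∑ c, ((gramMatrix g b)⁻¹ k a * (gramMatrix g b)⁻¹ l c) •
    (((Φ.curryLeft (b k)).curryLeft (b a)).curryLeft (b l)).curryLeft (b c)

theorem doubleContraction_apply (g : MultilinearMap ℝ (fun _ : Fin 2 => V) ℝ)
    (Φ : MultilinearMap ℝ (fun _ : Fin 6 => V) ℝ) (b : Fin 4 → V) (u v : V) :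
    doubleContraction g Φ b ![u, v] = ∑ k, ∑ a, ∑ l, ∑ c, (gramMatrix g b)⁻¹ k a *
      (gramMatrix g b)⁻¹ l c * Φ ![b k, b a, b l, b c, u, v] := by
  simp only [doubleContraction, sum_apply, smul_apply, smul_eq_mul]
  rfl

/-- Invariance of a single contraction is applied to the inner pair with the outer arguments fixed,
and then to the outer pair. -/
theorem doubleContraction_basis_change (g : MultilinearMap ℝ (fun _ : Fin 2 => V) ℝ)
    (Φ : MultilinearMap ℝ (fun _ : Fin 6 => V) ℝ) (b b' : Module.Basis (Fin 4) ℝ V) (u v : V) :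
    doubleContraction g Φ b' ![u, v] = doubleContraction g Φ b ![u, v] := by
  have h : ∀ c : Module.Basis (Fin 4) ℝ V, doubleContraction g Φ c ![u, v] =
      ∑ k, ∑ a, (gramMatrix g c)⁻¹ k a * ∑ l, ∑ d, (gramMatrix g c)⁻¹ l d *
        firstTwo ((Φ.curryLeft (c k)).curryLeft (c a)) ![u, v] (c l) (c d) := by
    intro c
    rw [doubleContraction_apply]
    simp only [Finset.mul_sum, mul_assoc]
    rfl
  have hin : ∀ x y, ∑ l, ∑ d, (gramMatrix g b')⁻¹ l d *
        firstTwo ((Φ.curryLeft x).curryLeft y) ![u, v] (b' l) (b' d) =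
      ∑ l, ∑ d, (gramMatrix g b)⁻¹ l d *
        firstTwo ((Φ.curryLeft x).curryLeft y) ![u, v] (b l) (b d) := fun x y =>
    contraction_basis_change g _ b b'
  rw [h b', h b]
  simp only [hin]
  have := contraction_basis_change g (∑ l, ∑ d, (gramMatrix g b)⁻¹ l d •
    firstTwo Φ ![b l, b d, u, v]) b b'
  simp only [LinearMap.sum_apply, LinearMap.smul_apply, smul_eq_mul] at this
  exact this

open Classical in
/-- Permutation of the arguments of a multilinear map (zero if `f` is not a permutation). -/
noncomputable def permuteArgs {n : ℕ} (μ : MultilinearMap ℝ (fun _ : Fin n => V) ℝ)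
    (f : Fin n → Fin n) : MultilinearMap ℝ (fun _ : Fin n => V) ℝ :=
  if h : Function.Bijective f then μ.domDomCongr (Equiv.ofBijective f h) else 0

theorem permuteArgs_apply {n : ℕ} (μ : MultilinearMap ℝ (fun _ : Fin n => V) ℝ)
    {f : Fin n → Fin n} (h : Function.Bijective f) (w : Fin n → V) :
    permuteArgs μ f w = μ (w ∘ f) := by
  simp only [permuteArgs, dif_pos h]
  rfl

/-- Here `koszulProd` is applied to multilinear maps, with argument slots as indices. Slots 0, 1 and
2, 3 are the pairs to be contracted and 4, 5 the free ones. All index arrays that occur are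
permutations, so the default value zero of `permuteArgs` never appears. -/
theorem koszulProd_permuteArgs (μ : MultilinearMap ℝ (fun _ : Fin 6 => V) ℝ) (w : Fin 6 → V) :
    koszulProd (permuteArgs μ) 1 0 2 3 4 5 w = koszulProd μ (w 1) (w 0) (w 2) (w 3) (w 4) (w 5) ∧
    koszulProd (permuteArgs μ) 1 5 2 3 4 0 w =
      koszulProd μ (w 1) (w 5) (w 2) (w 3) (w 4) (w 0) := by
  have h : ∀ a b c d e f : Fin 6, Function.Bijective ![a, b, c, d, e, f] →
      permuteArgs μ ![a, b, c, d, e, f] w = μ ![w a, w b, w c, w d, w e, w f] := by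
    intro a b c d e f hf
    rw [permuteArgs_apply μ hf]
    congr 1
    ext i
    fin_cases i <;> rfl
  constructor <;>
  · simp only [koszulProd, add_apply, sub_apply]
    simp (discharger := decide) only [h]

/-- The averaged quadratic part of the Ricci tensor, as a bilinear form built from the metric `g`
and the averaged products `μ` of first derivatives, by means of a basis `b`. -/
noncomputable def backreaction (g : MultilinearMap ℝ (fun _ : Fin 2 => V) ℝ)
    (μ : MultilinearMap ℝ (fun _ : Fin 6 => V) ℝ) (b : Fin 4 → V) :
    MultilinearMap ℝ (fun _ : Fin 2 => V) ℝ :=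
  (1 / 4 : ℝ) • doubleContraction g (koszulProd (permuteArgs μ) 1 0 2 3 4 5
    - koszulProd (permuteArgs μ) 1 5 2 3 4 0) b

theorem backreaction_basis_change (g : MultilinearMap ℝ (fun _ : Fin 2 => V) ℝ)
    (μ : MultilinearMap ℝ (fun _ : Fin 6 => V) ℝ) (b b' : Module.Basis (Fin 4) ℝ V) (u v : V) :
    backreaction g μ b' ![u, v] = backreaction g μ b ![u, v] := by
  simp only [backreaction, smul_apply,
    doubleContraction_basis_change g _ b b']

theorem backreaction_apply_basis (g : MultilinearMap ℝ (fun _ : Fin 2 => V) ℝ)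
    (μ : MultilinearMap ℝ (fun _ : Fin 6 => V) ℝ) (b : Fin 4 → V) (i j : Fin 4) :
    backreaction g μ b ![b i, b j] =
      quadRicci (fun k l => (gramMatrix g b)⁻¹ k l) (fun idx => μ (b ∘ idx)) i j := by
  have hk : ∀ a i j c k l, koszulProd (fun idx => μ (b ∘ idx)) a i j c k l =
      koszulProd μ (b a) (b i) (b j) (b c) (b k) (b l) := by
    have h : ∀ a₁ a₂ a₃ a₄ a₅ a₆ : Fin 4, μ (b ∘ ![a₁, a₂, a₃, a₄, a₅, a₆]) =
        μ ![b a₁, b a₂, b a₃, b a₄, b a₅, b a₆] := by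
      intros
      congr 1
      ext i
      fin_cases i <;> rfl
    intros
    simp only [koszulProd, h]
  simp only [backreaction, smul_apply, doubleContraction_apply, quadRicci, hk,
    sub_apply, koszulProd_permuteArgs, smul_eq_mul, Finset.mul_sum,
    ← Finset.sum_sub_distrib]
  refine Finset.sum_congr rfl fun k _ => ?_
  rw [Finset.sum_comm]
  refine Finset.sum_congr rfl fun l _ => Finset.sum_congr rfl fun a _ =>
    Finset.sum_congr rfl fun c _ => ?_
  simp
  ring

/-- The bilinear form with given components in a basis. -/
noncomputable def ofComponents (b : Module.Basis (Fin 4) ℝ V) (A : Fin 4 → Fin 4 → ℝ) :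
    MultilinearMap ℝ (fun _ : Fin 2 => V) ℝ :=
  ∑ i, ∑ j, A i j • (MultilinearMap.mkPiAlgebra ℝ (Fin 2) ℝ).compLinearMap ![b.coord i, b.coord j]

theorem ofComponents_apply (b : Module.Basis (Fin 4) ℝ V) (A : Fin 4 → Fin 4 → ℝ) (u v : V) :
    ofComponents b A ![u, v] = ∑ i, ∑ j, A i j * (b.coord i u * b.coord j v) := by
  simp [ofComponents, Fin.prod_univ_two]

theorem ofComponents_apply_basis (b : Module.Basis (Fin 4) ℝ V) (A : Fin 4 → Fin 4 → ℝ)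
    (i j : Fin 4) : ofComponents b A ![b i, b j] = A i j := by
  simp [ofComponents_apply, Finsupp.single_apply]

theorem multilinear_two_expand (A : MultilinearMap ℝ (fun _ : Fin 2 => V) ℝ)
    (b : Fin 4 → V) (p q : Fin 4 → ℝ) :
    A ![∑ i, p i • b i, ∑ j, q j • b j] = ∑ i, ∑ j, p i * q j * A ![b i, b j] := by
  have : ∀ x y, A ![x, y] = firstTwo A ![] x y := fun _ _ => rfl
  simp only [this, map_sum, map_smul, LinearMap.sum_apply, LinearMap.smul_apply, smul_eq_mul,
    Finset.mul_sum]
  rw [Finset.sum_comm]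
  exact Finset.sum_congr rfl fun k _ => Finset.sum_congr rfl fun l _ => by ring

theorem multilinear_two_ext {A B : MultilinearMap ℝ (fun _ : Fin 2 => V) ℝ}
    (b : Module.Basis (Fin 4) ℝ V) (h : ∀ i j, A ![b i, b j] = B ![b i, b j]) : A = B := by
  ext w
  have hw : w = ![∑ i, b.repr (w 0) i • b i, ∑ j, b.repr (w 1) j • b j] := by
    ext i
    fin_cases i <;> simp [b.sum_repr]
  rw [hw, multilinear_two_expand, multilinear_two_expand]
  simp only [h]

end TensorAlgebra

/-! ### Weak convergence under diffeomorphisms. -/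

section ChangeOfVariables

/-- The Jacobian determinant of a smooth map is smooth. -/
theorem ContDiffOn.det_fderiv {W : Set E4} (hW : IsOpen W) {f : E4 → E4}
    (hf : ContDiffOn ℝ ∞ f W) : ContDiffOn ℝ ∞ (fun y => (fderiv ℝ f y).det) W := by
  have h : ∀ A : E4 →L[ℝ] E4, A.det =
      (Matrix.of fun i j => A (EuclideanSpace.single j 1) i : Matrix (Fin 4) (Fin 4) ℝ).det := by
    intro A
    rw [ContinuousLinearMap.det, ← LinearMap.det_toMatrix (EuclideanSpace.basisFun (Fin 4) ℝ).toBasis]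
    congr 1
  simp only [h, Matrix.det_apply', Matrix.of_apply]
  refine ContDiffOn.sum fun σ _ => contDiffOn_const.mul (contDiffOn_prod fun i _ => ?_)
  have h1 : ContDiffOn ℝ ∞ (fun y => fderiv ℝ f y (EuclideanSpace.single i 1)) W :=
    (hf.fderiv_of_isOpen hW (by simp)).clm_apply contDiffOn_const
  exact (contDiffOn_euclidean.1 h1) _

theorem OpenPartialHomeomorph.det_fderiv_symm_ne_zero (Φ : OpenPartialHomeomorph E4 E4)
    (h1 : ContDiffOn ℝ ∞ Φ Φ.source) (h2 : ContDiffOn ℝ ∞ Φ.symm Φ.target) {z : E4}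
    (hz : z ∈ Φ.target) : (fderiv ℝ Φ.symm z).det ≠ 0 := by
  have d2 : HasFDerivAt Φ.symm (fderiv ℝ Φ.symm z) z :=
    ((h2.contDiffAt (Φ.open_target.mem_nhds hz)).differentiableAt (by simp)).hasFDerivAt
  have d1 : HasFDerivAt Φ (fderiv ℝ Φ (Φ.symm z)) (Φ.symm z) :=
    ((h1.contDiffAt (Φ.open_source.mem_nhds (Φ.map_target hz))).differentiableAt
      (by simp)).hasFDerivAt
  have d3 : HasFDerivAt (fun w => Φ (Φ.symm w)) (ContinuousLinearMap.id ℝ E4) z := by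
    refine (hasFDerivAt_id z).congr_of_eventuallyEq ?_
    filter_upwards [Φ.open_target.mem_nhds hz] with w hw using Φ.right_inv hw
  have := (d1.comp z d2).unique d3
  intro h0
  have h4 : ((fderiv ℝ Φ (Φ.symm z)).comp (fderiv ℝ Φ.symm z)).det = 0 := by
    rw [ContinuousLinearMap.det, ContinuousLinearMap.toLinearMap_comp, LinearMap.det_comp]
    rw [ContinuousLinearMap.det] at h0
    rw [h0, mul_zero]
  rw [this] at h4
  simp [ContinuousLinearMap.det] at h4

/-- Weak convergence is invariant under changes of coordinates. -/
theorem WeakTo.comp_diffeo (Φ : OpenPartialHomeomorph E4 E4)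
    (h1 : ContDiffOn ℝ ∞ Φ Φ.source) (h2 : ContDiffOn ℝ ∞ Φ.symm Φ.target)
    {u : ℝ → E4 → ℝ} {F : E4 → ℝ} (hu : WeakTo Φ.target u F) :
    WeakTo Φ.source (fun s y => u s (Φ y)) (fun y => F (Φ y)) where
  cont s hs := (hu.cont s hs).comp Φ.continuousOn Φ.mapsTo
  cont_lim := hu.cont_lim.comp Φ.continuousOn Φ.mapsTo
  tendsto f hf := by
    classical
    -- The transported test function: `f` composed with the inverse map, weighted by the Jacobian
    -- and extended by zero.
    set k : E4 → ℝ := fun z => if z ∈ Φ.target then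
      |(fderiv ℝ Φ.symm z).det| * f (Φ.symm z) else 0 with hk
    have hK : IsCompact (Φ '' tsupport f) :=
      hf.compact.isCompact.image_of_continuousOn (Φ.continuousOn.mono hf.subset)
    have hKt : Φ '' tsupport f ⊆ Φ.target := by
      rintro _ ⟨y, hy, rfl⟩
      exact Φ.map_source (hf.subset hy)
    have hk0 : ∀ z ∉ Φ '' tsupport f, k z = 0 := by
      intro z hz
      simp only [hk]
      split_ifs with h
      · have : Φ.symm z ∉ tsupport f := fun h' => hz ⟨_, h', Φ.right_inv h⟩
        rw [image_eq_zero_of_notMem_tsupport this, mul_zero]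
      · rfl
    have hkt : tsupport k ⊆ Φ '' tsupport f :=
      closure_minimal (fun z hz => by_contra fun h => hz (hk0 z h)) hK.isClosed
    have hktest : IsTest Φ.target k := by
      refine ⟨?_, HasCompactSupport.intro hK hk0, hkt.trans hKt⟩
      rw [contDiff_iff_contDiffAt]
      intro z
      by_cases hz : z ∈ Φ.target
      -- The absolute value preserves smoothness because the Jacobian determinant does not vanish.
      · have hdet := ((h2.det_fderiv Φ.open_target).contDiffAt (Φ.open_target.mem_nhds hz)).abs
          (Φ.det_fderiv_symm_ne_zero h1 h2 hz)
        have hfs : ContDiffAt ℝ ∞ (fun w => f (Φ.symm w)) z :=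
          hf.smooth.contDiffAt.comp z (h2.contDiffAt (Φ.open_target.mem_nhds hz))
        refine (hdet.mul hfs).congr_of_eventuallyEq ?_
        filter_upwards [Φ.open_target.mem_nhds hz] with w hw
        simp [hk, hw]
      · refine (contDiffAt_const (c := (0 : ℝ))).congr_of_eventuallyEq ?_
        filter_upwards [hK.isClosed.isOpen_compl.mem_nhds fun h => hz (hKt h)] with w hw
        exact hk0 w hw
    have key : ∀ v : E4 → ℝ, ∫ y, f y * v (Φ y) = ∫ z, k z * v z := by
      intro v
      have e1 : ∫ y, f y * v (Φ y) = ∫ y in Φ.symm '' Φ.target, f y * v (Φ y) := by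
        rw [setIntegral_eq_integral_of_forall_compl_eq_zero]
        intro y hy
        rw [Φ.symm_image_target_eq_source] at hy
        rw [image_eq_zero_of_notMem_tsupport fun h => hy (hf.subset h), zero_mul]
      have e2 : ∫ z, k z * v z = ∫ z in Φ.target, k z * v z := by
        rw [setIntegral_eq_integral_of_forall_compl_eq_zero]
        intro z hz
        simp [hk, hz]
      rw [e1, e2, integral_image_eq_integral_abs_det_fderiv_smul volume
        Φ.open_target.measurableSet (f' := fderiv ℝ Φ.symm) ?_ ?_]
      · refine setIntegral_congr_fun Φ.open_target.measurableSet fun z hz => ?_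
        simp only [hk, hz, if_true, smul_eq_mul, Φ.right_inv hz]
        ring
      · intro z hz
        exact ((h2.contDiffAt (Φ.open_target.mem_nhds hz)).differentiableAt
          (by simp)).hasFDerivAt.hasFDerivWithinAt
      · exact Φ.symm.injOn
    simp only [key]
    exact hu.tendsto k hktest

end ChangeOfVariables

/-! ### Coordinate frames and transition maps. -/

section Charts

variable {M : Type*} [TopologicalSpace M] [ChartedSpace E4 M] {e e' : Chart M}

theorem chart_mdifferentiable (he : e ∈ smoothCharts M) :
    OpenPartialHomeomorph.MDifferentiable 𝓘(ℝ, E4) 𝓘(ℝ, E4) e :=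
  ⟨(contMDiffOn_of_mem_maximalAtlas he).mdifferentiableOn (by simp),
    (contMDiffOn_symm_of_mem_maximalAtlas he).mdifferentiableOn (by simp)⟩

theorem comp_two (A : TensorField M 2) (e : Chart M) (i j : Fin 4) (y : E4) :
    A.comp e ![i, j] y =
      A (e.symm y) ![coordFrame e i (e.symm y), coordFrame e j (e.symm y)] := by
  simp only [TensorField.comp]
  congr 1
  ext m
  fin_cases m <;> rfl

/-- The transition map between two charts is smooth. -/
theorem transition_smooth (he : e ∈ smoothCharts M) (he' : e' ∈ smoothCharts M) :
    ContDiffOn ℝ ∞ (e'.symm ≫ₕ e) (e'.symm ≫ₕ e).source := by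
  rw [← contMDiffOn_iff_contDiffOn]
  have h1 := contMDiffOn_of_mem_maximalAtlas he
  have h2 := contMDiffOn_symm_of_mem_maximalAtlas he'
  rw [OpenPartialHomeomorph.coe_trans]
  refine h1.comp (h2.mono ?_) ?_
  · intro y hy; exact hy.1
  · intro y hy; exact hy.2

/-- The isomorphism from a tangent space to the coordinate space. -/
noncomputable def chartEquiv (he : e ∈ smoothCharts M) {x : M} (hx : x ∈ e.source) :
    TangentSpace 𝓘(ℝ, E4) x ≃L[ℝ] E4 :=
  (chart_mdifferentiable he).mfderiv hx

theorem chartEquiv_apply (he : e ∈ smoothCharts M) {x : M} (hx : x ∈ e.source)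
    (v : TangentSpace 𝓘(ℝ, E4) x) :
    chartEquiv he hx v = mfderiv 𝓘(ℝ, E4) 𝓘(ℝ, E4) e x v := rfl

theorem coordField_eq (he : e ∈ smoothCharts M) {x : M} (hx : x ∈ e.source) (v : E4) :
    coordField e v x = (chartEquiv he hx).symm v := by
  have : mfderiv 𝓘(ℝ, E4) 𝓘(ℝ, E4) e x = ((chart_mdifferentiable he).mfderiv hx :
      TangentSpace 𝓘(ℝ, E4) x →L[ℝ] TangentSpace 𝓘(ℝ, E4) (e x)) := rfl
  rw [coordField, VectorField.mpullback_apply, this, ContinuousLinearMap.inverse_equiv]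
  rfl

/-- The coordinate basis of a tangent space. -/
noncomputable def chartBasis (he : e ∈ smoothCharts M) {x : M} (hx : x ∈ e.source) :
    Module.Basis (Fin 4) ℝ (TangentSpace 𝓘(ℝ, E4) x) :=
  (EuclideanSpace.basisFun (Fin 4) ℝ).toBasis.map (chartEquiv he hx).symm.toLinearEquiv

theorem chartBasis_apply (he : e ∈ smoothCharts M) {x : M} (hx : x ∈ e.source) (i : Fin 4) :
    chartBasis he hx i = coordFrame e i x := by
  rw [coordFrame, coordField_eq he hx]
  simp [chartBasis]

theorem coordField_expand (he : e ∈ smoothCharts M) {x : M} (hx : x ∈ e.source) (v : E4) :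
    coordField e v x = ∑ i, v i • coordFrame e i x := by
  simp only [coordFrame, coordField_eq he hx, ← map_smul, ← map_sum]
  congr 1
  ext j
  simp [Pi.single_apply]

theorem eq_sum_coordFrame (he : e ∈ smoothCharts M) {x : M} (hx : x ∈ e.source)
    (w : TangentSpace 𝓘(ℝ, E4) x) :
    w = ∑ i, (chartEquiv he hx w) i • coordFrame e i x := by
  rw [← coordField_expand he hx, coordField_eq he hx, ContinuousLinearEquiv.symm_apply_apply]

theorem coordFrame_change (he : e ∈ smoothCharts M) (he' : e' ∈ smoothCharts M) {y : E4}
    (hy : y ∈ (e'.symm ≫ₕ e).source) (j : Fin 4) :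
    coordFrame e' j (e'.symm y) =
      ∑ i, (fderiv ℝ (e'.symm ≫ₕ e) y (EuclideanSpace.single j 1)) i •
        coordFrame e i (e'.symm y) := by
  have hy' : y ∈ e'.target := hy.1
  have hx : e'.symm y ∈ e.source := hy.2
  have hx' : e'.symm y ∈ e'.source := e'.map_target hy'
  have hd1 : MDifferentiableAt 𝓘(ℝ, E4) 𝓘(ℝ, E4) e (e'.symm y) :=
    (chart_mdifferentiable he).mdifferentiableAt hx
  have hd2 : MDifferentiableAt 𝓘(ℝ, E4) 𝓘(ℝ, E4) e'.symm y :=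
    (chart_mdifferentiable he').mdifferentiableAt_symm hy'
  have hc : mfderiv 𝓘(ℝ, E4) 𝓘(ℝ, E4) (e ∘ e'.symm) y =
      (mfderiv 𝓘(ℝ, E4) 𝓘(ℝ, E4) e (e'.symm y)).comp (mfderiv 𝓘(ℝ, E4) 𝓘(ℝ, E4) e'.symm y) :=
    mfderiv_comp y hd1 hd2
  have hinv : (mfderiv 𝓘(ℝ, E4) 𝓘(ℝ, E4) e'.symm y (EuclideanSpace.single j (1 : ℝ) : E4) :
      TangentSpace 𝓘(ℝ, E4) (e'.symm y)) = coordFrame e' j (e'.symm y) := by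
    rw [coordFrame, coordField_eq he' hx', ContinuousLinearEquiv.eq_symm_apply, chartEquiv_apply]
    have := (chart_mdifferentiable he').comp_symm_deriv hy'
    exact congrArg (fun A => A (EuclideanSpace.single j (1 : ℝ) : E4)) this
  have hJ : chartEquiv he hx (coordFrame e' j (e'.symm y)) =
      fderiv ℝ (e'.symm ≫ₕ e) y (EuclideanSpace.single j 1) := by
    rw [OpenPartialHomeomorph.coe_trans, ← mfderiv_eq_fderiv, hc, chartEquiv_apply, ← hinv]
    rfl
  rw [← hJ]
  exact eq_sum_coordFrame he hx _

end Charts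

/-! ### Regularity of coordinate frames, the Riemannian metric and the connection coefficients. -/

section SmoothFrames

variable {M : Type*} [TopologicalSpace M] [ChartedSpace E4 M] {e : Chart M}

theorem chart_mfderiv_isInvertible (he : e ∈ smoothCharts M) {x : M} (hx : x ∈ e.source) :
    (mfderiv 𝓘(ℝ, E4) 𝓘(ℝ, E4) e x).IsInvertible :=
  ⟨(chart_mdifferentiable he).mfderiv hx, rfl⟩

theorem chart_symm_mfderiv_isInvertible (he : e ∈ smoothCharts M) {y : E4} (hy : y ∈ e.target) :
    (mfderiv 𝓘(ℝ, E4) 𝓘(ℝ, E4) e.symm y).IsInvertible :=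
  ⟨(chart_mdifferentiable he).symm.mfderiv hy, rfl⟩

/-- The components in the chart `e` of a tangent vector. -/
noncomputable def chartComponents (e : Chart M) (x : M) (v : TangentSpace 𝓘(ℝ, E4) x) : E4 :=
  mfderiv 𝓘(ℝ, E4) 𝓘(ℝ, E4) e x v

variable [IsManifold 𝓘(ℝ, E4) ∞ M]

/-- Smoothness of a vector field at a point. -/
abbrev SmoothFieldAt (V : (x : M) → TangentSpace 𝓘(ℝ, E4) x) (x : M) : Prop :=
  ContMDiffAt 𝓘(ℝ, E4) 𝓘(ℝ, E4).tangent ∞ (fun z => (⟨z, V z⟩ : TangentBundle 𝓘(ℝ, E4) M)) x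

/-- Coordinate vector fields are smooth. -/
theorem contMDiffAt_coordField (he : e ∈ smoothCharts M) {x : M} (hx : x ∈ e.source) (v : E4) :
    SmoothFieldAt (coordField e v) x := by
  have hV : SmoothFieldAt (M := E4) (fun y => (NormedSpace.fromTangentSpace y).symm v) (e x) :=
    contMDiffAt_vectorSpace_iff_contDiffAt.2 (contDiffAt_const (c := v))
  exact hV.mpullback_vectorField_preimage
    ((contMDiffOn_of_mem_maximalAtlas he).contMDiffAt (e.open_source.mem_nhds hx))
    (chart_mfderiv_isInvertible he hx) (by simp)

/-- The components of a smooth vector field in a chart are smooth. -/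
theorem contDiffAt_chart_components (he : e ∈ smoothCharts M)
    {V : (x : M) → TangentSpace 𝓘(ℝ, E4) x} {y : E4} (hy : y ∈ e.target)
    (hV : SmoothFieldAt V (e.symm y)) :
    ContDiffAt ℝ ∞ (fun z => chartComponents e (e.symm z) (V (e.symm z))) y := by
  have h := hV.mpullback_vectorField_preimage
    ((contMDiffOn_symm_of_mem_maximalAtlas he).contMDiffAt (e.open_target.mem_nhds hy))
    (chart_symm_mfderiv_isInvertible he hy) (m := ∞) (by simp)
  rw [contMDiffAt_vectorSpace_iff_contDiffAt] at h
  refine h.congr_of_eventuallyEq ?_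
  filter_upwards [e.open_target.mem_nhds hy] with z hz
  rw [VectorField.mpullback_apply]
  have : mfderiv 𝓘(ℝ, E4) 𝓘(ℝ, E4) e.symm z = ((chart_mdifferentiable he).symm.mfderiv hz :
      TangentSpace 𝓘(ℝ, E4) z →L[ℝ] TangentSpace 𝓘(ℝ, E4) (e.symm z)) := rfl
  rw [this, ContinuousLinearMap.inverse_equiv]
  rfl

/-- The inner product of two coordinate vector fields is continuous. -/
theorem continuousOn_inner_coordField (he : e ∈ smoothCharts M)
    (h : Bundle.ContMDiffRiemannianMetric 𝓘(ℝ, E4) ∞ E4 (TangentSpace 𝓘(ℝ, E4) : M → Type))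
    (u v : E4) : ContinuousOn (fun y => h.inner (e.symm y) (coordField e u (e.symm y))
      (coordField e v (e.symm y))) e.target := by
  have h0 : ContinuousOn (fun x => h.inner x (coordField e u x) (coordField e v x)) e.source := by
    intro x hx
    have : ContMDiffAt 𝓘(ℝ, E4) (𝓘(ℝ, E4).prod 𝓘(ℝ)) ∞
        (fun m ↦ Bundle.TotalSpace.mk' ℝ (E := Bundle.Trivial M ℝ) m
          (h.inner m (coordField e u m) (coordField e v m))) x :=
      ContMDiffAt.clm_bundle_apply₂ (F₁ := E4) (F₂ := E4) h.contMDiff.contMDiffAt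
        (contMDiffAt_coordField he hx u) (contMDiffAt_coordField he hx v)
    rw [Bundle.contMDiffAt_totalSpace] at this
    exact this.2.continuousAt.continuousWithinAt
  exact h0.comp e.symm.continuousOn e.symm.mapsTo

/-- The connection coefficients of a smooth affine connection in a chart: the `l`-th component
of `∇_{∂_c} ∂_i`. -/
noncomputable def connectionCoeff
    (D : CovariantDerivative 𝓘(ℝ, E4) E4 (TangentSpace 𝓘(ℝ, E4) : M → Type))
    (e : Chart M) (l c i : Fin 4) (y : E4) : ℝ :=
  chartComponents e (e.symm y) (D (coordFrame e i) (e.symm y) (coordFrame e c (e.symm y))) l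

theorem covariantDerivative_coordFrame (he : e ∈ smoothCharts M)
    (D : CovariantDerivative 𝓘(ℝ, E4) E4 (TangentSpace 𝓘(ℝ, E4) : M → Type))
    (c i : Fin 4) {y : E4} (hy : y ∈ e.target) :
    D (coordFrame e i) (e.symm y) (coordFrame e c (e.symm y)) =
      ∑ l, connectionCoeff D e l c i y • coordFrame e l (e.symm y) :=
  eq_sum_coordFrame he (e.map_target hy) _

theorem continuousOn_connectionCoeff [T2Space M] (he : e ∈ smoothCharts M)
    (D : CovariantDerivative 𝓘(ℝ, E4) E4 (TangentSpace 𝓘(ℝ, E4) : M → Type))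
    [hD : CovariantDerivative.ContMDiffCovariantDerivative D ∞] (l c i : Fin 4) :
    ContinuousOn (connectionCoeff D e l c i) e.target := by
  intro y hy
  set x := e.symm y with hx
  have hxs : x ∈ e.source := e.map_target hy
  obtain ⟨ψ, -, hψ⟩ := (SmoothBumpFunction.nhds_basis_tsupport (I := 𝓘(ℝ, E4)) x).mem_iff.1
    (e.open_source.mem_nhds hxs)
  -- The coordinate field is smooth only on the chart domain, so it is cut off to a global smooth
  -- field. It is unchanged near `x`, and there locality of the covariant derivative makes the two
  -- derivatives agree.
  set W : (z : M) → TangentSpace 𝓘(ℝ, E4) z := (ψ : M → ℝ) • coordFrame e i with hW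
  have hfr : ∀ z ∈ e.source, ∀ i, SmoothFieldAt (coordFrame e i) z := fun z hz i =>
    contMDiffAt_coordField he hz _
  have hWs : ContMDiff 𝓘(ℝ, E4) 𝓘(ℝ, E4).tangent ∞
      (fun z => (⟨z, W z⟩ : TangentBundle 𝓘(ℝ, E4) M)) := ContMDiffOn.smul_section_of_tsupport (u := e.source)
    ψ.contMDiff.contMDiffOn e.open_source hψ fun z hz => (hfr z hz i).contMDiffWithinAt
  have hDW := (hD.contMDiff.contMDiff (σ := W) (by simpa using hWs.contMDiffOn)).contMDiffAt
    (Filter.univ_mem (f := 𝓝 x))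
  have hDWc : SmoothFieldAt (fun z => D W z (coordFrame e c z)) x :=
    ContMDiffAt.clm_bundle_apply (F₁ := E4) (F₂ := E4) hDW (hfr x hxs c)
  have hcd := (contDiffAt_chart_components he hy hDWc).continuousAt
  have hl : ContinuousAt (fun z => chartComponents e (e.symm z)
      (D W (e.symm z) (coordFrame e c (e.symm z))) l) y :=
    (EuclideanSpace.proj (𝕜 := ℝ) l).continuous.continuousAt.comp hcd
  refine (hl.congr ?_).continuousWithinAt
  have hev : ∀ᶠ z in 𝓝 y, ∀ᶠ w in 𝓝 (e.symm z), ψ w = 1 :=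
    (e.symm.continuousAt hy).eventually ψ.eventuallyEq_one.eventually_nhds
  filter_upwards [hev, e.open_target.mem_nhds hy] with z hz hzt
  have hzs := e.map_target hzt
  have : D W (e.symm z) = D (coordFrame e i) (e.symm z) := by
    refine (D.isCovariantDerivativeOn (s := Set.univ)).congr_of_eventuallyEq
      (hWs.contMDiffAt.mdifferentiableAt (by simp)) ((hfr _ hzs i).mdifferentiableAt (by simp))
      Filter.univ_mem ?_
    filter_upwards [hz] with w hw
    simp [hW, hw]
  rw [connectionCoeff, this]

end SmoothFrames

/-! ### From tensorial hypotheses to bounds and limits of components. -/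

section ComponentBounds

variable {M : Type*} [TopologicalSpace M] [ChartedSpace E4 M] {e : Chart M}

/-- Take test fields with a single nonzero component. -/
theorem WeakLimit.weakTo {k : ℕ} {A : ℝ → Components M k} {A₀ : Components M k}
    (hA : WeakLimit A A₀) (he : e ∈ smoothCharts M) (idx : Fin k → Fin 4)
    (hc : ∀ s, 0 < s → ContinuousOn (A s e idx) e.target) (hc₀ : ContinuousOn (A₀ e idx) e.target) :
    WeakTo e.target (fun s => A s e idx) (A₀ e idx) where
  cont := hc
  cont_lim := hc₀
  tendsto f hf := by
    have := hA e he (fun idx' => if idx' = idx then f else 0) (by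
      intro idx'
      split_ifs
      · exact ⟨hf.smooth, hf.compact, hf.subset⟩
      · exact ⟨contDiff_const, HasCompactSupport.zero, by simp [tsupport]⟩)
    have h2 : ∀ (B : Components M k) y, ∑ idx', (if idx' = idx then f else 0) y * B e idx' y =
        f y * B e idx y := by
      intro B y
      rw [Finset.sum_eq_single idx (fun b _ hb => by simp [hb]) (by simp)]
      simp
    simpa only [h2] using this

theorem weakLimit_of_weakTo {k : ℕ} {A : ℝ → Components M k} {A₀ : Components M k}
    (hA : ∀ e ∈ smoothCharts M, ∀ idx, WeakTo e.target (fun s => A s e idx) (A₀ e idx)) :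
    WeakLimit A A₀ := by
  intro e he f hf
  have hf' : ∀ idx, IsTest e.target (f idx) := fun idx => ⟨(hf idx).1, (hf idx).2.1, (hf idx).2.2⟩
  rw [integral_finsetSum _ fun idx _ =>
    (hf' idx).integrable_mul e.open_target (hA e he idx).cont_lim]
  refine (tendsto_finsetSum _ fun idx _ => (hA e he idx).tendsto _ (hf' idx)).congr' ?_
  filter_upwards [eventually_pos_right] with s hs
  rw [integral_finsetSum _ fun idx _ =>
    (hf' idx).integrable_mul e.open_target ((hA e he idx).cont s hs)]

variable [IsManifold 𝓘(ℝ, E4) ∞ M]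

/-- Evaluating the form on coordinate vectors isolates one component. -/
theorem NormLE.abs_le {k : ℕ}
    {h : Bundle.ContMDiffRiemannianMetric 𝓘(ℝ, E4) ∞ E4 (TangentSpace 𝓘(ℝ, E4) : M → Type)}
    {A : Components M k} {c : M → ℝ} (hA : NormLE h A c) (he : e ∈ smoothCharts M)
    (idx : Fin k → Fin 4) {y : E4} (hy : y ∈ e.target) :
    |A e idx y| ≤ c (e.symm y) * ∏ m, Real.sqrt (h.inner (e.symm y)
        (coordFrame e (idx m) (e.symm y)) (coordFrame e (idx m) (e.symm y))) := by
  have := hA e he y hy (fun m => EuclideanSpace.single (idx m) 1)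
  rw [Finset.sum_eq_single idx] at this
  · simpa [coordFrame] using this
  · intro idx' _ hne
    obtain ⟨m, hm⟩ := Function.ne_iff.1 hne
    rw [Finset.prod_eq_zero (Finset.mem_univ m) (by simp [hm]), mul_zero]
  · simp

theorem NormLE.uniformO {k : ℕ}
    {h : Bundle.ContMDiffRiemannianMetric 𝓘(ℝ, E4) ∞ E4 (TangentSpace 𝓘(ℝ, E4) : M → Type)}
    (n : ℕ) {A : ℝ → Components M k} {C : M → ℝ} (hC : Continuous C)
    (hA : ∀ s, 0 < s → NormLE h (A s) (fun x => s ^ n * C x)) (he : e ∈ smoothCharts M)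
    (idx : Fin k → Fin 4) (hc : ∀ s, 0 < s → ContinuousOn (A s e idx) e.target) :
    UniformO e.target n (fun s => A s e idx) where
  cont := hc
  bound K hK hKc := by
    have hb : ContinuousOn (fun y => C (e.symm y) * ∏ m, Real.sqrt (h.inner (e.symm y)
        (coordFrame e (idx m) (e.symm y)) (coordFrame e (idx m) (e.symm y)))) e.target :=
      (hC.comp_continuousOn e.symm.continuousOn).mul (continuousOn_finsetProd _ fun m _ =>
        (continuousOn_inner_coordField he h _ _).sqrt)
    obtain ⟨B, hB⟩ := hKc.exists_bound_of_continuousOn (hb.mono hK)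
    refine ⟨max B 0, le_max_right _ _, ?_⟩
    filter_upwards [eventually_pos_right] with s hs y hy
    refine ((hA s hs).abs_le he idx (hK hy)).trans ?_
    rw [mul_assoc, mul_comm]
    gcongr
    exact (le_abs_self _).trans ((hB y hy).trans (le_max_left _ _))

theorem covDeriv_eq
    (D : CovariantDerivative 𝓘(ℝ, E4) E4 (TangentSpace 𝓘(ℝ, E4) : M → Type))
    (γ : TensorField M 2) (he : e ∈ smoothCharts M) (c i j : Fin 4) {y : E4} (hy : y ∈ e.target) :
    covDeriv D γ e ![c, i, j] y = partialDeriv c (γ.comp e ![i, j]) y -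
      (∑ l, connectionCoeff D e l c i y * γ.comp e ![l, j] y +
        ∑ l, connectionCoeff D e l c j y * γ.comp e ![i, l] y) := by
  have h1 : ∀ x (u v : TangentSpace 𝓘(ℝ, E4) x), γ x ![u, v] = firstTwo (γ x) ![] u v :=
    fun _ _ _ => rfl
  simp only [covDeriv, Matrix.cons_val_zero, Matrix.cons_val_one, Matrix.cons_val,
    covariantDerivative_coordFrame he D _ _ hy, comp_two, h1, map_sum, map_smul,
    LinearMap.sum_apply, LinearMap.smul_apply, smul_eq_mul]
  ring

/-- The difference between coordinate and covariant derivatives of a 2-tensor. -/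
noncomputable def connectionTerm
    (D : CovariantDerivative 𝓘(ℝ, E4) E4 (TangentSpace 𝓘(ℝ, E4) : M → Type))
    (e : Chart M) (γ : TensorField M 2) (c i j : Fin 4) (y : E4) : ℝ :=
  ∑ l, connectionCoeff D e l c i y * γ.comp e ![l, j] y +
    ∑ l, connectionCoeff D e l c j y * γ.comp e ![i, l] y

end ComponentBounds

/-! ### The family of Lorentz metrics satisfies the local hypotheses in every chart. -/

section LorentzFamily

variable {M : Type*} [TopologicalSpace M] [ChartedSpace E4 M] {e : Chart M}

theorem inverseMetric_eq_gramMatrix (g : TensorField M 2) (he : e ∈ smoothCharts M) {y : E4}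
    (hy : y ∈ e.target) (i j : Fin 4) :
    inverseMetric (g.comp e) i j y =
      (gramMatrix (g (e.symm y)) (chartBasis he (e.map_target hy)))⁻¹ i j := by
  simp only [inverseMetric, gramMatrix, comp_two, chartBasis_apply]

theorem IsLorentzMetric.det_ne_zero {g : TensorField M 2} (hg : IsLorentzMetric g)
    (he : e ∈ smoothCharts M) {y : E4} (hy : y ∈ e.target) :
    (Matrix.of fun a b : Fin 4 => g.comp e ![a, b] y).det ≠ 0 := by
  obtain ⟨b, hb⟩ := hg.signature (e.symm y)
  have h1 : (gramMatrix (g (e.symm y)) b).det ≠ 0 := by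
    have : gramMatrix (g (e.symm y)) b = Matrix.diagonal fun i => if i = 0 then -1 else 1 := by
      ext i j
      simp [gramMatrix, hb, Matrix.diagonal_apply]
    rw [this, Matrix.det_diagonal]
    simp
  have h2 := gramMatrix_det_ne_zero _ b (chartBasis he (e.map_target hy)) h1
  simpa only [gramMatrix, comp_two, chartBasis_apply] using h2

theorem quadForm_comp (A : TensorField M 2) (e : Chart M) (y : E4) (v : Fin 4 → ℝ) :
    quadForm (fun i j => A.comp e ![i, j] y) v =
      A (e.symm y) ![∑ i, v i • coordFrame e i (e.symm y),
        ∑ i, v i • coordFrame e i (e.symm y)] := by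
  rw [multilinear_two_expand]
  simp only [quadForm, comp_two]

theorem IsLorentzMetric.exists_timelike {g : TensorField M 2} (hg : IsLorentzMetric g)
    (he : e ∈ smoothCharts M) {y : E4} (hy : y ∈ e.target) :
    ∃ v, quadForm (fun i j => g.comp e ![i, j] y) v < 0 := by
  obtain ⟨b, hb⟩ := hg.signature (e.symm y)
  refine ⟨fun i => chartEquiv he (e.map_target hy) (b 0) i, ?_⟩
  rw [quadForm_comp, ← eq_sum_coordFrame he (e.map_target hy), hb]
  simp

/-- Einstein's equation makes E equal to 8πT, so positivity of T on timelike vectors passes to E. -/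
theorem WeakEnergyCondition.quadForm_nonneg {g T : TensorField M 2} {Λ : ℝ}
    (hw : WeakEnergyCondition g T) (hE : EinsteinEquation Λ g T) (he : e ∈ smoothCharts M) {y : E4}
    (hy : y ∈ e.target) {v : Fin 4 → ℝ} (hv : quadForm (fun i j => g.comp e ![i, j] y) v < 0) :
    0 ≤ quadForm (fun i j => einstein (g.comp e) i j y + Λ * g.comp e ![i, j] y) v := by
  rw [quadForm_comp] at hv
  have h1 := hw _ _ hv
  rw [← quadForm_comp T] at h1
  have h2 : quadForm (fun i j => einstein (g.comp e) i j y + Λ * g.comp e ![i, j] y) v =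
      8 * Real.pi * quadForm (fun i j => T.comp e ![i, j] y) v := by
    simp only [quadForm, hE e he y hy, Finset.mul_sum]
    exact Finset.sum_congr rfl fun _ _ => Finset.sum_congr rfl fun _ _ => by ring
  rw [h2]
  positivity

variable [IsManifold 𝓘(ℝ, E4) ∞ M] [T2Space M]
  {h : Bundle.ContMDiffRiemannianMetric 𝓘(ℝ, E4) ∞ E4 (TangentSpace 𝓘(ℝ, E4) : M → Type)}
  {D : CovariantDerivative 𝓘(ℝ, E4) E4 (TangentSpace 𝓘(ℝ, E4) : M → Type)}
  [CovariantDerivative.ContMDiffCovariantDerivative D ∞]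
  {g : ℝ → TensorField M 2} (hg : ∀ s : ℝ, 0 ≤ s → IsLorentzMetric (g s))
  {C₁ : M → ℝ} (hC₁ : Continuous C₁)
  (h_small : ∀ s : ℝ, 0 < s → NormLE h (g s - g 0).comp (fun x => s * C₁ x))
  {C₂ : M → ℝ} (hC₂ : Continuous C₂)
  (h_deriv : ∀ s : ℝ, 0 < s → NormLE h (covDeriv D (g s - g 0)) C₂)

include hg

omit [IsManifold 𝓘(ℝ, E4) ∞ M] [T2Space M] in
theorem smooth_comp_sub {s : ℝ} (hs : 0 ≤ s) (he : e ∈ smoothCharts M) (idx : Fin 2 → Fin 4) :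
    ContDiffOn ℝ ∞ ((g s - g 0).comp e idx) e.target :=
  ((hg s hs).smooth e he idx).sub ((hg 0 le_rfl).smooth e he idx)

include hC₁ h_small

omit [T2Space M] in
theorem uniformO_comp_sub (he : e ∈ smoothCharts M) (idx : Fin 2 → Fin 4) :
    UniformO e.target 1 (fun s => (g s - g 0).comp e idx) :=
  NormLE.uniformO 1 hC₁ (A := fun s => (g s - g 0).comp) (by simpa using h_small) he idx
    fun _ hs => (smooth_comp_sub hg hs.le he idx).continuousOn

/-- ∂γ and ∇γ differ by connection coefficients times γ, hence by O(s). So the choice of derivative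
operator affects neither the bounds nor the weak limits. -/
theorem uniformO_connectionTerm (he : e ∈ smoothCharts M) (c i j : Fin 4) :
    UniformO e.target 1 (fun s => connectionTerm D e (g s - g 0) c i j) :=
  (UniformO.sum (t := Finset.univ) fun _ _ => (uniformO_comp_sub hg hC₁ h_small he _).const_mul
    (continuousOn_connectionCoeff he D _ _ _)).add
  (UniformO.sum (t := Finset.univ) fun _ _ => (uniformO_comp_sub hg hC₁ h_small he _).const_mul
    (continuousOn_connectionCoeff he D _ _ _))

theorem continuousOn_covDeriv (he : e ∈ smoothCharts M) (c i j : Fin 4) {s : ℝ} (hs : 0 < s) :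
    ContinuousOn (covDeriv D (g s - g 0) e ![c, i, j]) e.target :=
  (((smooth_comp_sub hg hs.le he _).partialDeriv e.open_target c).continuousOn.sub
    ((uniformO_connectionTerm hg hC₁ h_small he c i j).cont s hs)).congr
      fun _ hy => covDeriv_eq D _ he c i j hy

include hC₂ h_deriv

theorem uniformO_covDeriv (he : e ∈ smoothCharts M) (c i j : Fin 4) :
    UniformO e.target 0 (fun s => covDeriv D (g s - g 0) e ![c, i, j]) :=
  NormLE.uniformO 0 hC₂ (A := fun s => covDeriv D (g s - g 0)) (by simpa using h_deriv) he _
    fun _ hs => continuousOn_covDeriv hg hC₁ h_small he c i j hs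

/-- In each chart, the components of the metrics form a family of the type studied above. -/
theorem metricFamily_comp (he : e ∈ smoothCharts M) :
    MetricFamily e.target (fun s => (g s).comp e) where
  isOpen := e.open_target
  near i j :=
    { smooth := fun s hs => (hg s hs.le).smooth e he _
      smooth_lim := (hg 0 le_rfl).smooth e he _
      near := uniformO_comp_sub hg hC₁ h_small he _
      deriv := fun c => by
        have h1 := (uniformO_covDeriv hg hC₁ h_small hC₂ h_deriv he c i j).add
          (uniformO_connectionTerm (D := D) hg hC₁ h_small he c i j).to_zero
        have h2 := h1.add (UniformO.of_continuousOn
          (((hg 0 le_rfl).smooth e he ![i, j]).partialDeriv e.open_target c).continuousOn)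
        refine h2.congr fun s hs y hy => ?_
        have h3 := partialDeriv_sub (((hg s hs.le).smooth e he ![i, j]).diffAt e.open_target hy)
          (((hg 0 le_rfl).smooth e he ![i, j]).diffAt e.open_target hy) c
        have h4 := covDeriv_eq D (g s - g 0) he c i j hy
        have h5 : partialDeriv c ((g s - g 0).comp e ![i, j]) y =
          partialDeriv c (fun z => (g s).comp e ![i, j] z - (g 0).comp e ![i, j] z) y := rfl
        simp only [connectionTerm]
        linarith }
  symm s hs y _ i j := by
    simp only [comp_two]
    exact (hg s hs).symm _ _ _
  det s hs y hy := (hg s hs).det_ne_zero he hy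

/-- Products of coordinate derivatives and of covariant derivatives have the same weak limits. -/
theorem weakTo_gradDiff_mul {μ : TensorField M 6} (hμ : μ.Smooth)
    (h_quad : WeakLimit (fun s => quadraticProduct (covDeriv D (g s - g 0))) μ.comp)
    (he : e ∈ smoothCharts M) (a b c d i j : Fin 4) :
    WeakTo e.target (fun s y => gradDiff (fun s => (g s).comp e) s y a c d *
      gradDiff (fun s => (g s).comp e) s y b i j) (μ.comp e ![a, b, c, d, i, j]) := by
  have hcov := uniformO_covDeriv hg hC₁ h_small hC₂ h_deriv he
  have hcon := uniformO_connectionTerm (D := D) hg hC₁ h_small he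
  have h1 : WeakTo e.target (fun s y => covDeriv D (g s - g 0) e ![a, c, d] y *
      covDeriv D (g s - g 0) e ![b, i, j] y) (μ.comp e ![a, b, c, d, i, j]) :=
    h_quad.weakTo he ![a, b, c, d, i, j]
      (fun s hs => ((hcov a c d).cont s hs).mul ((hcov b i j).cont s hs))
      (hμ e he _).continuousOn
  -- In the product of two sums ∇γ + O(s), every term except ∇γ·∇γ is O(s).
  have h2 := (((hcov a c d).zero_mul_one (hcon b i j)).add
    ((hcon a c d).one_mul_zero (hcov b i j))).add
      ((hcon a c d).one_mul_zero (hcon b i j).to_zero)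
  refine (h1.add e.open_target h2.weakTo).congr (fun s hs y hy => ?_) (fun y _ => by simp)
  have h3 : ∀ c i j, gradDiff (fun s => (g s).comp e) s y c i j =
      covDeriv D (g s - g 0) e ![c, i, j] y + connectionTerm D e (g s - g 0) c i j y := by
    intro c i j
    rw [covDeriv_eq D (g s - g 0) he c i j hy, connectionTerm, sub_add_cancel]
    rfl
  simp only [h3]
  ring

end LorentzFamily

/-! ### Gluing local limits into tensor fields. -/

section WeakLimitsOfTensors

variable {M : Type*} [TopologicalSpace M] [ChartedSpace E4 M] {e e' : Chart M}

theorem comp_change (A : TensorField M 2) (he : e ∈ smoothCharts M) (he' : e' ∈ smoothCharts M)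
    {y : E4} (hy : y ∈ (e'.symm ≫ₕ e).source) (i j : Fin 4) :
    A.comp e' ![i, j] y = ∑ k, ∑ l,
      fderiv ℝ (e'.symm ≫ₕ e) y (EuclideanSpace.single i 1) k *
        fderiv ℝ (e'.symm ≫ₕ e) y (EuclideanSpace.single j 1) l *
          A.comp e ![k, l] ((e'.symm ≫ₕ e) y) := by
  have hs : e.symm ((e'.symm ≫ₕ e) y) = e'.symm y := e.left_inv hy.2
  rw [comp_two, coordFrame_change he he' hy, coordFrame_change he he' hy, multilinear_two_expand]
  refine Finset.sum_congr rfl fun k _ => Finset.sum_congr rfl fun l _ => ?_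
  rw [comp_two, hs]

/-- The weak limits of the components of tensor fields transform like a tensor field. -/
theorem weakTo_comp_change {T : ℝ → TensorField M 2} {F : Chart M → Fin 4 → Fin 4 → E4 → ℝ}
    (hT : ∀ e ∈ smoothCharts M, ∀ i j, WeakTo e.target (fun s => (T s).comp e ![i, j]) (F e i j))
    (he : e ∈ smoothCharts M) (he' : e' ∈ smoothCharts M)
    {y : E4} (hy : y ∈ (e'.symm ≫ₕ e).source) (i j : Fin 4) :
    F e' i j y = ∑ k, ∑ l,
      fderiv ℝ (e'.symm ≫ₕ e) y (EuclideanSpace.single i 1) k *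
        fderiv ℝ (e'.symm ≫ₕ e) y (EuclideanSpace.single j 1) l *
          F e k l ((e'.symm ≫ₕ e) y) := by
  set Φ := e'.symm ≫ₕ e with hΦ
  have hΦs : Φ.symm = e.symm ≫ₕ e' := by
    rw [hΦ, OpenPartialHomeomorph.trans_symm_eq_symm_trans_symm, OpenPartialHomeomorph.symm_symm]
  have h1 := transition_smooth he he'
  have h2 : ContDiffOn ℝ ∞ Φ.symm Φ.target := by
    have := transition_smooth he' he
    rwa [← hΦs] at this
  have hJ : ∀ i k, ContDiffOn ℝ ∞ (fun y => fderiv ℝ Φ y (EuclideanSpace.single i 1) k)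
      Φ.source := fun i k =>
    contDiffOn_euclidean.1 ((h1.fderiv_of_isOpen Φ.open_source (by simp)).clm_apply
      contDiffOn_const) k
  have hw : WeakTo Φ.source (fun s => (T s).comp e' ![i, j]) (fun y => ∑ k, ∑ l,
      fderiv ℝ Φ y (EuclideanSpace.single i 1) k * fderiv ℝ Φ y (EuclideanSpace.single j 1) l *
        F e k l (Φ y)) :=
    (WeakTo.sum Φ.open_source (t := Finset.univ) fun k _ =>
      WeakTo.sum Φ.open_source (t := Finset.univ) fun l _ =>
        (((hT e he k l).mono fun z hz => hz.1).comp_diffeo Φ h1 h2).smooth_mul Φ.open_source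
          ((hJ i k).mul (hJ j l))).congr
      (fun s _ y hy => comp_change (T s) he he' hy i j) (fun _ _ => rfl)
  exact ((hT e' he' i j).mono fun z hz => hz.1).unique Φ.open_source hw hy

/-- Weak limits of the components of a family of tensor fields in all charts are the components
of a tensor field. -/
theorem exists_tensorField_of_weakTo [IsManifold 𝓘(ℝ, E4) ∞ M] {T : ℝ → TensorField M 2}
    {F : Chart M → Fin 4 → Fin 4 → E4 → ℝ}
    (hT : ∀ e ∈ smoothCharts M, ∀ i j, WeakTo e.target (fun s => (T s).comp e ![i, j]) (F e i j)) :
    ∃ T₀ : TensorField M 2, ∀ e ∈ smoothCharts M, ∀ y ∈ e.target, ∀ i j,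
      T₀.comp e ![i, j] y = F e i j y := by
  have hc : ∀ x : M, chartAt E4 x ∈ smoothCharts M := fun x =>
    IsManifold.chart_mem_maximalAtlas x
  -- At each point the tensor is defined in the preferred chart there; the transformation law of
  -- weak limits gives its components in every other chart.
  refine ⟨fun x => ofComponents (chartBasis (hc x) (mem_chart_source E4 x))
    fun i j => F (chartAt E4 x) i j (chartAt E4 x x), fun e he y hy i j => ?_⟩
  set x := e.symm y
  have hy' : y ∈ (e.symm ≫ₕ chartAt E4 x).source := ⟨hy, mem_chart_source E4 x⟩
  rw [weakTo_comp_change hT (hc x) he hy', comp_two, coordFrame_change (hc x) he hy',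
    coordFrame_change (hc x) he hy', multilinear_two_expand]
  refine Finset.sum_congr rfl fun k _ => Finset.sum_congr rfl fun l _ => congrArg _ ?_
  rw [← chartBasis_apply (hc x) (mem_chart_source E4 x),
    ← chartBasis_apply (hc x) (mem_chart_source E4 x)]
  exact ofComponents_apply_basis _ _ k l

/-- The tensor field of backreaction terms. -/
theorem exists_backreaction [IsManifold 𝓘(ℝ, E4) ∞ M] (g : TensorField M 2) (μ : TensorField M 6)
    (c : ℝ) : ∃ t : TensorField M 2, ∀ e ∈ smoothCharts M, ∀ y ∈ e.target, ∀ i j,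
      t.comp e ![i, j] y =
        c * quadRicci (fun a b => inverseMetric (g.comp e) a b y) (μ.comp e · y) i j := by
  have hc : ∀ x : M, chartAt E4 x ∈ smoothCharts M := fun x =>
    IsManifold.chart_mem_maximalAtlas x
  -- The preferred chart supplies a basis at each point; invariance under change of basis lets any
  -- smooth chart compute the components.
  refine ⟨fun x => c • backreaction (g x) (μ x) (chartBasis (hc x) (mem_chart_source E4 x)),
    fun e he y hy i j => ?_⟩
  rw [comp_two, smul_apply, smul_eq_mul,
    backreaction_basis_change _ _ (chartBasis he (e.map_target hy)),
    ← chartBasis_apply he (e.map_target hy), ← chartBasis_apply he (e.map_target hy),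
    backreaction_apply_basis]
  simp only [← inverseMetric_eq_gramMatrix g he hy]
  congr 2
  ext idx
  simp only [TensorField.comp, Function.comp_def, chartBasis_apply]

theorem tensorField_ext [IsManifold 𝓘(ℝ, E4) ∞ M] {A B : TensorField M 2}
    (h : ∀ e ∈ smoothCharts M, ∀ y ∈ e.target, ∀ i j, A.comp e ![i, j] y = B.comp e ![i, j] y) :
    A = B := by
  ext1 x
  have hc : chartAt E4 x ∈ smoothCharts M := IsManifold.chart_mem_maximalAtlas x
  have hx := mem_chart_source E4 x
  refine multilinear_two_ext (chartBasis hc hx) fun i j => ?_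
  have := h _ hc _ ((chartAt E4 x).map_source hx) i j
  rw [comp_two, comp_two, (chartAt E4 x).left_inv hx] at this
  rwa [chartBasis_apply, chartBasis_apply]

theorem eq_pair (idx : Fin 2 → Fin 4) : idx = ![idx 0, idx 1] := by
  ext m; fin_cases m <;> rfl

end WeakLimitsOfTensors

/-! ### The main theorem. -/

theorem theorem1 {M : Type*} [TopologicalSpace M] [ChartedSpace E4 M]
    [IsManifold 𝓘(ℝ, E4) ∞ M] [T2Space M]
    -- the fixed Riemannian metric defining norms, and the fixed derivative operator
    (h : Bundle.ContMDiffRiemannianMetric 𝓘(ℝ, E4) ∞ E4 (TangentSpace 𝓘(ℝ, E4) : M → Type))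
    (D : CovariantDerivative 𝓘(ℝ, E4) E4 (TangentSpace 𝓘(ℝ, E4) : M → Type))
    [CovariantDerivative.ContMDiffCovariantDerivative D ∞]
    -- the one-parameter family of metrics, the matter and the cosmological constant
    (g T : ℝ → TensorField M 2) (Λ : ℝ)
    (hg : ∀ s : ℝ, 0 ≤ s → IsLorentzMetric (g s))
    -- (i)
    (h_einstein : ∀ s : ℝ, 0 < s → EinsteinEquation Λ (g s) (T s))
    (h_wec : ∀ s : ℝ, 0 < s → WeakEnergyCondition (g s) (T s))
    -- (ii)
    (C₁ : M → ℝ) (hC₁ : ContMDiff 𝓘(ℝ, E4) 𝓘(ℝ, ℝ) ∞ C₁) (hC₁_pos : ∀ x, 0 < C₁ x)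
    (h_small : ∀ s : ℝ, 0 < s → NormLE h (g s - g 0).comp (fun x => s * C₁ x))
    -- (iii)
    (C₂ : M → ℝ) (hC₂ : ContMDiff 𝓘(ℝ, E4) 𝓘(ℝ, ℝ) ∞ C₂) (hC₂_pos : ∀ x, 0 < C₂ x)
    (h_deriv : ∀ s : ℝ, 0 < s → NormLE h (covDeriv D (g s - g 0)) C₂)
    -- (iv)
    (μ : TensorField M 6) (hμ : μ.Smooth)
    (h_quad : WeakLimit (fun s => quadraticProduct (covDeriv D (g s - g 0))) μ.comp) :
    (∃! t₀ : TensorField M 2, IsEffectiveStressEnergy Λ g T t₀) ∧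
      ∀ t₀ : TensorField M 2, IsEffectiveStressEnergy Λ g T t₀ → Traceless (g 0) t₀ := by
  set Q : Chart M → Fin 4 → Fin 4 → E4 → ℝ := fun e i j y =>
    quadRicci (fun a b => inverseMetric ((g 0).comp e) a b y) (μ.comp e · y) i j with hQ
  -- `F` is the weak limit of T read off from Einstein's equation; the averaged equation then forces
  -- the effective tensor to be −Q/8π.
  set F : Chart M → Fin 4 → Fin 4 → E4 → ℝ := fun e i j y =>
    1 / (8 * Real.pi) * (einstein ((g 0).comp e) i j y + Q e i j y + Λ * (g 0).comp e ![i, j] y)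
    with hF
  have hG : ∀ e ∈ smoothCharts M, MetricFamily e.target (fun s => (g s).comp e) := fun e he =>
    metricFamily_comp hg hC₁.continuous h_small hC₂.continuous h_deriv he
  have hm := fun e (he : e ∈ smoothCharts M) =>
    weakTo_gradDiff_mul hg hC₁.continuous h_small hC₂.continuous h_deriv hμ h_quad he
  have hR := fun e (he : e ∈ smoothCharts M) => (hG e he).l1Bounded_ricci Λ
    (fun y hy => (hg 0 le_rfl).exists_timelike he hy)
    (fun s hs y hy v hv => (h_wec s hs).quadForm_nonneg (h_einstein s hs) he hy hv)
  -- No regularity of T(s) is assumed; its continuity is inherited from the left side of Einstein's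
  -- equation.
  have hT : ∀ e ∈ smoothCharts M, ∀ i j,
      WeakTo e.target (fun s => (T s).comp e ![i, j]) (F e i j) := by
    intro e he i j
    have hg0 : WeakTo e.target (fun s => (g s).comp e ![i, j]) ((g 0).comp e ![i, j]) :=
      ((((hG e he).near i j).near.weakTo).add e.open_target (WeakTo.const
        ((hG e he).smooth le_rfl i j).continuousOn)).congr (fun s _ y _ => by simp)
          (fun y _ => by simp)
    refine ((((hG e he).weakTo_einstein (hm e he) (hR e he) i j).add e.open_target
      (hg0.const_mul e.open_target Λ)).const_mul e.open_target (1 / (8 * Real.pi))).congr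
        (fun s hs y hy => ?_) (fun y _ => rfl)
    beta_reduce
    rw [h_einstein s hs e he y hy]
    field_simp
  have hQs : ∀ e ∈ smoothCharts M, ∀ i j, ContDiffOn ℝ ∞ (Q e i j) e.target := fun e he i j =>
    (hG e he).smooth_quadRicci (hμ e he) i j
  have hFs : ∀ e ∈ smoothCharts M, ∀ i j, ContDiffOn ℝ ∞ (F e i j) e.target := fun e he i j =>
    contDiffOn_const.mul ((((hG e he).smooth_einstein le_rfl i j).add (hQs e he i j)).add
      (contDiffOn_const.mul ((hG e he).smooth le_rfl i j)))
  have hadd : ∀ (A B : TensorField M 2) e i j y,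
      (A + B).comp e ![i, j] y = A.comp e ![i, j] y + B.comp e ![i, j] y := fun _ _ _ _ _ _ => rfl
  -- Any admissible averaged T₀ has components `F` by uniqueness of weak limits, so the components
  -- of t₀ are determined. Both uniqueness and tracelessness rest on this.
  have hcomp : ∀ t₀, IsEffectiveStressEnergy Λ g T t₀ → ∀ e ∈ smoothCharts M, ∀ y ∈ e.target,
      ∀ i j, t₀.comp e ![i, j] y = -(1 / (8 * Real.pi)) * Q e i j y := by
    rintro t₀ ⟨-, T₀, hT₀s, hT₀, hE⟩ e he y hy i j
    have h1 := (hT₀.weakTo he ![i, j] (hT e he i j).cont (hT₀s e he _).continuousOn).unique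
      e.open_target (hT e he i j) hy
    have h2 := hE e he y hy i j
    rw [hadd, h1] at h2
    simp only [hF] at h2
    field_simp at h2 ⊢
    linarith
  refine ⟨?_, ?_⟩
  · obtain ⟨T₀, hT₀⟩ := exists_tensorField_of_weakTo hT
    obtain ⟨t₀, ht₀⟩ := exists_backreaction (g 0) μ (-(1 / (8 * Real.pi)))
    refine ⟨t₀, ⟨fun e he idx => ?_, T₀, fun e he idx => ?_, weakLimit_of_weakTo
      fun e he idx => ?_, fun e he y hy i j => ?_⟩, fun t ht => tensorField_ext
        fun e he y hy i j => (hcomp t ht e he y hy i j).trans (ht₀ e he y hy i j).symm⟩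
    · rw [eq_pair idx]
      exact (contDiffOn_const.mul (hQs e he _ _)).congr fun y hy => ht₀ e he y hy _ _
    · rw [eq_pair idx]
      exact (hFs e he _ _).congr fun y hy => hT₀ e he y hy _ _
    · rw [eq_pair idx]
      exact (hT e he _ _).congr (fun _ _ _ _ => rfl) fun y hy => hT₀ e he y hy _ _
    · rw [hadd, hT₀ e he y hy, ht₀ e he y hy]
      simp only [hF, hQ]
      field_simp
      ring
  · intro t₀ ht₀ e he y hy
    simp only [metricTrace, hcomp t₀ ht₀ e he y hy]
    have := (hG e he).trace_quadRicci (hm e he) (hR e he) hy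
    calc _ = -(1 / (8 * Real.pi)) * ∑ i, ∑ j, inverseMetric ((g 0).comp e) i j y * Q e i j y := by
          simp only [Finset.mul_sum]
          exact Finset.sum_congr rfl fun _ _ => Finset.sum_congr rfl fun _ _ => by ring
      _ = 0 := by rw [this, mul_zero]
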